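/- Let $U=\mathbb{C}^a\times\prod_{i=1}^k\mathbb{P}^{d_i}$ (for $k=0$ an affine space, for $a=0$ a product of projective spaces), and let $\psi=[\psi_1:\dots:\psi_n]:U\dashrightarrow\mathbb{P}^{n-1}$ be a rational map over $\mathbb{C}$, given by polynomials $\psi_1,\dots,\psi_n$ in the coordinates of $U$ that are multihomogeneous of one common multidegree in the coordinates of the projective factors. Let $V=\overline{\operatorname{im}\psi}$ be the Zariski closure of its image and assume that $\psi:U\dashrightarrow V$ is birational and that $V$ is not contained in the isotropic quadric $Q=\{y\in\mathbb{P}^{n-1}: y^Ty=0\}$. Let $c$ be the codimension of $V$ in $\mathbb{P}^{n-1}$ and let $V_{\rm reg}$ be the set of regular points of $V$. Write $\psi^{-1}(V_{\rm reg}\setminus Q)$ for the set of $x\in U$ with $\psi_j(x)\neq 0$ for some $j$ and $\psi(x)\in V_{\rm reg}\setminus Q$. For a nonzero symmetric matrix $H\in\mathrm{Sym}^2(\mathbb{C}^n)$, a critical point on $V$ is a point $y\in V_{\rm reg}\setminus Q$ at which the gradient of $y\mapsto \frac{y^THy}{y^Ty}$ is orthogonal to the tangent space of $V$. The RR degree of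 $V$ is the number of critical points on $V$ for general $H$. Let $R_H(x)=\frac{\psi(x)^TH\psi(x)}{\psi(x)^T\psi(x)}$. A parametric critical point for $H$ is a point $x\in\psi^{-1}(V_{\rm reg}\setminus Q)$ at which $\psi$ is immersive (its differential, as a map from $U$ to $\mathbb{P}^{n-1}$, is injective) and $\nabla_xR_H(x)=0$. The parametric RR correspondence is the Zariski closure $$\mathcal{P}_V=\overline{\{(x,H): x \text{ is a parametric critical point for } H\}}\subseteq U\times\mathbb{P}(\mathrm{Sym}^2(\mathbb{C}^n)).$$ Then: 1. $\mathcal{P}_V$ is irreducible of dimension $\binom{n+1}{2}-1$. 2. The first projection $\gamma_1:\mathcal{P}_V\to U$ is, over the Zariski open set $\psi^{-1}(V_{\rm reg}\setminus Q)$, a Zariski locally trivial bundle of projective spaces of dimension $\binom{n+1}{2}-n+c$: its fibres are the projectivizations of the fibres of an algebraic vector subbundle, of linear rank $\binom{n+1}{2}-n+c+1$, of the trivial bundle with fibre $\mathrm{Sym}^2(\mathbb{C}^n)$. 3. The RR degree of $V$ is well defined: there is exactly one integer $D$ such that, for all $H$ in some nonempty Zariski open subset of $\mathbb{P}(\mathrm{Sym}^2(\mathbb{C}^n))$,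 the set of critical points on $V$ is finite of cardinality $D$. For all $H$ in some nonempty Zariski open subset of $\mathbb{P}(\mathrm{Sym}^2(\mathbb{C}^n))$, the fibre of the second projection $\gamma_2:\mathcal{P}_V\to\mathbb{P}(\mathrm{Sym}^2(\mathbb{C}^n))$ over $H$ is finite and its cardinality is the RR degree of $V$. -/

import Mathlib

open MvPolynomial
open scoped LinearAlgebra.Projectivization

noncomputable section

namespace RayleighRitz

/-! ## Spaces with homogeneous coordinates and their Zariski topology -/

/-- A space `X` whose points are described by (affine and homogeneous) coordinates indexed by `σ`:
`Rep v x` says that the vector `v` is a coordinate vector of the point `x`. -/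
class HomCoords (X : Type) (σ : outParam Type) where
  /-- `v` is a coordinate vector of `x`. -/
  Rep : (σ → ℂ) → X → Prop

/-- Homogeneous coordinates on the projective space of `ℂ^τ`. -/
instance projCoords (τ : Type) : HomCoords (ℙ ℂ (τ → ℂ)) τ where
  Rep v x := ∃ hv : v ≠ 0, Projectivization.mk ℂ v hv = x

/-- Coordinates on a product of two spaces. -/
instance prodCoords {X Y σ τ : Type} [HomCoords X σ] [HomCoords Y τ] :
    HomCoords (X × Y) (σ ⊕ τ) where
  Rep v z := HomCoords.Rep (fun s => v (Sum.inl s)) z.1 ∧ HomCoords.Rep (fun t => v (Sum.inr t)) z.2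

/-- The space `ℂ^a × ∏ᵢ ℙ^{dᵢ}`. For `k = 0` it is the affine space `ℂ^a`, and for `a = 0` it is a
product of projective spaces. -/
structure ParamSpace {k : ℕ} (a : ℕ) (d : Fin k → ℕ) where
  /-- the affine part of a point -/
  aff : Fin a → ℂ
  /-- the projective components of a point -/
  proj : ∀ i : Fin k, ℙ ℂ (Fin (d i + 1) → ℂ)

/-- The index set of the coordinates on `ℂ^a × ∏ᵢ ℙ^{dᵢ}`. -/
abbrev Coord {k : ℕ} (a : ℕ) (d : Fin k → ℕ) : Type := Fin a ⊕ (Σ i : Fin k, Fin (d i + 1))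

instance paramCoords {k : ℕ} (a : ℕ) (d : Fin k → ℕ) :
    HomCoords (ParamSpace a d) (Coord a d) where
  Rep v x := (∀ s, v (Sum.inl s) = x.aff s) ∧
    ∀ i, HomCoords.Rep (fun j => v (Sum.inr ⟨i, j⟩)) (x.proj i)

/-- The Zariski topology: `Z` is closed if it is the zero locus of a set of polynomials in the
coordinates. (The vanishing of all polynomials of `S` at a coordinate vector of `x` is required not
to depend on the coordinate vector chosen, so that this is the quotient of the Zariski topology on
the set of all coordinate vectors.) -/
@[reducible] def zariski (X : Type) {σ : Type} [HomCoords X σ] : TopologicalSpace X :=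
  TopologicalSpace.ofClosed
    {Z | ∃ S : Set (MvPolynomial σ ℂ), ∀ (v : σ → ℂ) (x : X), HomCoords.Rep v x →
      (x ∈ Z ↔ ∀ f ∈ S, eval v f = 0)}
    ⟨{1}, by simp⟩
    (by
      intro A hA
      choose! S hS using fun Z (hZ : Z ∈ A) => hA hZ
      refine ⟨⋃ Z ∈ A, S Z, fun v x hx => ?_⟩
      simp only [Set.mem_sInter, Set.mem_iUnion, exists_prop]
      constructor
      · rintro h f ⟨Z, hZ, hf⟩
        exact (hS Z hZ v x hx).1 (h Z hZ) f hf
      · intro h Z hZ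
        exact (hS Z hZ v x hx).2 fun f hf => h f ⟨Z, hZ, hf⟩)
    (by
      rintro A ⟨S, hS⟩ B ⟨T, hT⟩
      refine ⟨{h | ∃ f ∈ S, ∃ g ∈ T, h = f * g}, fun v x hx => ?_⟩
      rw [Set.mem_union, hS v x hx, hT v x hx]
      constructor
      · rintro (h | h) _ ⟨f, hf, g, hg, rfl⟩
        · simp [h f hf]
        · simp [h g hg]
      · intro h
        by_contra! hcon
        obtain ⟨⟨f, hf, hf0⟩, g, hg, hg0⟩ := hcon
        have := h _ ⟨f, hf, g, hg, rfl⟩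
        rw [map_mul] at this
        exact (mul_ne_zero hf0 hg0) this)

/-- `W` is open in the Zariski topology. -/
def ZOpen {X σ : Type} [HomCoords X σ] (W : Set X) : Prop := @IsOpen X (zariski X) W

/-- The closure in the Zariski topology. -/
def zclosure {X σ : Type} [HomCoords X σ] (Z : Set X) : Set X := @closure X (zariski X) Z

/-- Irreducibility in the Zariski topology. -/
def ZIrreducible {X σ : Type} [HomCoords X σ] (Z : Set X) : Prop :=
  @IsIrreducible X (zariski X) Z

/-- The Krull dimension of a subset in its Zariski topology. -/
def zdim {X σ : Type} [HomCoords X σ] (Z : Set X) : WithBot ℕ∞ :=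
  @topologicalKrullDim Z (@instTopologicalSpaceSubtype X (fun x => x ∈ Z) (zariski X))

/-! ## Symmetric matrices and the Rayleigh quotient -/

/-- The projective space `ℙ^{n-1}`. -/
abbrev PSpace (n : ℕ) : Type := ℙ ℂ (Fin n → ℂ)

/-- The projective space of complex symmetric `n × n` matrices; the coordinates are the entries
`h_{ij} = h_{ji}`, indexed by unordered pairs. -/
abbrev PSym (n : ℕ) : Type := ℙ ℂ (Sym2 (Fin n) → ℂ)

/-- The symmetric matrix with the given entries. -/
def symMatrix {n : ℕ} (h : Sym2 (Fin n) → ℂ) : Matrix (Fin n) (Fin n) ℂ :=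
  Matrix.of fun i j => h s(i, j)

theorem isSymm_iff_exists_symMatrix {n : ℕ} (A : Matrix (Fin n) (Fin n) ℂ) :
    A.IsSymm ↔ ∃ h, symMatrix h = A := by
  constructor
  · intro hA
    refine ⟨Sym2.lift ⟨fun i j => A i j, fun i j => (hA.apply j i)⟩, ?_⟩
    ext i j
    simp [symMatrix]
  · rintro ⟨h, rfl⟩
    ext i j
    simp [symMatrix, Sym2.eq_swap]

/-- The Rayleigh quotient `yᵀ A y / yᵀ y`. -/
def rayleigh {n : ℕ} (A : Matrix (Fin n) (Fin n) ℂ) (y : Fin n → ℂ) : ℂ :=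
  dotProduct y (A.mulVec y) / dotProduct y y

/-- The isotropic quadric `yᵀ y = 0`. -/
def isotropicQuadric (n : ℕ) : Set (PSpace n) :=
  {y | ∃ w, HomCoords.Rep w y ∧ dotProduct w w = 0}

/-! ## Regular points and critical points of a projective variety -/

/-- The polynomials that vanish on `V`: the (homogeneous) ideal of `V`. -/
def vanishingPolys {n : ℕ} (V : Set (PSpace n)) : Set (MvPolynomial (Fin n) ℂ) :=
  {f | ∀ y ∈ V, ∀ w, HomCoords.Rep w y → eval w f = 0}

/-- The gradient of a polynomial at a point. -/
def grad {n : ℕ} (f : MvPolynomial (Fin n) ℂ) (w : Fin n → ℂ) : Fin n → ℂ :=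
  fun j => eval w (pderiv j f)

/-- The row span at `w` of the Jacobian matrix of the ideal of `V`. -/
def jacSpan {n : ℕ} (V : Set (PSpace n)) (w : Fin n → ℂ) : Submodule ℂ (Fin n → ℂ) :=
  Submodule.span ℂ {g | ∃ f ∈ vanishingPolys V, g = grad f w}

/-- The regular locus of an irreducible projective variety `V ⊆ ℙ^{n-1}`: the points at which the
Jacobian matrix of the ideal of `V` has rank equal to the codimension `n - 1 - dim V`. -/
def regularLocus {n : ℕ} (V : Set (PSpace n)) : Set (PSpace n) :=
  {y | y ∈ V ∧ ∃ w, HomCoords.Rep w y ∧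
    (Module.finrank ℂ (jacSpan V w) : WithBot ℕ∞) + zdim V + 1 = n}

/-- The tangent space at `w` of the affine cone over `V`. -/
def coneTangent {n : ℕ} (V : Set (PSpace n)) (w : Fin n → ℂ) : Set (Fin n → ℂ) :=
  {u | ∀ f ∈ vanishingPolys V, dotProduct (grad f w) u = 0}

/-- The complex critical points on `V` of the Rayleigh quotient of `H`: the regular nonisotropic
points at which the gradient of the Rayleigh quotient is orthogonal to the tangent space of `V`. -/
def criticalPoints {n : ℕ} (V : Set (PSpace n)) (H : PSym n) : Set (PSpace n) :=
  {y | y ∈ regularLocus V ∧ y ∉ isotropicQuadric n ∧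
    ∃ w h, HomCoords.Rep w y ∧ HomCoords.Rep h H ∧
      ∀ u ∈ coneTangent V w, fderiv ℂ (rayleigh (symMatrix h)) w u = 0}

/-- `P` holds for a general point of `X`: it holds on a nonempty Zariski open subset. -/
def ForGeneral {X σ : Type} [HomCoords X σ] (P : X → Prop) : Prop :=
  ∃ G : Set X, ZOpen G ∧ G.Nonempty ∧ ∀ x ∈ G, P x

/-- `D` is the Rayleigh–Ritz degree of `V`: for a general symmetric matrix `H` there are exactly `D`
critical points. -/
def IsRRDegree {n : ℕ} (V : Set (PSpace n)) (D : ℕ) : Prop :=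
  ForGeneral fun H : PSym n => (criticalPoints V H).Finite ∧ (criticalPoints V H).ncard = D

/-! ## Birational parametrizations -/

/-- The multigrading on the polynomials in the coordinates of `ℂ^a × ∏ᵢ ℙ^{dᵢ}`: affine coordinates
have degree `0`, the coordinates of the `i`-th projective space have the `i`-th unit vector as
degree. -/
def weight {k : ℕ} (a : ℕ) (d : Fin k → ℕ) : Coord a d → (Fin k → ℕ) :=
  Sum.elim (fun _ => 0) (fun t => Pi.single t.1 1)

/-- A family of polynomials that are multihomogeneous of one common multidegree. -/
def IsMultihomogeneous {k a : ℕ} {d : Fin k → ℕ} {ι : Type}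
    (F : ι → MvPolynomial (Coord a d) ℂ) : Prop :=
  ∃ D : Fin k → ℕ, ∀ j, IsWeightedHomogeneous (weight a d) (F j) D

/-- The value of a tuple of polynomials at a coordinate vector. -/
def evalTuple {σ ι : Type} (F : ι → MvPolynomial σ ℂ) (v : σ → ℂ) : ι → ℂ :=
  fun j => eval v (F j)

/-- The rational map given by `ψ` is defined at `x` and has the value `y` there. -/
def MapsPoint {k a n : ℕ} {d : Fin k → ℕ} (ψ : Fin n → MvPolynomial (Coord a d) ℂ)
    (x : ParamSpace a d) (y : PSpace n) : Prop :=
  ∃ v, HomCoords.Rep v x ∧ HomCoords.Rep (evalTuple ψ v) y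

/-- The closure of the image of `ψ`. -/
def imageClosure {k a n : ℕ} {d : Fin k → ℕ} (ψ : Fin n → MvPolynomial (Coord a d) ℂ) :
    Set (PSpace n) :=
  zclosure {y | ∃ x, MapsPoint ψ x y}

/-- The rational map `ψ` from `ℂ^a × ∏ᵢ ℙ^{dᵢ}` to the closure of its image is birational: there
is a rational map in the other direction, whose affine coordinates are the quotients `p_s / q` of
forms of equal degree and whose component in `ℙ^{dᵢ}` is given by forms `p_{i,j}` of equal degree,
such that the composition is defined and the identity on a nonempty Zariski open set. -/
def IsBirational {k a n : ℕ} {d : Fin k → ℕ} (ψ : Fin n → MvPolynomial (Coord a d) ℂ) : Prop :=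
  ∃ (p : Coord a d → MvPolynomial (Fin n) ℂ) (q : MvPolynomial (Fin n) ℂ) (e : ℕ) (E : Fin k → ℕ),
    q.IsHomogeneous e ∧ (∀ s, (p (Sum.inl s)).IsHomogeneous e) ∧
    (∀ i j, (p (Sum.inr ⟨i, j⟩)).IsHomogeneous (E i)) ∧
    ∃ W : Set (ParamSpace a d), ZOpen W ∧ W.Nonempty ∧ ∀ x ∈ W, ∃ v,
      HomCoords.Rep v x ∧ evalTuple ψ v ≠ 0 ∧ eval (evalTuple ψ v) q ≠ 0 ∧
      HomCoords.Rep (Sum.elim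
        (fun s => eval (evalTuple ψ v) (p (Sum.inl s)) / eval (evalTuple ψ v) q)
        (fun t => eval (evalTuple ψ v) (p (Sum.inr t)))) x

/-- The preimage under `ψ` of the regular nonisotropic points of the closure of its image. -/
def regularDomain {k a n : ℕ} {d : Fin k → ℕ} (ψ : Fin n → MvPolynomial (Coord a d) ℂ) :
    Set (ParamSpace a d) :=
  {x | ∃ y, MapsPoint ψ x y ∧ y ∈ regularLocus (imageClosure ψ) ∧ y ∉ isotropicQuadric n}

/-- The rational map given by `ψ` is immersive at the point with coordinate vector `v`: the vector
`ψ(v)` and the columns of the Jacobian matrix of `ψ` at `v` span a space of dimension `dim U + 1`,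
where `U = ℂ^a × ∏ᵢ ℙ^{dᵢ}`. -/
def IsImmersiveAt {k a n : ℕ} {d : Fin k → ℕ} (ψ : Fin n → MvPolynomial (Coord a d) ℂ)
    (v : Coord a d → ℂ) : Prop :=
  Module.finrank ℂ (Submodule.span ℂ ({evalTuple ψ v} ∪
    Set.range fun s : Coord a d => evalTuple (fun j => pderiv s (ψ j)) v)) = a + (∑ i, d i) + 1

/-- The parametric Rayleigh–Ritz correspondence: the closure of the set of pairs `(x, H)` for which
`x` is a critical point of `R_H(x) = ψ(x)ᵀ H ψ(x) / ψ(x)ᵀ ψ(x)`, that is, a point whose image is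
regular and nonisotropic, at which `ψ` is immersive and all the partial derivatives of `R_H`
vanish. -/
def parametricCorrespondence {k a n : ℕ} {d : Fin k → ℕ}
    (ψ : Fin n → MvPolynomial (Coord a d) ℂ) : Set (ParamSpace a d × PSym n) :=
  zclosure {z | z.1 ∈ regularDomain ψ ∧ ∃ v h, HomCoords.Rep v z.1 ∧ HomCoords.Rep h z.2 ∧
    IsImmersiveAt ψ v ∧
    fderiv ℂ (fun u : Coord a d → ℂ => rayleigh (symMatrix h) (evalTuple ψ u)) v = 0}

/-- Over the Zariski open set `O`, the set `P` is the projectivization of an algebraic vector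
subbundle of the trivial bundle with fibre `ℂ^τ`, with `r`-dimensional projective spaces as fibres:
locally on `O` there are `r + 1` sections with (multihomogeneous) polynomial coordinates which are
linearly independent at every point `x` and span the linear space whose projectivization is the
fibre of `P` over `x`. -/
def IsProjectiveBundleOver {k a : ℕ} {d : Fin k → ℕ} {τ : Type}
    (P : Set (ParamSpace a d × ℙ ℂ (τ → ℂ))) (O : Set (ParamSpace a d)) (r : ℕ) : Prop :=
  ∀ x₀ ∈ O, ∃ W : Set (ParamSpace a d), ZOpen W ∧ x₀ ∈ W ∧ W ⊆ O ∧
    ∃ F : Fin (r + 1) → τ → MvPolynomial (Coord a d) ℂ, (∀ l, IsMultihomogeneous (F l)) ∧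
      ∀ x ∈ W, ∀ v, HomCoords.Rep v x →
        LinearIndependent ℂ (fun l => evalTuple (F l) v) ∧
        ∀ (H : ℙ ℂ (τ → ℂ)) (h : τ → ℂ), HomCoords.Rep h H →
          ((x, H) ∈ P ↔ h ∈ Submodule.span ℂ (Set.range fun l => evalTuple (F l) v))

end RayleighRitz

end

open RayleighRitz

noncomputable section

namespace RayleighRitz

/-! ## Multiprojective coordinates -/

/-! Let `w` be a nonisotropic coordinate vector of a point of `V`, and let `N` be the span of the
gradients at `w` of the ideal of `V`, that is, the orthogonal complement of the tangent space of the
cone. The gradient of the Rayleigh quotient at `w` is a multiple of (wᵀw)Hw − (wᵀHw)w, so `w` is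
critical for `H` exactly when Hw ∈ N + ℂw (`mem_critSpace_iff`). The sum is direct because N ⟂ w and
wᵀw ≠ 0, and H ↦ Hw is onto ℂⁿ; hence the critical matrices form a linear space whose rank depends
only on dim N (`finrank_critSpace`). It is spanned by values of polynomial sections that exist along
the whole cone (`critSpace_le_span`), and this makes it a vector bundle over the regular
nonisotropic points.

Birationality provides an affine chart of `U` in which ψ is a polynomial map with a rational inverse
on a principal open set (`InvertibleParam`). The parameters `t` are then coordinates on an open part
of `V`: their number is dim V, and carrying the inverse over to dual numbers shows that every
tangent vector comes from the parameters (`exists_differential_eq`). So these points are regular and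
ψ is immersive there. After shrinking the open set, r + 1 sections form a frame, and the bundle is
the image of a polynomial map in `t` and the frame coefficients `s`. `ParamBundle` records this
situation; it occurs once with base in `U` and once with base in `V`. Irreducibility follows because
the vanishing ideal is the kernel of a map to a polynomial ring, and the dimension is a count of
parameters. The correspondence is the closure of this bundle (`correspondence_eq`), since sections
carry critical pairs outside the chart back into it; the same sections compute the fibres over the
whole regular domain (`isProjectiveBundleOver`).

There are as many parameters (t, s) as entries of a symmetric matrix, so the projection to `H`
becomes a polynomial map between affine spaces of equal dimension. Its general fibre has constant
cardinality by the primitive element theorem (`exists_card_fibre`). The part of the closure outside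
the bundle is too small to dominate the matrices (`exists_generic`). Critical points on `V` and
points of the fibre of γ₂ are therefore counted by the same parameters `t` (`exists_degree`).

Dimensions are handled by `Dep I e`, which says that the transcendence degree modulo `I` is less
than `e`. Coordinate vectors carry one extra degree of freedom for each homogeneous block. -/

/-- Rescale the coordinates block by block. -/
def scale {σ B : Type} (blk : σ → Option B) (l : B → ℂ) (v : σ → ℂ) : σ → ℂ :=
  fun s => (blk s).elim 1 l * v s

/-- The coordinates are divided into affine ones and blocks of homogeneous ones, and the coordinate
vectors of a point form an orbit of the torus that rescales the blocks. -/
class MultiProj (X : Type) {σ : outParam Type} (B : outParam Type) [HomCoords X σ] where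
  /-- the block of a coordinate -/
  blk : σ → Option B
  rep_exists : ∀ x : X, ∃ v, HomCoords.Rep v x
  rep_inj : ∀ {v : σ → ℂ} {x y : X}, HomCoords.Rep v x → HomCoords.Rep v y → x = y
  rep_scale : ∀ {v : σ → ℂ} {x : X} {l : B → ℂ}, HomCoords.Rep v x → (∀ b, l b ≠ 0) →
    HomCoords.Rep (scale blk l v) x
  rep_eq_scale : ∀ {v w : σ → ℂ} {x : X}, HomCoords.Rep v x → HomCoords.Rep w x →
    ∃ l : B → ℂ, (∀ b, l b ≠ 0) ∧ w = scale blk l v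
  rep_ne_zero : ∀ {v : σ → ℂ} {x : X}, HomCoords.Rep v x → ∀ b, ∃ s, blk s = some b ∧ v s ≠ 0
  exists_point : ∀ {v : σ → ℂ}, (∀ b, ∃ s, blk s = some b ∧ v s ≠ 0) → ∃ x : X, HomCoords.Rep v x

theorem proj_rep_smul {τ : Type} {v : τ → ℂ} {x : ℙ ℂ (τ → ℂ)} {c : ℂ} (h : HomCoords.Rep v x)
    (hc : c ≠ 0) : HomCoords.Rep (c • v) x := by
  obtain ⟨hv, rfl⟩ := h
  exact ⟨smul_ne_zero hc hv, (Projectivization.mk_eq_mk_iff' ℂ _ _ _ _).2 ⟨c, rfl⟩⟩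

theorem proj_rep_eq_smul {τ : Type} {v w : τ → ℂ} {x : ℙ ℂ (τ → ℂ)} (h : HomCoords.Rep v x)
    (h' : HomCoords.Rep w x) : ∃ c : ℂ, c ≠ 0 ∧ w = c • v := by
  obtain ⟨hv, rfl⟩ := h
  obtain ⟨hw, h⟩ := h'
  obtain ⟨c, hc⟩ := (Projectivization.mk_eq_mk_iff' ℂ _ _ _ _).1 h
  refine ⟨c, ?_, hc.symm⟩
  rintro rfl
  exact hw (by rw [← hc, zero_smul])

theorem proj_rep_ne_zero {τ : Type} {v : τ → ℂ} {x : ℙ ℂ (τ → ℂ)} (h : HomCoords.Rep v x) :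
    v ≠ 0 := h.1

theorem proj_rep_inj {τ : Type} {v : τ → ℂ} {x y : ℙ ℂ (τ → ℂ)} (h : HomCoords.Rep v x)
    (h' : HomCoords.Rep v y) : x = y := by
  obtain ⟨hv, rfl⟩ := h
  obtain ⟨_, h⟩ := h'
  exact h

theorem proj_rep_exists {τ : Type} (x : ℙ ℂ (τ → ℂ)) : ∃ v : τ → ℂ, HomCoords.Rep v x := by
  induction x using Projectivization.ind with
  | h v hv => exact ⟨v, hv, rfl⟩

theorem proj_exists_point {τ : Type} {v : τ → ℂ} (hv : v ≠ 0) :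
    ∃ x : ℙ ℂ (τ → ℂ), HomCoords.Rep v x := ⟨_, hv, rfl⟩

instance projMulti (τ : Type) : MultiProj (ℙ ℂ (τ → ℂ)) Unit where
  blk _ := some ()
  rep_exists := proj_rep_exists
  rep_inj := proj_rep_inj
  rep_scale {v x l} h hl := by
    have := proj_rep_smul h (hl ())
    exact this
  rep_eq_scale {v w x} h h' := by
    obtain ⟨c, hc, rfl⟩ := proj_rep_eq_smul h h'
    exact ⟨fun _ => c, fun _ => hc, rfl⟩
  rep_ne_zero {v x} h b := by
    obtain ⟨s, hs⟩ := Function.ne_iff.1 (proj_rep_ne_zero h)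
    exact ⟨s, rfl, hs⟩
  exists_point {v} h := by
    obtain ⟨s, -, hs⟩ := h ()
    exact proj_exists_point (Function.ne_iff.2 ⟨s, hs⟩)

instance paramMulti {k : ℕ} (a : ℕ) (d : Fin k → ℕ) : MultiProj (ParamSpace a d) (Fin k) where
  blk := Sum.elim (fun _ => none) (fun t => some t.1)
  rep_exists x := by
    choose v hv using fun i => proj_rep_exists (x.proj i)
    exact ⟨Sum.elim x.aff fun t => v t.1 t.2, fun s => rfl, fun i => hv i⟩
  rep_inj {v x y} h h' := by
    obtain ⟨xa, xp⟩ := x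
    obtain ⟨ya, yp⟩ := y
    obtain rfl : xa = ya := funext fun s => (h.1 s).symm.trans (h'.1 s)
    obtain rfl : xp = yp := funext fun i => proj_rep_inj (h.2 i) (h'.2 i)
    rfl
  rep_scale {v x l} h hl := by
    refine ⟨fun s => ?_, fun i => ?_⟩
    · simpa [scale] using h.1 s
    · exact proj_rep_smul (h.2 i) (hl i)
  rep_eq_scale {v w x} h h' := by
    choose l hl hl' using fun i => proj_rep_eq_smul (h.2 i) (h'.2 i)
    refine ⟨l, hl, funext ?_⟩
    rintro (s | ⟨i, j⟩)
    · simp [scale, h.1 s, h'.1 s]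
    · simpa [scale] using congrFun (hl' i) j
  rep_ne_zero {v x} h i := by
    obtain ⟨s, hs⟩ := Function.ne_iff.1 (proj_rep_ne_zero (h.2 i))
    exact ⟨Sum.inr ⟨i, s⟩, rfl, hs⟩
  exists_point {v} h := by
    have : ∀ i, ∃ x : ℙ ℂ (Fin (d i + 1) → ℂ),
        HomCoords.Rep (fun j => v (Sum.inr ⟨i, j⟩)) x := by
      intro i
      obtain ⟨s | ⟨i', j⟩, hs, hs'⟩ := h i
      · simp at hs
      · simp only [Sum.elim_inr, Option.some.injEq] at hs
        subst hs
        exact proj_exists_point (Function.ne_iff.2 ⟨j, hs'⟩)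
    choose x hx using this
    exact ⟨⟨fun s => v (Sum.inl s), x⟩, fun s => rfl, hx⟩

instance prodMulti {X Y σ τ B C : Type} [HomCoords X σ] [HomCoords Y τ] [MultiProj X B]
    [MultiProj Y C] : MultiProj (X × Y) (B ⊕ C) where
  blk := Sum.elim (fun s => (MultiProj.blk X s).map Sum.inl)
    (fun t => (MultiProj.blk Y t).map Sum.inr)
  rep_exists z := by
    obtain ⟨v, hv⟩ := MultiProj.rep_exists z.1
    obtain ⟨w, hw⟩ := MultiProj.rep_exists z.2
    exact ⟨Sum.elim v w, hv, hw⟩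
  rep_inj h h' := Prod.ext (MultiProj.rep_inj h.1 h'.1) (MultiProj.rep_inj h.2 h'.2)
  rep_scale {v x l} h hl := by
    have h1 := MultiProj.rep_scale h.1 (fun b => hl (Sum.inl b))
    have h2 := MultiProj.rep_scale h.2 (fun b => hl (Sum.inr b))
    constructor
    · convert h1 using 2 with s
      simp only [scale, Sum.elim_inl]
      cases MultiProj.blk X s <;> rfl
    · convert h2 using 2 with s
      simp only [scale, Sum.elim_inr]
      cases MultiProj.blk Y s <;> rfl
  rep_eq_scale {v w x} h h' := by
    obtain ⟨l, hl, h1⟩ := MultiProj.rep_eq_scale h.1 h'.1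
    obtain ⟨l', hl', h2⟩ := MultiProj.rep_eq_scale h.2 h'.2
    refine ⟨Sum.elim l l', ?_, funext ?_⟩
    · rintro (b | b)
      · exact hl b
      · exact hl' b
    · rintro (s | s)
      · refine (congrFun h1 s).trans ?_
        simp only [scale, Sum.elim_inl]
        cases MultiProj.blk X s <;> rfl
      · refine (congrFun h2 s).trans ?_
        simp only [scale, Sum.elim_inr]
        cases MultiProj.blk Y s <;> rfl
  rep_ne_zero {v x} h b := by
    rcases b with b | b
    · obtain ⟨s, hs, hs'⟩ := MultiProj.rep_ne_zero h.1 b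
      exact ⟨Sum.inl s, by simp [hs], hs'⟩
    · obtain ⟨s, hs, hs'⟩ := MultiProj.rep_ne_zero h.2 b
      exact ⟨Sum.inr s, by simp [hs], hs'⟩
  exists_point {v} h := by
    have h1 : ∃ x : X, HomCoords.Rep (fun s => v (Sum.inl s)) x := by
      refine MultiProj.exists_point fun b => ?_
      obtain ⟨s | s, hs, hs'⟩ := h (Sum.inl b)
      · exact ⟨s, by simpa using hs, hs'⟩
      · simp at hs
    have h2 : ∃ x : Y, HomCoords.Rep (fun s => v (Sum.inr s)) x := by
      refine MultiProj.exists_point fun b => ?_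
      obtain ⟨s | s, hs, hs'⟩ := h (Sum.inr b)
      · simp at hs
      · exact ⟨s, by simpa using hs, hs'⟩
    obtain ⟨x, hx⟩ := h1
    obtain ⟨y, hy⟩ := h2
    exact ⟨(x, y), hx, hy⟩

/-! ## Vanishing ideals and the Zariski topology -/

theorem exists_eval_ne_zero {σ : Type} {f : MvPolynomial σ ℂ} (hf : f ≠ 0) :
    ∃ v : σ → ℂ, eval v f ≠ 0 := by
  by_contra! h
  exact hf (MvPolynomial.funext fun v => by simp [h v])

theorem exists_torus_eval_ne_zero {B : Type} [Finite B] {f : MvPolynomial B ℂ} (hf : f ≠ 0) :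
    ∃ l : B → ℂ, (∀ b, l b ≠ 0) ∧ eval l f ≠ 0 := by
  have := Fintype.ofFinite B
  have h : f * ∏ b, X b ≠ 0 :=
    mul_ne_zero hf (Finset.prod_ne_zero_iff.2 fun b _ => X_ne_zero b)
  obtain ⟨l, hl⟩ := exists_eval_ne_zero h
  simp only [map_mul, map_prod, eval_X] at hl
  exact ⟨l, fun b => Finset.prod_ne_zero_iff.1 (right_ne_zero_of_mul hl) b (Finset.mem_univ b),
    left_ne_zero_of_mul hl⟩

/-- The polynomial in the scaling factors obtained by rescaling the coordinate vector `v`. -/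
def torusPoly {σ B : Type} (blk : σ → Option B) (v : σ → ℂ) (f : MvPolynomial σ ℂ) :
    MvPolynomial B ℂ :=
  aeval (fun s => (blk s).elim 1 X * C (v s)) f

theorem eval_torusPoly {σ B : Type} (blk : σ → Option B) (v : σ → ℂ) (f : MvPolynomial σ ℂ)
    (l : B → ℂ) : eval l (torusPoly blk v f) = eval (scale blk l v) f := by
  rw [torusPoly, aeval_def, algebraMap_eq, eval_eval₂, ← eval₂_id]
  refine congrArg₂ (fun (φ : ℂ →+* ℂ) x => eval₂ φ x f) ?_ ?_
  · ext z; simp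
  · funext s
    simp only [scale]
    cases blk s <;> simp

section
variable {X σ B : Type} [HomCoords X σ] [MultiProj X B]

/-- The polynomials that vanish at all coordinate vectors of the points of `Z`. -/
def vanIdeal (Z : Set X) : Ideal (MvPolynomial σ ℂ) where
  carrier := {f | ∀ x ∈ Z, ∀ w, HomCoords.Rep w x → eval w f = 0}
  zero_mem' := by simp
  add_mem' := by
    intro f g hf hg x hx w hw
    simp [hf x hx w hw, hg x hx w hw]
  smul_mem' := by
    intro c f hf x hx w hw
    simp [hf x hx w hw]

omit [MultiProj X B] in
theorem mem_vanIdeal {Z : Set X} {f : MvPolynomial σ ℂ} :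
    f ∈ vanIdeal Z ↔ ∀ x ∈ Z, ∀ w, HomCoords.Rep w x → eval w f = 0 := Iff.rfl

omit [MultiProj X B] in
theorem vanIdeal_anti {Z Z' : Set X} (h : Z ⊆ Z') : vanIdeal Z' ≤ vanIdeal Z :=
  fun _ hf x hx => hf x (h hx)

omit [MultiProj X B] in
theorem isClosed_zariski_iff {Z : Set X} : @IsClosed X (zariski X) Z ↔
    ∃ S : Set (MvPolynomial σ ℂ), ∀ (v : σ → ℂ) (x : X), HomCoords.Rep v x →
      (x ∈ Z ↔ ∀ f ∈ S, eval v f = 0) := by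
  rw [← @isOpen_compl_iff X _ (zariski X)]
  change Zᶜᶜ ∈ _ ↔ _
  rw [compl_compl]
  rfl

include B in
-- A closed set needs equations whose vanishing is independent of the coordinate vector. The
-- polynomials in `S` need not be homogeneous, so `S` is enlarged by all its rescalings under the
-- torus.
theorem isClosed_zeroLocus (S : Set (MvPolynomial σ ℂ)) : @IsClosed X (zariski X)
    {x : X | ∀ f ∈ S, ∀ w, HomCoords.Rep w x → eval w f = 0} := by
  rw [isClosed_zariski_iff]
  refine ⟨{g | ∃ f ∈ S, ∃ l : B → ℂ, (∀ b, l b ≠ 0) ∧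
    ∀ v, eval v g = eval (scale (MultiProj.blk X) l v) f}, fun v x hv => ⟨?_, ?_⟩⟩
  · rintro h g ⟨f, hf, l, hl, hg⟩
    rw [hg]
    exact h f hf _ (MultiProj.rep_scale hv hl)
  · intro h f hf w hw
    obtain ⟨l, hl, rfl⟩ := MultiProj.rep_eq_scale hv hw
    have := h (aeval (fun s => C ((MultiProj.blk X s).elim 1 l) * MvPolynomial.X s) f)
      ⟨f, hf, l, hl, fun v => ?_⟩
    · rw [← this, aeval_def, algebraMap_eq, eval_eval₂, ← eval₂_id]
      refine congrArg₂ (fun (φ : ℂ →+* ℂ) x => eval₂ φ x f) ?_ ?_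
      · ext z; simp
      · funext s; simp [scale]
    · rw [aeval_def, algebraMap_eq, eval_eval₂, ← eval₂_id]
      refine congrArg₂ (fun (φ : ℂ →+* ℂ) x => eval₂ φ x f) ?_ ?_
      · ext z; simp
      · funext s; simp [scale]

include B in
theorem zOpen_nonvanishing (f : MvPolynomial σ ℂ) :
    ZOpen {x : X | ∃ w, HomCoords.Rep w x ∧ eval w f ≠ 0} := by
  unfold ZOpen
  rw [← @isClosed_compl_iff X (zariski X)]
  convert isClosed_zeroLocus (X := X) {f} using 1
  ext x
  simp

include B in
theorem mem_zclosure {Z : Set X} {x : X} :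
    x ∈ zclosure Z ↔ ∀ f ∈ vanIdeal Z, ∀ w, HomCoords.Rep w x → eval w f = 0 := by
  let _ := zariski X
  constructor
  · intro h
    have : zclosure Z ⊆ {x : X | ∀ f ∈ (vanIdeal Z : Set (MvPolynomial σ ℂ)), ∀ w,
        HomCoords.Rep w x → eval w f = 0} :=
      closure_minimal (s := Z) (fun z hz f hf => hf z hz) (isClosed_zeroLocus _)
    exact this h
  · intro h
    obtain ⟨S, hS⟩ := isClosed_zariski_iff.1 (isClosed_closure (s := Z))
    obtain ⟨w, hw⟩ := MultiProj.rep_exists x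
    refine (hS w x hw).2 fun f hf => h f (fun z hz v hv => ?_) w hw
    exact (hS v z hv).1 (subset_closure hz) f hf

omit [MultiProj X B] in
theorem subset_zclosure (Z : Set X) : Z ⊆ zclosure Z :=
  let _ := zariski X
  subset_closure

omit [MultiProj X B] in
theorem zclosure_mono {Z Z' : Set X} (h : Z ⊆ Z') : zclosure Z ⊆ zclosure Z' :=
  let _ := zariski X
  closure_mono h

omit [MultiProj X B] in
theorem zclosure_subset {Z Z' : Set X} (h : Z ⊆ zclosure Z') : zclosure Z ⊆ zclosure Z' :=
  let _ := zariski X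
  closure_minimal h isClosed_closure

include B in
theorem vanIdeal_zclosure (Z : Set X) : vanIdeal (zclosure Z) = vanIdeal Z :=
  le_antisymm (vanIdeal_anti (subset_zclosure Z)) fun f hf _ hx => mem_zclosure.1 hx f hf

include B in
-- On the torus orbit of coordinate vectors of `x`, both `f` and `g` become nonzero polynomials in
-- the scaling factors, and so does their product. Without homogeneity, nonvanishing at one
-- coordinate vector says nothing about another, so this is what makes primality work for arbitrary
-- polynomials.
theorem exists_rep_eval_ne_zero [Finite B] {x : X} {v w : σ → ℂ} (hv : HomCoords.Rep v x)
    (hw : HomCoords.Rep w x) {f g : MvPolynomial σ ℂ} (hf : eval v f ≠ 0) (hg : eval w g ≠ 0) :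
    ∃ u, HomCoords.Rep u x ∧ eval u f ≠ 0 ∧ eval u g ≠ 0 := by
  obtain ⟨l, hl, rfl⟩ := MultiProj.rep_eq_scale hv hw
  have h1 : torusPoly (MultiProj.blk X) v f ≠ 0 := by
    intro h
    apply hf
    have := eval_torusPoly (MultiProj.blk X) v f (fun _ => 1)
    rw [h, map_zero] at this
    rw [this]
    congr 2
    funext s
    simp only [scale]
    cases MultiProj.blk X s <;> simp
  have h2 : torusPoly (MultiProj.blk X) v g ≠ 0 := by
    intro h
    apply hg
    rw [← eval_torusPoly, h, map_zero]
  obtain ⟨l', hl', h⟩ := exists_torus_eval_ne_zero (mul_ne_zero h1 h2)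
  rw [map_mul, eval_torusPoly, eval_torusPoly] at h
  exact ⟨_, MultiProj.rep_scale hv hl', left_ne_zero_of_mul h, right_ne_zero_of_mul h⟩

include B in
theorem isPrime_vanIdeal [Finite B] {Z : Set X} (hZ : ZIrreducible Z) : (vanIdeal Z).IsPrime := by
  let _ := zariski X
  obtain ⟨⟨z, hz⟩, hirr⟩ := hZ
  constructor
  · intro h
    obtain ⟨w, hw⟩ := MultiProj.rep_exists z
    have : (1 : MvPolynomial σ ℂ) ∈ vanIdeal Z := h ▸ Submodule.mem_top
    simpa using this z hz w hw
  · intro f g hfg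
    by_contra! hcon
    simp only [mem_vanIdeal, not_forall] at hcon
    obtain ⟨⟨x, hx, v, hv, hf⟩, y, hy, w, hw, hg⟩ := hcon
    obtain ⟨u, huZ, ⟨v', hv', hf'⟩, w', hw', hg'⟩ := hirr _ _ (zOpen_nonvanishing (X := X) f)
      (zOpen_nonvanishing g) ⟨x, hx, v, hv, hf⟩ ⟨y, hy, w, hw, hg⟩
    obtain ⟨t, ht, h1, h2⟩ := exists_rep_eval_ne_zero hv' hw' hf' hg'
    exact mul_ne_zero h1 h2 (by simpa using hfg u huZ t ht)

include B in
theorem zIrreducible_of_isPrime {Z : Set X} (hne : Z.Nonempty) (hp : (vanIdeal Z).IsPrime) :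
    ZIrreducible Z := by
  let _ := zariski X
  refine ⟨hne, ?_⟩
  rintro U V hU hV ⟨x, hx, hxU⟩ ⟨y, hy, hyV⟩
  obtain ⟨S, hS⟩ := isClosed_zariski_iff.1 hU.isClosed_compl
  obtain ⟨T, hT⟩ := isClosed_zariski_iff.1 hV.isClosed_compl
  obtain ⟨v, hv⟩ := MultiProj.rep_exists x
  obtain ⟨w, hw⟩ := MultiProj.rep_exists y
  have h1 : ∃ f ∈ S, eval v f ≠ 0 := by
    by_contra! h
    exact (hS v x hv).2 h hxU
  have h2 : ∃ f ∈ T, eval w f ≠ 0 := by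
    by_contra! h
    exact (hT w y hw).2 h hyV
  obtain ⟨f, hfS, hf⟩ := h1
  obtain ⟨g, hgT, hg⟩ := h2
  have : f * g ∉ vanIdeal Z := by
    intro h
    rcases hp.mem_or_mem h with h | h
    · exact hf (h x hx v hv)
    · exact hg (h y hy w hw)
  simp only [mem_vanIdeal, not_forall, map_mul] at this
  obtain ⟨z, hz, u, hu, hfg⟩ := this
  refine ⟨z, hz, ?_, ?_⟩
  · by_contra h
    exact left_ne_zero_of_mul hfg ((hS u z hu).1 h f hfS)
  · by_contra h
    exact right_ne_zero_of_mul hfg ((hT u z hu).1 h g hgT)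

end

/-! ## Algebraic dependence modulo an ideal -/

/-- Any `e` polynomials are algebraically dependent modulo `I`. -/
def Dep {σ : Type} (I : Ideal (MvPolynomial σ ℂ)) (e : ℕ) : Prop :=
  ∀ f : Fin e → MvPolynomial σ ℂ, ∃ P : MvPolynomial (Fin e) ℂ, P ≠ 0 ∧ aeval f P ∈ I

theorem Dep.exists_relation {σ ι : Type} [Fintype ι] {I : Ideal (MvPolynomial σ ℂ)} {e : ℕ}
    (h : Dep I e) (hι : Fintype.card ι = e) (f : ι → MvPolynomial σ ℂ) :
    ∃ P : MvPolynomial ι ℂ, P ≠ 0 ∧ aeval f P ∈ I := by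
  let i := Fintype.equivFinOfCardEq hι
  obtain ⟨P, hP, hPI⟩ := h (f ∘ i.symm)
  refine ⟨rename i.symm P, ?_, ?_⟩
  · exact fun h => hP (rename_injective _ i.symm.injective (by simpa using h))
  · rwa [aeval_rename]

theorem Dep.mono {σ : Type} {I : Ideal (MvPolynomial σ ℂ)} {e e' : ℕ} (h : Dep I e)
    (he : e ≤ e') : Dep I e' := by
  intro f
  obtain ⟨P, hP, hPI⟩ := h (f ∘ Fin.castLE he)
  refine ⟨rename (Fin.castLE he) P, ?_, ?_⟩
  · exact fun h => hP (rename_injective _ (Fin.castLE_injective he) (by simpa using h))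
  · rwa [aeval_rename]

theorem Dep.anti {σ : Type} {I J : Ideal (MvPolynomial σ ℂ)} {e : ℕ} (h : Dep I e)
    (hIJ : I ≤ J) : Dep J e := fun f => by
  obtain ⟨P, hP, hPI⟩ := h f
  exact ⟨P, hP, hIJ hPI⟩

/-- A polynomial relation satisfied by `g` modulo `I` can be divided by `g` as long as its constant
term is zero, because `I` is prime and `g ∉ I`. Once the constant term is nonzero, it is the
required element, congruent to a multiple of `g`. -/
theorem exists_coeff_relation {R A : Type*} [CommRing R] [CommRing A] (φ : R →+* A)
    {I : Ideal A} (hI : I.IsPrime) {g : A} (hg : g ∉ I) (n : ℕ) :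
    ∀ q : Polynomial R, q ≠ 0 → q.natDegree ≤ n → q.eval₂ φ g ∈ I →
      ∃ P : R, P ≠ 0 ∧ ∃ h : A, φ P - g * h ∈ I := by
  induction n with
  | zero =>
    intro q hq hn hqI
    rw [Polynomial.eq_C_of_natDegree_eq_zero (Nat.le_zero.1 hn), Polynomial.eval₂_C] at hqI
    refine ⟨q.coeff 0, fun h => hq ?_, 0, by simpa using hqI⟩
    rw [Polynomial.eq_C_of_natDegree_eq_zero (Nat.le_zero.1 hn), h, map_zero]
  | succ n ih =>
    intro q hq hn hqI
    have hdiv : q.eval₂ φ g = q.divX.eval₂ φ g * g + φ (q.coeff 0) := by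
      conv_lhs => rw [← Polynomial.divX_mul_X_add q]
      simp
    by_cases h0 : q.coeff 0 = 0
    · rw [h0, map_zero, add_zero] at hdiv
      refine ih q.divX ?_ ?_ ?_
      · intro h
        apply hq
        rw [← Polynomial.divX_mul_X_add q, h, h0]
        simp
      · rw [Polynomial.natDegree_divX_eq_natDegree_tsub_one]
        omega
      · rw [hdiv] at hqI
        exact (hI.mem_or_mem hqI).resolve_right hg
    · refine ⟨q.coeff 0, h0, -q.divX.eval₂ φ g, ?_⟩
      rw [hdiv] at hqI
      convert hqI using 1
      ring

theorem eval₂_optionEquivLeft {σ ι : Type} (g : MvPolynomial σ ℂ) (f : ι → MvPolynomial σ ℂ)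
    (Q : MvPolynomial (Option ι) ℂ) :
    (optionEquivLeft ℂ ι Q).eval₂
      (aeval f : MvPolynomial ι ℂ →ₐ[ℂ] MvPolynomial σ ℂ).toRingHom g =
        aeval (fun o : Option ι => o.elim g f) Q := by
  have : (Polynomial.eval₂RingHom (aeval f : MvPolynomial ι ℂ →ₐ[ℂ] MvPolynomial σ ℂ).toRingHom
      g).comp (optionEquivLeft ℂ ι : MvPolynomial (Option ι) ℂ →+* _) =
      (aeval (fun o : Option ι => o.elim g f)).toRingHom := by
    refine MvPolynomial.ringHom_ext (fun c => ?_) fun o => ?_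
    · simp
    · cases o <;> simp
  exact DFunLike.congr_fun this Q

/-- A relation between `g` and the `f i` is read as a polynomial in `g`. The cofactor `h` stays
explicit because `exists_generic_not_mem` evaluates the congruence at points where `g` vanishes. -/
theorem Dep.drop_relation {σ ι : Type} [Fintype ι] {I : Ideal (MvPolynomial σ ℂ)} (hI : I.IsPrime)
    {e : ℕ} (h : Dep I (e + 1)) (hι : Fintype.card ι = e) {g : MvPolynomial σ ℂ} (hg : g ∉ I)
    (f : ι → MvPolynomial σ ℂ) :
    ∃ P : MvPolynomial ι ℂ, P ≠ 0 ∧ ∃ h, aeval f P - g * h ∈ I := by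
  obtain ⟨Q, hQ, hQI⟩ := h.exists_relation (ι := Option ι) (by simp [hι]) (fun o => o.elim g f)
  exact exists_coeff_relation (aeval f : MvPolynomial ι ℂ →ₐ[ℂ] MvPolynomial σ ℂ).toRingHom hI hg _
    (optionEquivLeft ℂ ι Q) ((map_ne_zero_iff _ (optionEquivLeft ℂ ι).injective).2 hQ) le_rfl
    (eval₂_optionEquivLeft g f Q ▸ hQI)

/-- This is the drop of transcendence degree from a prime to a strictly larger ideal, the only input
from dimension theory for the upper bound on Krull dimension. -/
theorem Dep.drop {σ : Type} {I J : Ideal (MvPolynomial σ ℂ)} (hI : I.IsPrime) {e : ℕ}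
    (h : Dep I (e + 1)) (hIJ : I < J) : Dep J e := by
  intro f
  obtain ⟨g, hgJ, hgI⟩ := SetLike.exists_of_lt hIJ
  obtain ⟨P, hP, u, hu⟩ := h.drop_relation hI (Fintype.card_fin e) hgI f
  refine ⟨P, hP, ?_⟩
  simpa using J.add_mem (hIJ.le hu) (J.mul_mem_right u hgJ)

theorem not_dep_zero {σ : Type} {I : Ideal (MvPolynomial σ ℂ)} (hI : I.IsPrime) : ¬ Dep I 0 := by
  intro h
  obtain ⟨P, hP, hPI⟩ := h Fin.elim0
  obtain ⟨c, rfl⟩ := C_surjective (Fin 0) P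
  rw [aeval_C] at hPI
  refine hI.ne_top (I.eq_top_of_isUnit_mem hPI ?_)
  exact (isUnit_iff_ne_zero.2 fun h => hP (by rw [h, map_zero])).map (algebraMap ℂ _)

/-- Independence modulo the kernel would give more algebraically independent polynomials than there
are variables, against the transcendence degree of the polynomial ring. -/
theorem dep_ker_aeval {σ β : Type} [Fintype β] (Θ : σ → MvPolynomial β ℂ) :
    Dep (RingHom.ker (aeval Θ)) (Fintype.card β + 1) := by
  intro f
  by_contra! hcon
  have : AlgebraicIndependent ℂ (fun i => aeval Θ (f i)) := by
    rw [algebraicIndependent_iff]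
    intro p hp
    by_contra hp0
    refine hcon p hp0 ?_
    rw [RingHom.mem_ker, ← hp]
    exact (DFunLike.congr_fun (comp_aeval f (aeval Θ)) p)
  have := this.lift_cardinalMk_le_trdeg
  rw [MvPolynomial.trdeg_of_isDomain] at this
  simp at this

section
variable {X σ B : Type} [HomCoords X σ] [MultiProj X B]

/-! ## Parametrized sets -/

theorem eval_aeval_tuple {σ β : Type} (Θ : σ → MvPolynomial β ℂ) (z : β → ℂ)
    (f : MvPolynomial σ ℂ) : eval z (aeval Θ f) = eval (evalTuple Θ z) f := by
  rw [aeval_def, algebraMap_eq, eval_eval₂, ← eval₂_id]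
  refine congrArg₂ (fun (φ : ℂ →+* ℂ) x => eval₂ φ x f) ?_ rfl
  ext z; simp

theorem evalTuple_aeval {ι σ β : Type} (Θ : σ → MvPolynomial β ℂ) (Φ : ι → MvPolynomial σ ℂ)
    (z : β → ℂ) : evalTuple (fun s => aeval Θ (Φ s)) z = evalTuple Φ (evalTuple Θ z) :=
  _root_.funext fun s => eval_aeval_tuple Θ z (Φ s)

theorem eq_zero_of_eval_of_ne {β : Type} {Γ f : MvPolynomial β ℂ} (hΓ : Γ ≠ 0)
    (h : ∀ z, eval z Γ ≠ 0 → eval z f = 0) : f = 0 := by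
  by_contra hf
  obtain ⟨z, hz⟩ := exists_eval_ne_zero (mul_ne_zero hΓ hf)
  rw [map_mul] at hz
  exact right_ne_zero_of_mul hz (h z (left_ne_zero_of_mul hz))

omit [MultiProj X B] in
-- A polynomial vanishing on a nonempty principal open set is zero. Therefore the open condition `Γ`
-- is needed only for landing in `Z`; the parameters that reach a given coordinate vector need not
-- satisfy it.
theorem vanIdeal_eq_ker {Z : Set X} {β : Type} (Θ : σ → MvPolynomial β ℂ) {Γ : MvPolynomial β ℂ}
    (hΓ : Γ ≠ 0) (h1 : ∀ z, eval z Γ ≠ 0 → ∃ x ∈ Z, HomCoords.Rep (evalTuple Θ z) x)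
    (h2 : ∀ x ∈ Z, ∀ w, HomCoords.Rep w x → ∃ z, w = evalTuple Θ z) :
    vanIdeal Z = RingHom.ker (aeval Θ) := by
  ext f
  rw [RingHom.mem_ker]
  constructor
  · intro hf
    refine eq_zero_of_eval_of_ne hΓ fun z hz => ?_
    obtain ⟨x, hx, hrep⟩ := h1 z hz
    rw [eval_aeval_tuple]
    exact hf x hx _ hrep
  · intro hf x hx w hw
    obtain ⟨z, rfl⟩ := h2 x hx w hw
    rw [← eval_aeval_tuple, hf, map_zero]

/-- The tuple `Φ` together with independent scaling factors for all blocks. -/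
def torusTuple {β : Type} (blk : σ → Option B) (Φ : σ → MvPolynomial β ℂ) :
    σ → MvPolynomial (β ⊕ B) ℂ :=
  fun s => (blk s).elim 1 (fun b => MvPolynomial.X (Sum.inr b)) * rename Sum.inl (Φ s)

omit [HomCoords X σ] [MultiProj X B] in
theorem evalTuple_torusTuple {β : Type} (blk : σ → Option B) (Φ : σ → MvPolynomial β ℂ)
    (z : β ⊕ B → ℂ) : evalTuple (torusTuple blk Φ) z =
      scale blk (fun b => z (Sum.inr b)) (evalTuple Φ fun t => z (Sum.inl t)) := by
  funext s
  simp only [evalTuple, torusTuple, scale, map_mul, eval_rename]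
  congr 1
  cases blk s <;> simp

/-- The polynomial `g` times the product of all scaling factors. -/
def torusDenom {β B : Type} [Fintype B] (g : MvPolynomial β ℂ) : MvPolynomial (β ⊕ B) ℂ :=
  rename Sum.inl g * ∏ b, MvPolynomial.X (Sum.inr b)

theorem torusDenom_ne_zero {β B : Type} [Fintype B] {g : MvPolynomial β ℂ} (hg : g ≠ 0) :
    (torusDenom g : MvPolynomial (β ⊕ B) ℂ) ≠ 0 := by
  refine mul_ne_zero ?_ (Finset.prod_ne_zero_iff.2 fun b _ => X_ne_zero _)
  exact fun h => hg (rename_injective _ Sum.inl_injective (by simpa using h))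

theorem eval_torusDenom_ne_zero {β B : Type} [Fintype B] {g : MvPolynomial β ℂ} {z : β ⊕ B → ℂ} :
    eval z (torusDenom g) ≠ 0 ↔
      eval (fun t => z (Sum.inl t)) g ≠ 0 ∧ ∀ b, z (Sum.inr b) ≠ 0 := by
  simp [torusDenom, eval_rename, Finset.prod_eq_zero_iff, Function.comp_def]

theorem vanIdeal_eq_ker_torusTuple [Fintype B] {Z : Set X} {β : Type} (Φ : σ → MvPolynomial β ℂ)
    {g : MvPolynomial β ℂ} (hg : g ≠ 0)
    (h1 : ∀ t, eval t g ≠ 0 → ∃ x ∈ Z, HomCoords.Rep (evalTuple Φ t) x)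
    (h2 : ∀ x ∈ Z, ∃ t, HomCoords.Rep (evalTuple Φ t) x) :
    vanIdeal Z = RingHom.ker (aeval (torusTuple (MultiProj.blk X) Φ)) := by
  refine vanIdeal_eq_ker _ (torusDenom_ne_zero hg) (fun z hz => ?_) (fun x hx w hw => ?_)
  · obtain ⟨hz1, hz2⟩ := eval_torusDenom_ne_zero.1 hz
    obtain ⟨x, hx, h⟩ := h1 _ hz1
    refine ⟨x, hx, ?_⟩
    rw [evalTuple_torusTuple]
    exact MultiProj.rep_scale h hz2
  · obtain ⟨t, ht⟩ := h2 x hx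
    obtain ⟨l, hl, rfl⟩ := MultiProj.rep_eq_scale ht hw
    exact ⟨Sum.elim t l, by rw [evalTuple_torusTuple]; rfl⟩

/-! ## Bounds for the Krull dimension -/

include B in
-- The coordinate vectors of a single point already contain a full torus: one nonzero coordinate
-- from each block takes arbitrary nonzero values independently.
theorem not_dep_vanIdeal [Fintype B] {Z : Set X} (hne : Z.Nonempty) :
    ¬ Dep (vanIdeal Z) (Fintype.card B) := by
  obtain ⟨x, hx⟩ := hne
  obtain ⟨v, hv⟩ := MultiProj.rep_exists x
  choose κ hκ hκ0 using MultiProj.rep_ne_zero hv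
  intro h
  obtain ⟨P, hP, hPI⟩ := h.exists_relation (ι := B) rfl (fun b => MvPolynomial.X (κ b))
  obtain ⟨l, hl, hPl⟩ := exists_torus_eval_ne_zero hP
  apply hPl
  have := hPI x hx _ (MultiProj.rep_scale (l := fun b => l b / v (κ b)) hv
    (fun b => div_ne_zero (hl b) (hκ0 b)))
  rw [eval_aeval_tuple] at this
  have hl' : evalTuple (fun b => MvPolynomial.X (κ b))
      (scale (MultiProj.blk X) (fun b => l b / v (κ b)) v) = l := by
    funext b
    simp [evalTuple, scale, hκ, hκ0]
  rwa [hl'] at this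

include B in
-- A chain of irreducible closed subsets gives a chain of primes, along which the transcendence
-- degree drops strictly. It never falls below the number of blocks, which is why `card B` is
-- subtracted from the bound.
theorem zdim_le [Fintype B] {Z : Set X} {M : ℕ}
    (h : Dep (vanIdeal Z) (M + Fintype.card B + 1)) : zdim Z ≤ M := by
  classical
  let _ := zariski X
  let J : TopologicalSpace.IrreducibleCloseds Z → Ideal (MvPolynomial σ ℂ) :=
    fun T => vanIdeal (Subtype.val '' (T : Set Z))
  have hJp : ∀ T, (J T).IsPrime := fun T =>
    isPrime_vanIdeal (T.isIrreducible'.image _ continuous_subtype_val.continuousOn)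
  have hJdep : ∀ T, Dep (J T) (M + Fintype.card B + 1) := fun T =>
    h.anti (vanIdeal_anti (by rintro _ ⟨x, -, rfl⟩; exact x.2))
  have hJlt : ∀ T T', T < T' → J T' < J T := by
    intro T T' hTT
    refine lt_of_le_of_ne (vanIdeal_anti (Set.image_mono hTT.le)) ?_
    intro heq
    obtain ⟨x, hxT', hxT⟩ := SetLike.exists_of_lt hTT
    obtain ⟨C, hC, hCT⟩ := isClosed_induced_iff.1 T.isClosed'
    obtain ⟨S, hS⟩ := isClosed_zariski_iff.1 hC
    have hmem : ∀ y : Z, y ∈ T ↔ (y : X) ∈ C := fun y => by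
      change y ∈ T.carrier ↔ _
      rw [← hCT]; rfl
    obtain ⟨w, hw⟩ := MultiProj.rep_exists (x : X)
    rw [hmem] at hxT
    apply hxT
    refine (hS w x hw).2 fun f hf => ?_
    have : f ∈ J T := by
      rintro _ ⟨y, hy, rfl⟩ v hv
      exact (hS v y hv).1 ((hmem y).1 hy) f hf
    rw [← heq] at this
    exact this x ⟨x, hxT', rfl⟩ w hw
  -- The least `e` with `Dep (J T) e` is the transcendence degree of `J T` plus one.
  let ρ : TopologicalSpace.IrreducibleCloseds Z → ℕ := fun T => Nat.find ⟨_, hJdep T⟩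
  have hρ : StrictMono ρ := by
    intro T T' hTT
    obtain ⟨e, he⟩ : ∃ e, ρ T' = e + 1 := by
      refine Nat.exists_eq_succ_of_ne_zero fun h0 => not_dep_zero (hJp T') ?_
      have := Nat.find_spec ⟨_, hJdep T'⟩
      exact h0 ▸ this
    have hd : Dep (J T') (e + 1) := he ▸ Nat.find_spec ⟨_, hJdep T'⟩
    have : ρ T ≤ e := Nat.find_min' _ (hd.drop (hJp T') (hJlt T T' hTT))
    omega
  have hlow : ∀ T, Fintype.card B + 1 ≤ ρ T := by
    intro T
    by_contra! hlt
    refine not_dep_vanIdeal (Z := Subtype.val '' (T : Set Z)) (T.isIrreducible'.nonempty.image _) ?_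
    exact Dep.mono (Nat.find_spec ⟨_, hJdep T⟩) (Nat.lt_succ_iff.1 hlt)
  have hup : ∀ T, ρ T ≤ M + Fintype.card B + 1 := fun T => Nat.find_min' _ (hJdep T)
  change Order.krullDim _ ≤ _
  refine iSup_le fun p => ?_
  have := (p.map ρ hρ).head_add_length_le_nat
  have h1 := hlow p.head
  have h2 := hup p.last
  rw [LTSeries.head_map, LTSeries.last_map] at this
  change ρ p.head + p.length ≤ ρ p.last at this
  have : p.length ≤ M := by omega
  exact_mod_cast this

theorem isIrreducible_preimage_val {T : Type} [TopologicalSpace T] {Z C : Set T} (hCZ : C ⊆ Z)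
    (hC : IsIrreducible C) : IsIrreducible (Subtype.val ⁻¹' C : Set Z) := by
  constructor
  · obtain ⟨x, hx⟩ := hC.1
    exact ⟨⟨x, hCZ hx⟩, hx⟩
  · rintro U V hU hV ⟨x, hx, hxU⟩ ⟨y, hy, hyV⟩
    obtain ⟨U', hU', rfl⟩ := isOpen_induced_iff.1 hU
    obtain ⟨V', hV', rfl⟩ := isOpen_induced_iff.1 hV
    obtain ⟨z, hz, h1, h2⟩ := hC.2 U' V' hU' hV' ⟨x, hx, hxU⟩ ⟨y, hy, hyV⟩
    exact ⟨⟨z, hCZ hz⟩, hz, h1, h2⟩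

include B in
theorem zIrreducible_zclosure [Finite B] {Z : Set X} (hne : Z.Nonempty)
    (hp : (vanIdeal Z).IsPrime) : ZIrreducible (zclosure Z) := by
  refine zIrreducible_of_isPrime (hne.mono (subset_zclosure Z)) ?_
  rwa [vanIdeal_zclosure]

include B in
-- Releasing the parameters one at a time from fixed values `t₀` gives an increasing chain of
-- irreducible subsets. The rational inverse recovers each parameter from the point, so each step is
-- strict after taking closures.
theorem le_zdim [Fintype B] {Z : Set X} (hZ : zclosure Z ⊆ Z) {β : Type} [Fintype β]
    (Φ : σ → MvPolynomial β ℂ) {g : MvPolynomial β ℂ} (hg : g ≠ 0)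
    (hΦ : ∀ t, eval t g ≠ 0 → ∃ x ∈ Z, HomCoords.Rep (evalTuple Φ t) x)
    (num den : β → MvPolynomial σ ℂ)
    (hinv : ∀ (t : β → ℂ) (x : X) (w : σ → ℂ), eval t g ≠ 0 →
      HomCoords.Rep (evalTuple Φ t) x → HomCoords.Rep w x →
      ∀ i, eval w (den i) ≠ 0 ∧ eval w (num i) = t i * eval w (den i)) :
    (Fintype.card β : WithBot ℕ∞) ≤ zdim Z := by
  classical
  let _ := zariski X
  obtain ⟨t₀, ht₀⟩ := exists_eval_ne_zero hg
  let e := Fintype.equivFin β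
  let L : ℕ → Set X := fun i => {x : X | ∃ t : β → ℂ, eval t g ≠ 0 ∧
    (∀ j, i ≤ e j → t j = t₀ j) ∧ HomCoords.Rep (evalTuple Φ t) x}
  have hLZ : ∀ i, L i ⊆ Z := by
    rintro i x ⟨t, ht, -, hx⟩
    obtain ⟨y, hy, hy'⟩ := hΦ t ht
    rwa [MultiProj.rep_inj hx hy']
  have hLmono : ∀ i j, i ≤ j → L i ⊆ L j := by
    rintro i j hij x ⟨t, ht, h, hx⟩
    exact ⟨t, ht, fun s hs => h s (hij.trans hs), hx⟩
  have hLne : ∀ i, (L i).Nonempty := fun i => by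
    obtain ⟨y, hy, hy'⟩ := hΦ t₀ ht₀
    exact ⟨y, t₀, ht₀, fun _ _ => rfl, hy'⟩
  have hLprime : ∀ i, (vanIdeal (L i)).IsPrime := by
    intro i
    -- Substituting the frozen values exhibits `L i` as a polynomially parametrized set, so its
    -- ideal is a kernel and hence prime.
    let sub : β → MvPolynomial β ℂ := fun j => if i ≤ e j then C (t₀ j) else MvPolynomial.X j
    have hsub : ∀ (t : β → ℂ) (j : β), i ≤ e j → evalTuple sub t j = t₀ j := by
      intro t j hj
      simp [evalTuple, sub, hj]
    have hsub' : ∀ (t : β → ℂ), (∀ j, i ≤ e j → t j = t₀ j) → evalTuple sub t = t := by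
      intro t ht
      funext j
      by_cases hj : i ≤ e j
      · rw [hsub t j hj, ht j hj]
      · simp [evalTuple, sub, hj]
    have hev : ∀ t, evalTuple (fun s => aeval sub (Φ s)) t = evalTuple Φ (evalTuple sub t) :=
      evalTuple_aeval sub Φ
    have hker := vanIdeal_eq_ker_torusTuple (X := X) (Z := L i) (fun s => aeval sub (Φ s))
      (g := aeval sub g) ?_ ?_ ?_
    · rw [hker]
      exact RingHom.ker_isPrime _
    · intro h
      apply ht₀
      rw [← hsub' t₀ fun _ _ => rfl, ← eval_aeval_tuple, h, map_zero]
    · intro t ht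
      rw [eval_aeval_tuple] at ht
      obtain ⟨y, -, hy'⟩ := hΦ _ ht
      exact ⟨y, ⟨_, ht, hsub t, hy'⟩, by rwa [hev]⟩
    · rintro x ⟨t, ht, h, hx⟩
      refine ⟨t, ?_⟩
      rwa [hev, hsub' t h]
  have hclZ : ∀ i, zclosure (L i) ⊆ Z := fun i => (zclosure_mono (hLZ i)).trans hZ
  let T : Fin (Fintype.card β + 1) → TopologicalSpace.IrreducibleCloseds Z := fun i =>
    { carrier := Subtype.val ⁻¹' zclosure (L i)
      isIrreducible' := isIrreducible_preimage_val (hclZ i)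
        (zIrreducible_zclosure (hLne i) (hLprime i))
      isClosed' := isClosed_closure.preimage continuous_subtype_val }
  let p : LTSeries (TopologicalSpace.IrreducibleCloseds Z) :=
    { length := Fintype.card β
      toFun := T
      step := ?_ }
  · exact Order.LTSeries.length_le_krullDim p
  · intro i
    have hmono : L (i.castSucc : Fin (Fintype.card β + 1)) ⊆ L (i.succ : Fin _) :=
      hLmono _ _ (by simp)
    change T i.castSucc < T i.succ
    rw [lt_iff_le_not_ge]
    refine ⟨fun x hx => zclosure_mono hmono hx, fun hle => ?_⟩
    let j := e.symm i
    -- The newly released parameter is moved slightly; by continuity `g` remains nonzero.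
    have hcurve : ∃ c : ℂ, c ≠ 0 ∧ eval (Function.update t₀ j (t₀ j + c)) g ≠ 0 := by
      have hcont : Continuous fun c : ℂ => eval (Function.update t₀ j (t₀ j + c)) g :=
        (MvPolynomial.continuous_eval g).comp (by fun_prop)
      have h0 : ∀ᶠ c in nhds (0 : ℂ), eval (Function.update t₀ j (t₀ j + c)) g ≠ 0 :=
        hcont.continuousAt.eventually_ne (by simpa using ht₀)
      obtain ⟨c, hc, hc'⟩ := ((h0.filter_mono nhdsWithin_le_nhds).and
        (self_mem_nhdsWithin : {(0 : ℂ)}ᶜ ∈ nhdsWithin 0 {(0 : ℂ)}ᶜ)).exists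
      exact ⟨c, hc', hc⟩
    obtain ⟨c, hc, hgc⟩ := hcurve
    obtain ⟨y, hyZ, hy⟩ := hΦ _ hgc
    have hyL : y ∈ L (i.succ : Fin _) := by
      refine ⟨_, hgc, fun s hs => ?_, hy⟩
      rw [Function.update_of_ne]
      rintro rfl
      simp [j] at hs
    have hyT : (⟨y, hyZ⟩ : Z) ∈ T i.castSucc := hle (subset_zclosure (L _) hyL)
    have hyT' : y ∈ zclosure (L (i.castSucc : Fin (Fintype.card β + 1))) := hyT
    -- The equation "parameter `j` equals `t₀ j`", cleared of denominators, holds on the smaller set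
    -- but fails at the moved point.
    have hf : num j - C (t₀ j) * den j ∈
        vanIdeal (L (i.castSucc : Fin (Fintype.card β + 1))) := by
      rintro x ⟨t, ht, h, hx⟩ w hw
      have := (hinv t x w ht hx hw j).2
      rw [h j (by simp [j])] at this
      simp [this]
    have h1 := mem_zclosure.1 hyT' _ hf _ hy
    obtain ⟨h2, h3⟩ := hinv _ y _ hgc hy hy j
    rw [map_sub, map_mul, eval_C, h3, Function.update_self, ← sub_mul, add_sub_cancel_left] at h1
    exact mul_ne_zero hc h2 h1

/-! ## Projections to a projective space -/

theorem eval_sumAlgEquiv {B τ : Type} (a : B → ℂ) (h : τ → ℂ) (P : MvPolynomial (B ⊕ τ) ℂ) :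
    eval a (MvPolynomial.map (eval h) (sumAlgEquiv ℂ B τ P)) = eval (Sum.elim a h) P := by
  have : ((eval a).comp (MvPolynomial.map (eval h))).comp
      (sumAlgEquiv ℂ B τ : MvPolynomial (B ⊕ τ) ℂ →+* _) = eval (Sum.elim a h) := by
    refine MvPolynomial.ringHom_ext (fun c => ?_) fun o => ?_
    · simp
    · cases o <;> simp
  exact DFunLike.congr_fun this P

/-- `E` is irreducible and no larger than the target projective space, so its proper closed subset
`f = 0` cannot dominate the target. To obtain an explicit hypersurface, choose one pivot coordinate
in each block. A relation `P` between the pivots and `h` holds modulo `f`; where `f = 0` it vanishes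
for all nonzero pivot values, so each coefficient, a polynomial in `h`, vanishes. -/
theorem exists_generic_not_mem [Finite σ] [Fintype B] {τ : Type} [Fintype τ]
    {E : Set (X × ℙ ℂ (τ → ℂ))} (hE : (vanIdeal E).IsPrime)
    (hdep : Dep (vanIdeal E) (Fintype.card τ + Fintype.card B + 1)) {f : MvPolynomial σ ℂ}
    (hf : rename Sum.inl f ∉ vanIdeal E) :
    ∃ δ : MvPolynomial τ ℂ, δ ≠ 0 ∧ ∀ x H, (x, H) ∈ E →
      (∀ v, HomCoords.Rep v x → eval v f = 0) → ∀ h, HomCoords.Rep h H → eval h δ = 0 := by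
  classical
  have := Fintype.ofFinite σ
  have hκ : ∀ κ : B → σ, ∃ c : MvPolynomial τ ℂ, c ≠ 0 ∧ ∀ x H, (x, H) ∈ E →
      (∀ v, HomCoords.Rep v x → eval v f = 0) → ∀ h v, HomCoords.Rep h H → HomCoords.Rep v x →
      (∀ b, MultiProj.blk X (κ b) = some b ∧ v (κ b) ≠ 0) → eval h c = 0 := by
    intro κ
    obtain ⟨P, hP, u, hu⟩ := hdep.drop_relation (ι := B ⊕ τ) hE
      (by rw [Fintype.card_sum, add_comm]) hf
      (Sum.elim (fun b => MvPolynomial.X (Sum.inl (κ b))) fun t => MvPolynomial.X (Sum.inr t))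
    have hP' := (map_ne_zero_iff _ (sumAlgEquiv ℂ B τ).injective).2 hP
    obtain ⟨m, hm⟩ := MvPolynomial.ne_zero_iff.1 hP'
    refine ⟨_, hm, fun x H hxH hfx h v hh hv hb => ?_⟩
    suffices h0 : MvPolynomial.map (eval h) (sumAlgEquiv ℂ B τ P) = 0 by
      rw [← coeff_map, h0, coeff_zero]
    by_contra hne
    obtain ⟨l, hl, hne⟩ := exists_torus_eval_ne_zero hne
    apply hne
    rw [eval_sumAlgEquiv]
    have hv' := MultiProj.rep_scale (l := fun b => l b / v (κ b)) hv
      (fun b => div_ne_zero (hl b) (hb b).2)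
    have h1 := hu (x, H) hxH (Sum.elim (scale (MultiProj.blk X) (fun b => l b / v (κ b)) v) h)
      ⟨hv', hh⟩
    rw [map_sub, map_mul, eval_rename, Sum.elim_comp_inl, hfx _ hv', zero_mul, sub_zero,
      eval_aeval_tuple] at h1
    convert h1 using 3
    funext o
    rcases o with b | t
    · simp [evalTuple, scale, hb]
    · simp [evalTuple]
  -- The pivots that are nonzero depend on the point, but there are finitely many choices `κ`; the
  -- product serves all points.
  choose c hc hcE using hκ
  refine ⟨∏ κ, c κ, Finset.prod_ne_zero_iff.2 fun κ _ => hc κ, fun x H hxH hfx h hh => ?_⟩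
  obtain ⟨v, hv⟩ := MultiProj.rep_exists x
  choose κ hκ hκ0 using MultiProj.rep_ne_zero hv
  rw [map_prod]
  exact Finset.prod_eq_zero (Finset.mem_univ κ)
    (hcE κ x H hxH hfx h v hh hv fun b => ⟨hκ b, hκ0 b⟩)

/-- Substituting fractions into a polynomial and clearing the denominators. -/
theorem exists_clear_denominators {α R : Type} [Fintype α] [CommRing R] [Algebra ℂ R]
    (p q : α → R) (f : MvPolynomial α ℂ) :
    ∃ (Θ : R) (N : ℕ), ∀ (S : Type) [CommRing S] [Algebra ℂ S] (φ : R →ₐ[ℂ] S) (z : α → S),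
      (∀ i, φ (p i) = z i * φ (q i)) → φ Θ = (∏ i, φ (q i)) ^ N * aeval z f := by
  classical
  induction f using MvPolynomial.induction_on with
  | C c => exact ⟨algebraMap ℂ R c, 0, fun S _ _ φ z _ => by simp⟩
  | add f g hf hg =>
    obtain ⟨Θ, N, h⟩ := hf
    obtain ⟨Θ', N', h'⟩ := hg
    refine ⟨Θ * (∏ i, q i) ^ N' + Θ' * (∏ i, q i) ^ N, N + N', fun S _ _ φ z hz => ?_⟩
    rw [map_add, map_mul, map_mul, h S φ z hz, h' S φ z hz, map_pow, map_pow, map_prod, map_add]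
    ring
  | mul_X f i hf =>
    obtain ⟨Θ, N, h⟩ := hf
    refine ⟨Θ * p i * ∏ j ∈ Finset.univ.erase i, q j, N + 1, fun S _ _ φ z hz => ?_⟩
    rw [map_mul, map_mul, h S φ z hz, hz i, map_prod, map_mul, aeval_X, pow_succ,
      ← Finset.mul_prod_erase Finset.univ (fun i => φ (q i)) (Finset.mem_univ i)]
    ring

end

/-! ## The number of points in a general fibre -/

theorem exists_map_eq_C_mul {A K : Type*} [CommRing A] [IsDomain A] [Field K] [Algebra A K]
    [IsFractionRing A K] (p : Polynomial K) : ∃ a : A, a ≠ 0 ∧ ∃ p' : Polynomial A,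
      p'.map (algebraMap A K) = Polynomial.C (algebraMap A K a) * p := by
  obtain ⟨a, ha, h⟩ := IsLocalization.integerNormalization_spec (nonZeroDivisors A) p
  refine ⟨a, nonZeroDivisors.ne_zero ha, _, h.trans ?_⟩
  rw [← Polynomial.smul_eq_C_mul, algebraMap_smul]

/-- The minimal polynomial of a primitive element over the fraction field is cleared of
denominators. Divisibility by `μ`, separability (a Bézout identity for `μ` and its derivative) and
generation by `θ` all survive up to nonzero factors in `A`, which can be kept nonzero under
specialization. -/
theorem exists_primitive_relation {A B K E : Type*} [CommRing A] [IsDomain A] [CommRing B]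
    [IsDomain B] [Field K] [Field E] [CharZero K] [Algebra A B] [Algebra A K] [IsFractionRing A K]
    [Algebra B E] [IsFractionRing B E] [Algebra K E] [Algebra A E] [IsScalarTower A K E]
    [IsScalarTower A B E] [Algebra.IsAlgebraic A B] [FiniteDimensional K E] :
    ∃ (θ : B) (μ : Polynomial A), μ ≠ 0 ∧ μ.eval₂ (algebraMap A B) θ = 0 ∧
      (∀ f : Polynomial A, f.eval₂ (algebraMap A B) θ = 0 →
        ∃ a : A, a ≠ 0 ∧ ∃ k, Polynomial.C a * f = μ * k) ∧
      (∃ (u v : Polynomial A) (a : A), a ≠ 0 ∧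
        u * μ + v * Polynomial.derivative μ = Polynomial.C a) ∧
      ∀ b : B, ∃ a : A, a ≠ 0 ∧ ∃ q : Polynomial A,
        algebraMap A B a * b = q.eval₂ (algebraMap A B) θ := by
  have hAK : Function.Injective (algebraMap A K) := IsFractionRing.injective A K
  have hBE : Function.Injective (algebraMap B E) := IsFractionRing.injective B E
  have hmap : Function.Injective (Polynomial.map (algebraMap A K)) :=
    Polynomial.map_injective _ hAK
  obtain ⟨α, hα⟩ := Field.exists_primitive_element K E
  obtain ⟨b, b', hb', hbb⟩ := IsFractionRing.div_surjective B α
  -- The denominator `b'` is algebraic over `A`, so it divides a nonzero element `r` of `A`.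
  -- Multiplying the primitive element by `r` moves it into `B`.
  obtain ⟨r, hr, c, hc⟩ := (Algebra.IsAlgebraic.isAlgebraic (R := A) b').exists_nonzero_dvd hb'
  have hb0 : algebraMap B E b' ≠ 0 := by
    rw [Ne, map_eq_zero_iff _ hBE]
    exact nonZeroDivisors.ne_zero hb'
  have hθα : algebraMap B E (b * c) = algebraMap K E (algebraMap A K r) * α := by
    rw [← IsScalarTower.algebraMap_apply A K E, IsScalarTower.algebraMap_apply A B E, hc, ← hbb,
      map_mul, map_mul]
    field_simp
  have hr0 : algebraMap A K r ≠ 0 := by rwa [Ne, map_eq_zero_iff _ hAK]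
  set θ := b * c
  have htop : IntermediateField.adjoin K {algebraMap B E θ} = ⊤ := by
    rw [eq_top_iff, ← hα, IntermediateField.adjoin_simple_le_iff]
    have h1 := IntermediateField.mem_adjoin_simple_self K (algebraMap B E θ)
    have h2 := (IntermediateField.adjoin K {algebraMap B E θ}).algebraMap_mem
      (algebraMap A K r)⁻¹
    have hα' : algebraMap K E (algebraMap A K r)⁻¹ * algebraMap B E θ = α := by
      rw [hθα, ← mul_assoc, ← map_mul, inv_mul_cancel₀ hr0, map_one, one_mul]
    exact hα' ▸ mul_mem h2 h1
  have hev : ∀ f : Polynomial A, algebraMap B E (f.eval₂ (algebraMap A B) θ) =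
      Polynomial.aeval (algebraMap B E θ) (f.map (algebraMap A K)) := by
    intro f
    rw [Polynomial.hom_eval₂, Polynomial.aeval_map_algebraMap, Polynomial.aeval_def,
      IsScalarTower.algebraMap_eq A B E]
  have hint : IsIntegral K (algebraMap B E θ) := Algebra.IsIntegral.isIntegral _
  let p := minpoly K (algebraMap B E θ)
  have hsep : p.Separable := Algebra.IsSeparable.isSeparable K (algebraMap B E θ)
  obtain ⟨m, hm, μ, hμ⟩ := exists_map_eq_C_mul (A := A) p
  have hm0 : algebraMap A K m ≠ 0 := by rwa [Ne, map_eq_zero_iff _ hAK]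
  have hp0 : p ≠ 0 := minpoly.ne_zero hint
  refine ⟨θ, μ, ?_, ?_, ?_, ?_, ?_⟩
  · rintro rfl
    rw [Polynomial.map_zero] at hμ
    exact mul_ne_zero (Polynomial.C_ne_zero.2 hm0) hp0 hμ.symm
  · apply hBE
    rw [hev, hμ, map_mul, minpoly.aeval, mul_zero, map_zero]
  · intro f hf
    have h0 := hev f
    rw [hf, map_zero] at h0
    obtain ⟨k, hk⟩ := minpoly.dvd K _ h0.symm
    obtain ⟨a, ha, k', hk'⟩ := exists_map_eq_C_mul (A := A) k
    refine ⟨m * a, mul_ne_zero hm ha, k', hmap ?_⟩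
    rw [Polynomial.map_mul, Polynomial.map_mul, hμ, hk', hk, Polynomial.map_C, map_mul,
      Polynomial.C_mul]
    ring
  · obtain ⟨u, v, huv⟩ := hsep
    obtain ⟨a, ha, u', hu'⟩ := exists_map_eq_C_mul (A := A) u
    obtain ⟨a', ha', v', hv'⟩ := exists_map_eq_C_mul (A := A) v
    refine ⟨Polynomial.C a' * u', Polynomial.C a * v', m * a * a',
      mul_ne_zero (mul_ne_zero hm ha) ha', hmap ?_⟩
    rw [Polynomial.map_add, Polynomial.map_mul, Polynomial.map_mul, Polynomial.map_mul,
      Polynomial.map_mul, ← Polynomial.derivative_map, hμ, hu', hv', Polynomial.derivative_C_mul]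
    simp only [Polynomial.C_mul, Polynomial.map_mul, Polynomial.map_C]
    linear_combination (Polynomial.C (algebraMap A K m) * Polynomial.C (algebraMap A K a) *
      Polynomial.C (algebraMap A K a')) * huv
  · intro x
    have hx : algebraMap B E x ∈ (IntermediateField.adjoin K {algebraMap B E θ}).toSubalgebra := by
      rw [htop]; trivial
    rw [IntermediateField.adjoin_simple_toSubalgebra_of_isAlgebraic hint.isAlgebraic,
      Algebra.adjoin_singleton_eq_range_aeval] at hx
    obtain ⟨q, hq⟩ := hx
    obtain ⟨a, ha, q', hq'⟩ := exists_map_eq_C_mul (A := A) q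
    refine ⟨a, ha, q', hBE ?_⟩
    have hq2 : Polynomial.aeval (algebraMap B E θ) q = algebraMap B E x := hq
    rw [hev, hq', map_mul, map_mul, hq2, Polynomial.aeval_C,
      ← IsScalarTower.algebraMap_apply A K E, ← IsScalarTower.algebraMap_apply A B E]

theorem exists_primitive_element_relation {A B : Type*} [CommRing A] [IsDomain A] [CharZero A]
    [CommRing B] [IsDomain B] [Algebra A B] [FaithfulSMul A B] [Algebra.IsAlgebraic A B]
    [Algebra.FiniteType A B] :
    ∃ (θ : B) (μ : Polynomial A), μ ≠ 0 ∧ μ.eval₂ (algebraMap A B) θ = 0 ∧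
      (∀ f : Polynomial A, f.eval₂ (algebraMap A B) θ = 0 →
        ∃ a : A, a ≠ 0 ∧ ∃ k, Polynomial.C a * f = μ * k) ∧
      (∃ (u v : Polynomial A) (a : A), a ≠ 0 ∧
        u * μ + v * Polynomial.derivative μ = Polynomial.C a) ∧
      ∀ b : B, ∃ a : A, a ≠ 0 ∧ ∃ q : Polynomial A,
        algebraMap A B a * b = q.eval₂ (algebraMap A B) θ := by
  have : FaithfulSMul A (FractionRing B) := FaithfulSMul.trans A B (FractionRing B)
  let _ : Algebra (FractionRing A) (FractionRing B) := FractionRing.liftAlgebra A (FractionRing B)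
  have : Algebra.EssFiniteType B (FractionRing B) := .of_isLocalization _ (nonZeroDivisors B)
  have : Algebra.EssFiniteType A (FractionRing B) := .comp A B _
  have : Algebra.EssFiniteType (FractionRing A) (FractionRing B) := .of_comp A _ _
  have : Algebra.IsAlgebraic B (FractionRing B) := IsLocalization.isAlgebraic _ (nonZeroDivisors B)
  have : Algebra.IsAlgebraic A (FractionRing B) := Algebra.IsAlgebraic.trans A B _
  have : Algebra.IsAlgebraic (FractionRing A) (FractionRing B) :=
    IsFractionRing.comap_isAlgebraic_iff.1 this
  have : FiniteDimensional (FractionRing A) (FractionRing B) :=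
    Algebra.finite_of_essFiniteType_of_isAlgebraic
  have : CharZero (FractionRing A) := charZero_of_injective_algebraMap
    (IsFractionRing.injective A (FractionRing A))
  exact exists_primitive_relation (K := FractionRing A) (E := FractionRing B)

/-- Evaluation of a polynomial whose coefficients are polynomials. -/
def evalAt {τ : Type} (h : τ → ℂ) (ξ : ℂ) : Polynomial (MvPolynomial τ ℂ) →ₐ[ℂ] ℂ :=
  { (Polynomial.evalRingHom ξ).comp (Polynomial.mapRingHom (eval h)) with
    commutes' := fun c => by
      change Polynomial.eval ξ (Polynomial.map (eval h) (algebraMap ℂ _ c)) = _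
      rw [show algebraMap ℂ (Polynomial (MvPolynomial τ ℂ)) c = Polynomial.C (C c) from rfl]
      simp }

theorem evalAt_apply {τ : Type} (h : τ → ℂ) (ξ : ℂ) (f : Polynomial (MvPolynomial τ ℂ)) :
    evalAt h ξ f = (f.map (eval h)).eval ξ := rfl

/-- Equal numbers of variables make the injective extension algebraic, so it has a primitive element
`θ`. For general `h`, the value of `θ` identifies the fibre with the roots of `μ` specialized at
`h`, a separable polynomial of unchanged degree. -/
theorem exists_card_fibre_of_injective {β τ : Type} [Fintype β] [Fintype τ]
    (hcard : Fintype.card β = Fintype.card τ) (Ξ : τ → MvPolynomial β ℂ)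
    (hinj : Function.Injective (aeval Ξ : MvPolynomial τ ℂ → MvPolynomial β ℂ))
    {g : MvPolynomial β ℂ} (hg : g ≠ 0) :
    ∃ (D : ℕ) (δ : MvPolynomial τ ℂ), δ ≠ 0 ∧ ∀ h : τ → ℂ, eval h δ ≠ 0 →
      {z | eval z g ≠ 0 ∧ evalTuple Ξ z = h}.Finite ∧
      {z | eval z g ≠ 0 ∧ evalTuple Ξ z = h}.ncard = D := by
  classical
  let φ : MvPolynomial τ ℂ →ₐ[ℂ] MvPolynomial β ℂ := aeval Ξ
  let _ : Algebra (MvPolynomial τ ℂ) (MvPolynomial β ℂ) := φ.toRingHom.toAlgebra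
  have hφ : ∀ a, algebraMap (MvPolynomial τ ℂ) (MvPolynomial β ℂ) a = aeval Ξ a := fun a => rfl
  have : FaithfulSMul (MvPolynomial τ ℂ) (MvPolynomial β ℂ) :=
    (faithfulSMul_iff_algebraMap_injective _ _).2 hinj
  have : IsScalarTower ℂ (MvPolynomial τ ℂ) (MvPolynomial β ℂ) :=
    IsScalarTower.of_algebraMap_eq fun c => (φ.commutes c).symm
  have : Algebra.FiniteType (MvPolynomial τ ℂ) (MvPolynomial β ℂ) :=
    .of_restrictScalars_finiteType ℂ _ _
  have : Algebra.IsAlgebraic (MvPolynomial τ ℂ) (MvPolynomial β ℂ) := by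
    refine ⟨fun b => ?_⟩
    have hd := dep_ker_aeval (X : β → MvPolynomial β ℂ)
    obtain ⟨P, hP, hPb⟩ := hd.exists_relation (ι := Option τ) (by simp [hcard])
      (fun o => o.elim b Ξ)
    rw [aeval_X_left, RingHom.mem_ker, AlgHom.id_apply] at hPb
    refine ⟨optionEquivLeft ℂ τ P, (map_ne_zero_iff _ (optionEquivLeft ℂ τ).injective).2 hP, ?_⟩
    rw [← hPb]
    exact eval₂_optionEquivLeft b Ξ P
  obtain ⟨θ, μ, hμ0, hμ, hdvd, ⟨u, v, m, hm, huv⟩, hgen⟩ :=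
    exists_primitive_element_relation (A := MvPolynomial τ ℂ) (B := MvPolynomial β ℂ)
  choose a ha q hq using fun i => hgen (X i)
  -- A multiple of `g` lies in the base ring; where it is nonzero, every point of the fibre
  -- satisfies `g ≠ 0`.
  obtain ⟨ag, hag, g', hg'⟩ := (Algebra.IsAlgebraic.isAlgebraic (R := MvPolynomial τ ℂ)
    g).exists_nonzero_dvd (mem_nonZeroDivisors_of_ne_zero hg)
  let ev : Polynomial (MvPolynomial τ ℂ) →ₐ[ℂ] MvPolynomial β ℂ :=
    { Polynomial.eval₂RingHom (algebraMap _ (MvPolynomial β ℂ)) θ with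
      commutes' := fun c => by
        change Polynomial.eval₂ _ _ (algebraMap ℂ _ c) = _
        rw [show algebraMap ℂ (Polynomial (MvPolynomial τ ℂ)) c = Polynomial.C (C c) from rfl]
        simp [hφ] }
  have hev : ∀ f, ev f = f.eval₂ (algebraMap _ (MvPolynomial β ℂ)) θ := fun f => rfl
  -- An identity `f = k(θ)` specializes to any root `ξ`: with denominators cleared it is a
  -- polynomial relation for `θ`, hence divisible by `μ` up to the factor `c`. It applies to the
  -- point `z` rebuilt from `ξ`, not yet known to lie in the fibre.
  have key : ∀ (f : MvPolynomial β ℂ) (k : Polynomial (MvPolynomial τ ℂ)),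
      ev k = f → ∃ c : MvPolynomial τ ℂ, c ≠ 0 ∧ ∀ (h : τ → ℂ) (ξ : ℂ) (z : β → ℂ),
      eval h c ≠ 0 → (μ.map (eval h)).eval ξ = 0 → (∀ i, eval h (a i) ≠ 0) →
      (∀ i, ((q i).map (eval h)).eval ξ = z i * eval h (a i)) →
      eval z f = (k.map (eval h)).eval ξ := by
    intro f k hk
    obtain ⟨Θ, N, hΘ⟩ := exists_clear_denominators q (fun i => Polynomial.C (a i)) f
    have h0 : (Θ - k * (∏ i, Polynomial.C (a i)) ^ N).eval₂
        (algebraMap _ (MvPolynomial β ℂ)) θ = 0 := by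
      rw [← hev, map_sub, map_mul, hk, hΘ _ ev X, aeval_X_left, AlgHom.id_apply, map_pow, map_prod]
      · ring
      · intro i
        rw [hev, hev, ← hq, Polynomial.eval₂_C, mul_comm]
    obtain ⟨c, hc, k', hk'⟩ := hdvd _ h0
    refine ⟨c, hc, fun h ξ z hch hξ hah hz => ?_⟩
    have h1 := congrArg (evalAt h ξ) hk'
    rw [map_mul, map_mul, map_sub, map_mul, hΘ ℂ (evalAt h ξ) z] at h1
    · rw [evalAt_apply h ξ μ, hξ, zero_mul, evalAt_apply, Polynomial.map_C, Polynomial.eval_C,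
        map_pow, map_prod] at h1
      have h2 := (mul_eq_zero.1 h1).resolve_left hch
      have h3 : (∏ i, evalAt h ξ (Polynomial.C (a i))) ^ N ≠ 0 := by
        refine pow_ne_zero _ (Finset.prod_ne_zero_iff.2 fun i _ => ?_)
        rw [evalAt_apply, Polynomial.map_C, Polynomial.eval_C]
        exact hah i
      rw [mul_comm, ← sub_mul] at h2
      have h4 := (mul_eq_zero.1 h2).resolve_right h3
      rw [sub_eq_zero] at h4
      rw [← evalAt_apply, ← h4]
      rfl
    · intro i
      rw [evalAt_apply, evalAt_apply, Polynomial.map_C, Polynomial.eval_C, hz i]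
  choose c hc hcz using fun j => key (Ξ j) (Polynomial.C (X j)) (by rw [hev]; simp [hφ])
  obtain ⟨c', hc', hcz'⟩ := key θ Polynomial.X (by rw [hev]; simp)
  -- The factors keep, in order, the degree of `μ`, its separability, `g ≠ 0`, the denominators of
  -- the coordinates in terms of `θ`, and the identities of `key` for the components `Ξ j` and for
  -- `θ`.
  refine ⟨μ.natDegree, μ.leadingCoeff * m * ag * (∏ i, a i) * (∏ j, c j) * c', ?_, fun h hh => ?_⟩
  · refine mul_ne_zero (mul_ne_zero (mul_ne_zero (mul_ne_zero (mul_ne_zero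
      (Polynomial.leadingCoeff_ne_zero.2 hμ0) hm) hag) ?_) ?_) hc'
    · exact Finset.prod_ne_zero_iff.2 fun i _ => ha i
    · exact Finset.prod_ne_zero_iff.2 fun i _ => hc i
  simp only [map_mul, map_prod, mul_ne_zero_iff, Finset.prod_ne_zero_iff, Finset.mem_univ,
    true_implies] at hh
  obtain ⟨⟨⟨⟨⟨hlc, hmh⟩, hagh⟩, hah⟩, hch⟩, hch'⟩ := hh
  set μh := μ.map (eval h) with hμh
  have hdeg : μh.natDegree = μ.natDegree := Polynomial.natDegree_map_of_leadingCoeff_ne_zero _ hlc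
  have hμh0 : μh ≠ 0 := by
    rw [hμh, Ne, ← Polynomial.leadingCoeff_eq_zero,
      Polynomial.leadingCoeff_map_of_leadingCoeff_ne_zero _ hlc]
    exact hlc
  have hsep : μh.Separable := by
    have h1 := congrArg (Polynomial.map (eval h)) huv
    simp only [Polynomial.map_add, Polynomial.map_mul, Polynomial.map_C,
      ← Polynomial.derivative_map] at h1
    refine ⟨Polynomial.C (eval h m)⁻¹ * u.map (eval h), Polynomial.C (eval h m)⁻¹ * v.map (eval h),
      ?_⟩
    rw [mul_assoc, mul_assoc, ← mul_add, h1, ← Polynomial.C_mul, inv_mul_cancel₀ hmh,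
      Polynomial.C_1]
  have hcardroots : (μh.roots.toFinset).card = μ.natDegree := by
    rw [Multiset.toFinset_card_of_nodup (Polynomial.nodup_roots hsep),
      IsAlgClosed.card_roots_eq_natDegree, hdeg]
  have hevz : ∀ z, evalTuple Ξ z = h → ∀ f : Polynomial (MvPolynomial τ ℂ),
      eval z (f.eval₂ (algebraMap _ (MvPolynomial β ℂ)) θ) =
        (f.map (eval h)).eval (eval z θ) := by
    intro z hz f
    rw [Polynomial.hom_eval₂, Polynomial.eval_map]
    congr 1
    rw [← hz]
    refine RingHom.ext fun p => ?_
    exact eval_aeval_tuple Ξ z p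
  have heva : ∀ z, evalTuple Ξ z = h → ∀ p : MvPolynomial τ ℂ,
      eval z (algebraMap _ (MvPolynomial β ℂ) p) = eval h p := by
    intro z hz p
    rw [hφ, eval_aeval_tuple, hz]
  have hqz : ∀ z, evalTuple Ξ z = h → ∀ i, eval h (a i) * z i =
      ((q i).map (eval h)).eval (eval z θ) := by
    intro z hz i
    rw [← hevz z hz, ← hq, map_mul, heva z hz, eval_X]
  have hinjOn : Set.InjOn (fun z => eval z θ) {z | eval z g ≠ 0 ∧ evalTuple Ξ z = h} := by
    rintro z ⟨-, hz⟩ w ⟨-, hw⟩ hzw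
    funext i
    refine mul_left_cancel₀ (hah i) ?_
    rw [hqz z hz, hqz w hw]
    exact congrArg (fun x => ((q i).map (eval h)).eval x) hzw
  have himage : (fun z => eval z θ) '' {z | eval z g ≠ 0 ∧ evalTuple Ξ z = h} =
      μh.roots.toFinset := by
    ext ξ
    simp only [Set.mem_image, Finset.mem_coe, Multiset.mem_toFinset, Polynomial.mem_roots hμh0,
      Polynomial.IsRoot.def]
    constructor
    · rintro ⟨z, ⟨-, hz⟩, rfl⟩
      rw [hμh, ← hevz z hz, hμ, map_zero]
    · intro hξ
      let z : β → ℂ := fun i => ((q i).map (eval h)).eval ξ / eval h (a i)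
      have hz : ∀ i, ((q i).map (eval h)).eval ξ = z i * eval h (a i) := fun i =>
        (div_mul_cancel₀ _ (hah i)).symm
      have hΞ : evalTuple Ξ z = h := by
        funext j
        refine (hcz j h ξ z (hch j) hξ hah hz).trans ?_
        simp
      refine ⟨z, ⟨?_, hΞ⟩, ?_⟩
      · intro h0
        apply hagh
        rw [← heva z hΞ, hg', map_mul, h0, zero_mul]
      · refine (hcz' h ξ z hch' hξ hah hz).trans ?_
        simp
  constructor
  · refine Set.Finite.of_finite_image ?_ hinjOn
    rw [himage]
    exact Finset.finite_toSet _
  · rw [← hinjOn.ncard_image, himage, Set.ncard_coe_finset, hcardroots]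

/-- A polynomial map between affine spaces of the same dimension has the same number of preimages
at all points of a nonempty Zariski open set. -/
theorem exists_card_fibre {β τ : Type} [Fintype β] [Fintype τ]
    (hcard : Fintype.card β = Fintype.card τ) (Ξ : τ → MvPolynomial β ℂ)
    {g : MvPolynomial β ℂ} (hg : g ≠ 0) :
    ∃ (D : ℕ) (δ : MvPolynomial τ ℂ), δ ≠ 0 ∧ ∀ h : τ → ℂ, eval h δ ≠ 0 →
      {z | eval z g ≠ 0 ∧ evalTuple Ξ z = h}.Finite ∧
      {z | eval z g ≠ 0 ∧ evalTuple Ξ z = h}.ncard = D := by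
  by_cases hinj : Function.Injective (aeval Ξ : MvPolynomial τ ℂ → MvPolynomial β ℂ)
  · exact exists_card_fibre_of_injective hcard Ξ hinj hg
  -- If the map is not dominant, its image lies in a hypersurface and the general fibre is empty, so
  -- the degree is `0`.
  · rw [injective_iff_map_eq_zero (aeval Ξ : MvPolynomial τ ℂ →ₐ[ℂ] MvPolynomial β ℂ)] at hinj
    push Not at hinj
    obtain ⟨P, hP, hP0⟩ := hinj
    refine ⟨0, P, hP0, fun h hh => ?_⟩
    have : {z | eval z g ≠ 0 ∧ evalTuple Ξ z = h} = ∅ := by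
      refine Set.eq_empty_of_forall_notMem ?_
      rintro z ⟨-, rfl⟩
      apply hh
      rw [← eval_aeval_tuple, hP, map_zero]
    simp [this]

/-! ## Polynomials: derivatives, homogeneity, linear independence -/

/-- The derivative of a polynomial function. -/
def polyDeriv {σ : Type} [Fintype σ] (f : MvPolynomial σ ℂ) (v : σ → ℂ) : (σ → ℂ) →L[ℂ] ℂ :=
  ∑ s, eval v (pderiv s f) • ContinuousLinearMap.proj s

theorem polyDeriv_apply {σ : Type} [Fintype σ] (f : MvPolynomial σ ℂ) (v u : σ → ℂ) :
    polyDeriv f v u = ∑ s, eval v (pderiv s f) * u s := by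
  simp [polyDeriv]

theorem polyDeriv_eq_grad {n : ℕ} (f : MvPolynomial (Fin n) ℂ) (w u : Fin n → ℂ) :
    polyDeriv f w u = dotProduct (grad f w) u := by
  rw [polyDeriv_apply]; rfl

theorem hasFDerivAt_eval {σ : Type} [Fintype σ] (f : MvPolynomial σ ℂ) (v : σ → ℂ) :
    HasFDerivAt (fun v => eval v f) (polyDeriv f v) v := by
  classical
  induction f using MvPolynomial.induction_on with
  | C c =>
    have : polyDeriv (C c) v = 0 := by ext u; simp [polyDeriv_apply]
    rw [this]
    simpa using hasFDerivAt_const c v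
  | add f g hf hg =>
    have : polyDeriv (f + g) v = polyDeriv f v + polyDeriv g v := by
      ext u; simp [polyDeriv_apply, add_mul, Finset.sum_add_distrib]
    rw [this]
    simp only [map_add]
    exact hf.add hg
  | mul_X f s hf =>
    have : polyDeriv (f * X s) v = eval v f • ContinuousLinearMap.proj s + v s • polyDeriv f v := by
      ext u
      rw [show (eval v f • ContinuousLinearMap.proj s + v s • polyDeriv f v : (σ → ℂ) →L[ℂ] ℂ) u =
        eval v f * u s + v s * polyDeriv f v u from rfl]
      simp only [polyDeriv_apply, Derivation.leibniz, pderiv_X, smul_eq_mul, map_add, map_mul,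
        eval_X, add_mul, Finset.sum_add_distrib]
      congr 1
      · rw [Finset.sum_eq_single s]
        · simp
        · intro t _ hts
          rw [Pi.single_eq_of_ne hts.symm]
          simp
        · simp
      · rw [Finset.mul_sum]
        exact Finset.sum_congr rfl fun t _ => by ring
    rw [this]
    simp only [map_mul, eval_X]
    exact hf.mul (hasFDerivAt_apply s v)

theorem hasFDerivAt_evalTuple {σ ι : Type} [Fintype σ] [Fintype ι] (F : ι → MvPolynomial σ ℂ)
    (v : σ → ℂ) : HasFDerivAt (evalTuple F) (ContinuousLinearMap.pi fun j => polyDeriv (F j) v) v :=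
  hasFDerivAt_pi.2 fun j => hasFDerivAt_eval (F j) v

theorem evalTuple_pderiv_sum {σ ι : Type} [Fintype σ] (F : ι → MvPolynomial σ ℂ) (v u : σ → ℂ) :
    (fun j => polyDeriv (F j) v u) = ∑ s, u s • evalTuple (fun j => pderiv s (F j)) v := by
  funext j
  simp [polyDeriv_apply, evalTuple, mul_comm]

theorem polyDeriv_comp {σ ι : Type} [Fintype σ] [Fintype ι] (F : ι → MvPolynomial σ ℂ)
    (f : MvPolynomial ι ℂ) (v u : σ → ℂ) : polyDeriv (aeval F f) v u =
      polyDeriv f (evalTuple F v) (fun j => polyDeriv (F j) v u) := by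
  have h1 := hasFDerivAt_eval (aeval F f) v
  have h2 : HasFDerivAt (fun v => eval v (aeval F f))
      ((polyDeriv f (evalTuple F v)).comp
        (ContinuousLinearMap.pi fun j => polyDeriv (F j) v)) v := by
    simp only [eval_aeval_tuple]
    exact (hasFDerivAt_eval f (evalTuple F v)).comp v (hasFDerivAt_evalTuple F v)
  rw [h1.unique h2]
  rfl

/-- Every monomial of weight `D` is multiplied by the same character value. A general grading monoid
lets this cover both ordinary homogeneity and multidegrees. -/
theorem eval_character_smul {σ M : Type} [AddCommMonoid M] {wt : σ → M}
    {f : MvPolynomial σ ℂ} {D : M} (hf : IsWeightedHomogeneous wt f D)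
    (χ : Multiplicative M →* ℂ) (v : σ → ℂ) :
    eval (fun s => χ (Multiplicative.ofAdd (wt s)) * v s) f =
      χ (Multiplicative.ofAdd D) * eval v f := by
  rw [eval_eq, eval_eq, Finset.mul_sum]
  refine Finset.sum_congr rfl fun m hm => ?_
  have hD : Finsupp.weight wt m = D := hf (mem_support_iff.1 hm)
  have : χ (Multiplicative.ofAdd D) = ∏ i ∈ m.support, χ (Multiplicative.ofAdd (wt i)) ^ m i := by
    rw [← hD, Finsupp.weight_apply, Finsupp.sum, ofAdd_sum, map_prod]
    refine Finset.prod_congr rfl fun i _ => ?_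
    rw [ofAdd_nsmul, map_pow]
  rw [this]
  simp only [mul_pow, Finset.prod_mul_distrib]
  ring

theorem eval_smul_of_isHomogeneous {σ : Type} {f : MvPolynomial σ ℂ} {e : ℕ}
    (hf : f.IsHomogeneous e) (c : ℂ) (v : σ → ℂ) : eval (c • v) f = c ^ e * eval v f := by
  have := eval_character_smul (wt := (1 : σ → ℕ)) hf (powersHom ℂ c) v
  simpa [powersHom_apply, Pi.smul_def] using this

/-- The restriction of `f` to the line through `w` is a polynomial in `c` whose coefficients are the
values of the components. It has infinitely many roots. -/
theorem homogeneousComponent_eval_eq_zero {σ : Type} {f : MvPolynomial σ ℂ} {w : σ → ℂ}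
    (h : ∀ c : ℂ, c ≠ 0 → eval (c • w) f = 0) (i : ℕ) :
    eval w (homogeneousComponent i f) = 0 := by
  let p : Polynomial ℂ := ∑ i ∈ Finset.range (f.totalDegree + 1),
    Polynomial.C (eval w (homogeneousComponent i f)) * Polynomial.X ^ i
  have hp : ∀ c, p.eval c = eval (c • w) f := by
    intro c
    conv_rhs => rw [← sum_homogeneousComponent f]
    rw [map_sum, Polynomial.eval_finsetSum]
    refine Finset.sum_congr rfl fun i _ => ?_
    rw [eval_smul_of_isHomogeneous (homogeneousComponent_isHomogeneous i f), Polynomial.eval_mul,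
      Polynomial.eval_C, Polynomial.eval_pow, Polynomial.eval_X, mul_comm]
  have hp0 : p = 0 := by
    refine Polynomial.eq_zero_of_infinite_isRoot p
      ((Set.finite_singleton (0 : ℂ)).infinite_compl.mono ?_)
    intro c hc
    exact (hp c).trans (h c hc)
  by_cases hi : i < f.totalDegree + 1
  · have := congrArg (fun q => Polynomial.coeff q i) hp0
    simp only [p, Polynomial.finsetSum_coeff, Polynomial.coeff_C_mul_X_pow,
      Polynomial.coeff_zero] at this
    rwa [Finset.sum_ite_eq, if_pos (Finset.mem_range.2 hi)] at this
  · rw [homogeneousComponent_eq_zero i f (by omega), map_zero]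

/-- A matrix of functionals that detects the linear independence of the tuples `F l` at `v₀`. -/
theorem exists_det_ne_zero {σ τ : Type} [Fintype τ] {q : ℕ}
    (F : Fin q → τ → MvPolynomial σ ℂ) {v₀ : σ → ℂ}
    (h : LinearIndependent ℂ fun l => evalTuple (F l) v₀) :
    ∃ Λ : Matrix (Fin q) τ ℂ,
      (Λ * Matrix.of fun t l => eval v₀ (F l t)).det ≠ 0 := by
  classical
  set M : Matrix τ (Fin q) ℂ := Matrix.of fun t l => eval v₀ (F l t)
  have hinj : Function.Injective M.mulVec := Matrix.mulVec_injective_iff.2 h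
  obtain ⟨g, hg⟩ := LinearMap.exists_leftInverse_of_injective M.mulVecLin
    (LinearMap.ker_eq_bot.2 hinj)
  refine ⟨LinearMap.toMatrix' g, ?_⟩
  have : LinearMap.toMatrix' g * M = 1 := by
    rw [← LinearMap.toMatrix'_id, ← hg, LinearMap.toMatrix'_comp]
    congr 1
    exact (LinearMap.toMatrix'_toLin' M).symm
  rw [this]
  simp

theorem linearIndependent_of_det_ne_zero {σ τ : Type} [Fintype τ] {q : ℕ}
    {F : Fin q → τ → MvPolynomial σ ℂ} {v : σ → ℂ} {Λ : Matrix (Fin q) τ ℂ}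
    (h : (Λ * Matrix.of fun t l => eval v (F l t)).det ≠ 0) :
    LinearIndependent ℂ fun l => evalTuple (F l) v := by
  classical
  set M : Matrix τ (Fin q) ℂ := Matrix.of fun t l => eval v (F l t)
  have h1 : LinearIndependent ℂ M.col := by
    rw [← Matrix.mulVec_injective_iff]
    have h2 := Matrix.mulVec_injective_iff.2
      (Matrix.linearIndependent_cols_of_isUnit ((Matrix.isUnit_iff_isUnit_det _).2 h.isUnit))
    intro x y hxy
    apply h2
    rw [← Matrix.mulVec_mulVec, ← Matrix.mulVec_mulVec, hxy]
  exact h1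

/-- The determinant that detects linear independence, as a polynomial. -/
def detPoly {σ τ : Type} [Fintype τ] {q : ℕ} (F : Fin q → τ → MvPolynomial σ ℂ)
    (Λ : Matrix (Fin q) τ ℂ) : MvPolynomial σ ℂ :=
  (Matrix.of fun i j => ∑ t, C (Λ i t) * F j t : Matrix (Fin q) (Fin q) _).det

theorem eval_detPoly {σ τ : Type} [Fintype τ] {q : ℕ} (F : Fin q → τ → MvPolynomial σ ℂ)
    (Λ : Matrix (Fin q) τ ℂ) (v : σ → ℂ) :
    eval v (detPoly F Λ) = (Λ * Matrix.of fun t l => eval v (F l t)).det := by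
  rw [detPoly, RingHom.map_det]
  congr 1
  ext i j
  simp [Matrix.mul_apply]

/-- This is semicontinuity of rank: a compressed minor that is nonzero at `v₀` detects independence
on a principal open set. -/
theorem exists_poly_linearIndependent {σ τ : Type} [Fintype τ] {q : ℕ}
    (F : Fin q → τ → MvPolynomial σ ℂ) {v₀ : σ → ℂ}
    (h : LinearIndependent ℂ fun l => evalTuple (F l) v₀) :
    ∃ δ : MvPolynomial σ ℂ, eval v₀ δ ≠ 0 ∧ ∀ v, eval v δ ≠ 0 →
      LinearIndependent ℂ fun l => evalTuple (F l) v := by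
  obtain ⟨Λ, hΛ⟩ := exists_det_ne_zero F h
  refine ⟨detPoly F Λ, by rwa [eval_detPoly], fun v hv => ?_⟩
  rw [eval_detPoly] at hv
  exact linearIndependent_of_det_ne_zero hv

/-! ## Tangent spaces and the Rayleigh quotient -/

section
variable {n : ℕ} {V : Set (PSpace n)} {w : Fin n → ℂ}

theorem mem_jacSpan {z : Fin n → ℂ} : z ∈ jacSpan V w ↔ ∃ f ∈ vanIdeal V, z = grad f w := by
  constructor
  · intro hz
    induction hz using Submodule.span_induction with
    | mem z hz => exact hz
    | zero => exact ⟨0, zero_mem _, by funext j; simp [grad]⟩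
    | add x y _ _ hx hy =>
      obtain ⟨f, hf, rfl⟩ := hx
      obtain ⟨g, hg, rfl⟩ := hy
      exact ⟨f + g, add_mem hf hg, by funext j; simp [grad]⟩
    | smul c x _ hx =>
      obtain ⟨f, hf, rfl⟩ := hx
      refine ⟨C c * f, Ideal.mul_mem_left _ _ hf, ?_⟩
      funext j
      simp [grad]
  · rintro ⟨f, hf, rfl⟩
    exact Submodule.subset_span ⟨f, hf, rfl⟩

/-- The tangent space of the affine cone as a linear subspace. -/
def tangent (V : Set (PSpace n)) (w : Fin n → ℂ) : Submodule ℂ (Fin n → ℂ) where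
  carrier := coneTangent V w
  zero_mem' := fun f _ => by simp
  add_mem' := fun hx hy f hf => by rw [dotProduct_add, hx f hf, hy f hf, add_zero]
  smul_mem' := fun c x hx f hf => by rw [dotProduct_smul, hx f hf, smul_zero]

theorem mem_tangent {u : Fin n → ℂ} : u ∈ tangent V w ↔ ∀ f ∈ vanIdeal V, polyDeriv f w u = 0 := by
  simp only [polyDeriv_eq_grad]
  rfl

theorem nondegenerate_dotProduct :
    LinearMap.BilinForm.Nondegenerate (dotProductBilin ℂ ℂ : LinearMap.BilinForm ℂ (Fin n → ℂ)) := by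
  constructor
  · intro x hx
    exact dotProduct_eq_zero x hx
  · intro x hx
    exact dotProduct_eq_zero x fun y => (dotProduct_comm _ _).trans (hx y)

theorem tangent_eq_orthogonal : tangent V w =
    LinearMap.BilinForm.orthogonal (dotProductBilin ℂ ℂ) (jacSpan V w) := by
  ext u
  rw [LinearMap.BilinForm.mem_orthogonal_iff]
  constructor
  · intro hu z hz
    obtain ⟨f, hf, rfl⟩ := mem_jacSpan.1 hz
    exact hu f hf
  · intro hu f hf
    exact hu _ (mem_jacSpan.2 ⟨f, hf, rfl⟩)

theorem finrank_jacSpan_add_finrank_tangent :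
    Module.finrank ℂ (jacSpan V w) + Module.finrank ℂ (tangent V w) = n := by
  rw [tangent_eq_orthogonal, LinearMap.BilinForm.finrank_orthogonal nondegenerate_dotProduct,
    Module.finrank_fin_fun]
  have := (jacSpan V w).finrank_le
  rw [Module.finrank_fin_fun] at this
  omega

theorem mem_jacSpan_iff_forall_tangent {z : Fin n → ℂ} :
    z ∈ jacSpan V w ↔ ∀ u ∈ tangent V w, dotProduct z u = 0 := by
  have href : LinearMap.BilinForm.IsRefl
      (dotProductBilin ℂ ℂ : LinearMap.BilinForm ℂ (Fin n → ℂ)) := fun x y h =>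
    (dotProduct_comm y x).trans h
  conv_lhs => rw [← LinearMap.BilinForm.orthogonal_orthogonal nondegenerate_dotProduct href
    (jacSpan V w), ← tangent_eq_orthogonal, LinearMap.BilinForm.mem_orthogonal_iff]
  exact forall₂_congr fun u _ => by
    change dotProduct u z = 0 ↔ _
    rw [dotProduct_comm]

/-- The substitution x ↦ cx preserves the ideal of the cone, and by the chain rule it multiplies
gradients by `c`. -/
theorem jacSpan_smul_le {c : ℂ} (hc : c ≠ 0) : jacSpan V (c • w) ≤ jacSpan V w := by
  intro z hz
  obtain ⟨f, hf, rfl⟩ := mem_jacSpan.1 hz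
  let F : Fin n → MvPolynomial (Fin n) ℂ := fun s => C c * X s
  have hF : ∀ v, evalTuple F v = c • v := fun v => by funext s; simp [evalTuple, F]
  have hfc : aeval F f ∈ vanIdeal V := by
    intro y hy v hv
    rw [eval_aeval_tuple, hF]
    exact hf y hy _ (proj_rep_smul hv hc)
  have hgrad : grad (aeval F f) w = c • grad f (c • w) := by
    refine sub_eq_zero.1 (dotProduct_eq_zero _ fun u => ?_)
    rw [sub_dotProduct, ← polyDeriv_eq_grad, polyDeriv_comp, hF, smul_dotProduct,
      ← polyDeriv_eq_grad]
    have : (fun j => polyDeriv (F j) w u) = c • u := by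
      funext j
      simp [F, polyDeriv_apply, pderiv_X, Pi.single_apply, apply_ite (eval w)]
    rw [this, map_smul, sub_self]
  have : grad f (c • w) = c⁻¹ • grad (aeval F f) w := by
    rw [hgrad, smul_smul, inv_mul_cancel₀ hc, one_smul]
  rw [this]
  exact Submodule.smul_mem _ _ (mem_jacSpan.2 ⟨_, hfc, rfl⟩)

theorem jacSpan_smul {c : ℂ} (hc : c ≠ 0) : jacSpan V (c • w) = jacSpan V w := by
  refine le_antisymm (jacSpan_smul_le hc) ?_
  have := jacSpan_smul_le (V := V) (w := c • w) (inv_ne_zero hc)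
  rwa [smul_smul, inv_mul_cancel₀ hc, one_smul] at this

/-- Elements of the ideal vanish along the punctured line through `w`; differentiating at `t = 1`
replaces Euler's formula, which would need homogeneity. -/
theorem mem_tangent_self {y : PSpace n} (hy : y ∈ V) (hw : HomCoords.Rep w y) :
    w ∈ tangent V w := by
  rw [mem_tangent]
  intro f hf
  have h1 : HasDerivAt (fun t : ℂ => eval (t • w) f) (polyDeriv f w w) 1 := by
    have h2 : HasDerivAt (fun t : ℂ => t • w) w 1 := by
      simpa using (hasDerivAt_id (1 : ℂ)).smul_const w
    have h3 := hasFDerivAt_eval f ((1 : ℂ) • w)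
    have h4 := h3.comp_hasDerivAt (1 : ℂ) h2
    rw [one_smul] at h4
    exact h4
  have h5 : (fun t : ℂ => eval (t • w) f) =ᶠ[nhds 1] fun _ => 0 := by
    filter_upwards [isOpen_compl_singleton.mem_nhds (one_ne_zero : (1 : ℂ) ∈ ({0} : Set ℂ)ᶜ)]
      with t ht
    exact hf y hy _ (proj_rep_smul hw ht)
  exact h1.unique ((hasDerivAt_const (1 : ℂ) (0 : ℂ)).congr_of_eventuallyEq h5)

theorem dotProduct_eq_zero_of_mem_jacSpan {y : PSpace n} (hy : y ∈ V) (hw : HomCoords.Rep w y)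
    {z : Fin n → ℂ} (hz : z ∈ jacSpan V w) : dotProduct z w = 0 :=
  mem_jacSpan_iff_forall_tangent.1 hz w (mem_tangent_self hy hw)

theorem differentiableAt_rayleigh (A : Matrix (Fin n) (Fin n) ℂ) (hw : dotProduct w w ≠ 0) :
    DifferentiableAt ℂ (rayleigh A) w := by
  have h : DifferentiableAt ℂ (fun y : Fin n → ℂ => dotProduct y (A.mulVec y)) w := by
    simp only [dotProduct, Matrix.mulVec]
    fun_prop
  have h' : DifferentiableAt ℂ (fun y : Fin n → ℂ => dotProduct y y) w := by
    simp only [dotProduct]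
    fun_prop
  have := h.fun_mul (h'.fun_inv hw)
  simp only [← div_eq_mul_inv] at this
  exact this

theorem fderiv_rayleigh {A : Matrix (Fin n) (Fin n) ℂ} (hA : A.IsSymm)
    (hw : dotProduct w w ≠ 0) (u : Fin n → ℂ) : fderiv ℂ (rayleigh A) w u =
      2 * (dotProduct u (A.mulVec w) * dotProduct w w -
        dotProduct w (A.mulVec w) * dotProduct u w) / dotProduct w w ^ 2 := by
  rw [← (differentiableAt_rayleigh A hw).lineDeriv_eq_fderiv]
  -- Used for the numerator with `M = A` and for the denominator with `M = 1`.
  have hquad : ∀ M : Matrix (Fin n) (Fin n) ℂ, M.IsSymm →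
      HasDerivAt (fun t : ℂ => dotProduct (w + t • u) (M.mulVec (w + t • u)))
        (2 * dotProduct u (M.mulVec w)) 0 := by
    intro M hM
    have hs : dotProduct w (M.mulVec u) = dotProduct u (M.mulVec w) := by
      rw [Matrix.dotProduct_mulVec, ← Matrix.mulVec_transpose, hM.eq, dotProduct_comm]
    have : (fun t : ℂ => dotProduct (w + t • u) (M.mulVec (w + t • u))) = fun t =>
        dotProduct w (M.mulVec w) + t * (2 * dotProduct u (M.mulVec w)) +
          t ^ 2 * dotProduct u (M.mulVec u) := by
      funext t
      simp only [Matrix.mulVec_add, Matrix.mulVec_smul, dotProduct_add, add_dotProduct,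
        smul_dotProduct, dotProduct_smul, smul_eq_mul, hs]
      ring
    rw [this]
    have h1 := (((hasDerivAt_id (0 : ℂ)).mul_const (2 * dotProduct u (M.mulVec w))).const_add
      (dotProduct w (M.mulVec w))).add
      ((hasDerivAt_pow 2 (0 : ℂ)).mul_const (dotProduct u (M.mulVec u)))
    exact h1.congr_deriv (by simp)
  have h1 := hquad A hA
  have h2 := hquad 1 Matrix.isSymm_one
  simp only [Matrix.one_mulVec] at h2
  have h3 := h1.div h2 (by simpa using hw)
  have h4 : lineDeriv ℂ (rayleigh A) w u = _ := h3.deriv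
  rw [h4]
  simp only [zero_smul, add_zero]
  ring

/-! ## The linear system of critical matrices -/

theorem symMatrix_isSymm (h : Sym2 (Fin n) → ℂ) : (symMatrix h).IsSymm :=
  (isSymm_iff_exists_symMatrix _).2 ⟨h, rfl⟩

/-- The linear map `h ↦ H w`. -/
def symMulVec (w : Fin n → ℂ) : (Sym2 (Fin n) → ℂ) →ₗ[ℂ] (Fin n → ℂ) where
  toFun h := (symMatrix h).mulVec w
  map_add' h h' := by
    rw [← Matrix.add_mulVec]
    congr 1
  map_smul' c h := by
    rw [RingHom.id_apply, ← Matrix.smul_mulVec]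
    congr 1

/-- The matrices for which `w` represents a critical point. -/
def critSpace (V : Set (PSpace n)) (w : Fin n → ℂ) : Submodule ℂ (Sym2 (Fin n) → ℂ) :=
  (jacSpan V w ⊔ Submodule.span ℂ {w}).comap (symMulVec w)

theorem mem_critSpace {h : Sym2 (Fin n) → ℂ} : h ∈ critSpace V w ↔
    ∃ z ∈ jacSpan V w, ∃ α : ℂ, (symMatrix h).mulVec w = z + α • w := by
  rw [critSpace, Submodule.mem_comap, Submodule.mem_sup]
  constructor
  · rintro ⟨z, hz, x, hx, h⟩
    obtain ⟨α, rfl⟩ := Submodule.mem_span_singleton.1 hx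
    exact ⟨z, hz, α, h.symm⟩
  · rintro ⟨z, hz, α, h⟩
    exact ⟨z, hz, _, Submodule.mem_span_singleton.2 ⟨α, rfl⟩, h.symm⟩

theorem critSpace_smul {c : ℂ} (hc : c ≠ 0) : critSpace V (c • w) = critSpace V w := by
  ext h
  simp only [mem_critSpace, jacSpan_smul hc, Matrix.mulVec_smul]
  constructor
  · rintro ⟨z, hz, α, h⟩
    refine ⟨c⁻¹ • z, Submodule.smul_mem _ _ hz, α, ?_⟩
    have := congrArg (fun x => c⁻¹ • x) h
    simp only [smul_smul, smul_add, inv_mul_cancel₀ hc, one_smul] at this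
    rw [this, mul_comm α c, ← mul_assoc, inv_mul_cancel₀ hc, one_mul]
  · rintro ⟨z, hz, α, h⟩
    refine ⟨c • z, Submodule.smul_mem _ _ hz, α, ?_⟩
    rw [h, smul_add, smul_comm]

/-- Up to a nonzero factor the gradient is (wᵀw)Hw − (wᵀHw)w, and criticality means that it is
normal. If Hw = z + αw with `z` normal, pairing with `w` kills `z` and forces `α` to be the Rayleigh
quotient, so `α` may be left free in `critSpace`. -/
theorem mem_critSpace_iff {y : PSpace n} (hy : y ∈ V) (hw : HomCoords.Rep w y)
    (hw0 : dotProduct w w ≠ 0) {h : Sym2 (Fin n) → ℂ} :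
    h ∈ critSpace V w ↔ ∀ u ∈ tangent V w, fderiv ℂ (rayleigh (symMatrix h)) w u = 0 := by
  have h1 : (∀ u ∈ tangent V w, fderiv ℂ (rayleigh (symMatrix h)) w u = 0) ↔
      dotProduct w w • (symMatrix h).mulVec w -
        dotProduct w ((symMatrix h).mulVec w) • w ∈ jacSpan V w := by
    rw [mem_jacSpan_iff_forall_tangent]
    refine forall₂_congr fun u _ => ?_
    rw [fderiv_rayleigh (symMatrix_isSymm h) hw0, div_eq_zero_iff, or_iff_left (pow_ne_zero 2 hw0),
      mul_eq_zero, or_iff_right two_ne_zero, sub_dotProduct, smul_dotProduct, smul_dotProduct,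
      dotProduct_comm u, dotProduct_comm u w, smul_eq_mul, smul_eq_mul, mul_comm (dotProduct w w)]
  rw [h1, mem_critSpace]
  constructor
  · rintro ⟨z, hz, α, h⟩
    have hzw : dotProduct w z = 0 := by
      rw [dotProduct_comm]; exact dotProduct_eq_zero_of_mem_jacSpan hy hw hz
    rw [h, dotProduct_add, hzw, zero_add, dotProduct_smul, smul_add, smul_smul, smul_eq_mul,
      mul_comm α, add_sub_cancel_right]
    exact Submodule.smul_mem _ _ hz
  · intro hz
    refine ⟨_, Submodule.smul_mem _ (dotProduct w w)⁻¹ hz,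
      (dotProduct w w)⁻¹ * dotProduct w ((symMatrix h).mulVec w), ?_⟩
    rw [smul_sub, smul_smul, smul_smul, inv_mul_cancel₀ hw0, one_smul, sub_add_cancel]

end

section
variable {n : ℕ}

/-! ## Polynomial sections of the system of critical matrices -/

/-- The entries of a symmetric matrix that maps `w` to `(wᵀ w)² z`. -/
def symExtend {R : Type} [CommRing R] (w z : Fin n → R) (q : Sym2 (Fin n)) : R :=
  q.lift ⟨fun i j => dotProduct w w * (z i * w j + z j * w i) - dotProduct w z * (w i * w j),
    fun i j => by ring⟩

/-- The compression of a symmetric matrix to the orthogonal complement of `w`, up to a factor. -/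
def symCompress {R : Type} [CommRing R] (w : Fin n → R) (k : Sym2 (Fin n) → R)
    (q : Sym2 (Fin n)) : R :=
  q.lift ⟨fun i j => ∑ a, ∑ b, ((if i = a then dotProduct w w else 0) - w i * w a) * k s(a, b) *
      ((if j = b then dotProduct w w else 0) - w j * w b), fun i j => by
    dsimp only
    rw [Finset.sum_comm]
    refine Finset.sum_congr rfl fun a _ => Finset.sum_congr rfl fun b _ => ?_
    rw [Sym2.eq_swap]
    ring⟩

/-- The entries of the identity matrix. -/
def symOne {R : Type} [CommRing R] (q : Sym2 (Fin n)) : R :=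
  q.lift ⟨fun i j => if i = j then 1 else 0, fun i j => by simp [eq_comm]⟩

theorem symMatrix_symExtend_mulVec (w z : Fin n → ℂ) :
    (symMatrix (symExtend w z)).mulVec w = dotProduct w w ^ 2 • z := by
  funext i
  have h1 : ∀ j, symMatrix (symExtend w z) i j * w j =
      dotProduct w w * z i * (w j * w j) + dotProduct w w * w i * (w j * z j) -
        dotProduct w z * w i * (w j * w j) := fun j => by
    simp only [symMatrix, symExtend, Matrix.of_apply, Sym2.lift_mk]
    ring
  simp only [Matrix.mulVec, dotProduct, h1, Finset.sum_add_distrib, Finset.sum_sub_distrib,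
    ← Finset.mul_sum, Pi.smul_apply, smul_eq_mul]
  ring

theorem symMatrix_symOne : symMatrix (symOne : Sym2 (Fin n) → ℂ) = 1 := by
  ext i j
  simp [symMatrix, symOne, Matrix.one_apply]

theorem symMatrix_symCompress_mulVec (w : Fin n → ℂ) (k : Sym2 (Fin n) → ℂ) :
    (symMatrix (symCompress w k)).mulVec w = 0 := by
  funext i
  have h0 : ∀ b, ∑ j, ((if j = b then dotProduct w w else 0) - w j * w b) * w j = 0 := by
    intro b
    simp only [sub_mul, Finset.sum_sub_distrib, ite_mul, zero_mul, Finset.sum_ite_eq',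
      Finset.mem_univ, if_true]
    rw [sub_eq_zero, dotProduct, Finset.sum_mul]
    exact Finset.sum_congr rfl fun j _ => by ring
  simp only [Matrix.mulVec, dotProduct, symMatrix, symCompress, Matrix.of_apply, Sym2.lift_mk,
    Pi.zero_apply, Finset.sum_mul]
  rw [Finset.sum_comm]
  refine Finset.sum_eq_zero fun a _ => ?_
  rw [Finset.sum_comm]
  refine Finset.sum_eq_zero fun b _ => ?_
  simp only [mul_assoc _ _ (w _)]
  rw [← Finset.mul_sum]
  exact mul_eq_zero_of_right _ (h0 b)

/-- `symCompress` is k ↦ PkP with P = (wᵀw)I − wwᵀ, and P acts as the scalar wᵀw on matrices that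
annihilate `w`. Hence compressions of constant matrices span all of those when `w` is nonisotropic.
-/
theorem symCompress_of_mulVec_eq_zero {w : Fin n → ℂ} {k : Sym2 (Fin n) → ℂ}
    (hk : (symMatrix k).mulVec w = 0) : symCompress w k = dotProduct w w ^ 2 • k := by
  have hk' : ∀ a, ∑ b, k s(a, b) * w b = 0 := fun a => congrFun hk a
  funext q
  induction q using Sym2.ind with
  | _ i j =>
    have h1 : ∀ a, ∑ b, ((if i = a then dotProduct w w else 0) - w i * w a) * k s(a, b) *
        ((if j = b then dotProduct w w else 0) - w j * w b) =
        ((if i = a then dotProduct w w else 0) - w i * w a) * (k s(a, j) * dotProduct w w) := by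
      intro a
      simp only [mul_assoc, ← Finset.mul_sum]
      congr 1
      simp only [mul_sub, Finset.sum_sub_distrib, mul_ite, mul_zero, Finset.sum_ite_eq,
        Finset.mem_univ, if_true]
      rw [sub_eq_self, ← mul_zero (w j), ← hk' a, Finset.mul_sum]
      exact Finset.sum_congr rfl fun b _ => by ring
    simp only [symCompress, Sym2.lift_mk, h1]
    simp only [sub_mul, Finset.sum_sub_distrib, ite_mul, zero_mul, Finset.sum_ite_eq,
      Finset.mem_univ, if_true]
    have h2 : ∑ a, w i * w a * (k s(a, j) * dotProduct w w) = 0 := by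
      have : ∀ a, w i * w a * (k s(a, j) * dotProduct w w) =
          w i * dotProduct w w * (k s(j, a) * w a) := fun a => by
        rw [Sym2.eq_swap]; ring
      simp only [this, ← Finset.mul_sum, hk', mul_zero]
    rw [h2, sub_zero, Pi.smul_apply, smul_eq_mul]
    ring

theorem symMulVec_surjective {w : Fin n → ℂ} (hw : dotProduct w w ≠ 0) :
    Function.Surjective (symMulVec w) := by
  intro z
  refine ⟨(dotProduct w w ^ 2)⁻¹ • symExtend w z, ?_⟩
  rw [map_smul]
  change _ • (symMatrix (symExtend w z)).mulVec w = z
  rw [symMatrix_symExtend_mulVec, smul_smul, inv_mul_cancel₀ (pow_ne_zero 2 hw), one_smul]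

theorem finrank_comap_add {E F : Type} [AddCommGroup E] [Module ℂ E] [AddCommGroup F] [Module ℂ F]
    [FiniteDimensional ℂ E] [FiniteDimensional ℂ F] {f : E →ₗ[ℂ] F} (hf : Function.Surjective f)
    (S : Submodule ℂ F) :
    Module.finrank ℂ (S.comap f) + Module.finrank ℂ F =
      Module.finrank ℂ E + Module.finrank ℂ S := by
  have h1 := LinearMap.finrank_range_add_finrank_ker (S.mkQ.comp f)
  have h2 := S.finrank_quotient_add_finrank
  have h3 : Function.Surjective (S.mkQ.comp f) := S.mkQ_surjective.comp hf
  rw [LinearMap.range_eq_top.2 h3, finrank_top, LinearMap.ker_comp,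
    Submodule.ker_mkQ] at h1
  omega

/-- Normal vectors are orthogonal to `w`, which is not orthogonal to itself, so the normal space and
the line of `w` are independent. The rank of the preimage follows from surjectivity of H ↦ Hw. -/
theorem finrank_critSpace {V : Set (PSpace n)} {w : Fin n → ℂ} {y : PSpace n} (hy : y ∈ V)
    (hw : HomCoords.Rep w y) (hw0 : dotProduct w w ≠ 0) :
    Module.finrank ℂ (critSpace V w) + n =
      (n + 1).choose 2 + Module.finrank ℂ (jacSpan V w) + 1 := by
  have h1 := finrank_comap_add (symMulVec_surjective hw0) (jacSpan V w ⊔ Submodule.span ℂ {w})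
  have h2 := Submodule.finrank_sup_add_finrank_inf_eq (jacSpan V w) (Submodule.span ℂ {w})
  have h3 : jacSpan V w ⊓ Submodule.span ℂ {w} = ⊥ := by
    rw [eq_bot_iff]
    rintro x ⟨hx, hx'⟩
    obtain ⟨c, rfl⟩ := Submodule.mem_span_singleton.1 hx'
    have := dotProduct_eq_zero_of_mem_jacSpan hy hw hx
    rw [smul_dotProduct, smul_eq_mul, mul_eq_zero, or_iff_left hw0] at this
    rw [this, zero_smul]
    exact zero_mem _
  have hw1 : w ≠ 0 := proj_rep_ne_zero hw
  rw [h3, finrank_bot, finrank_span_singleton hw1] at h2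
  rw [Module.finrank_fin_fun, Module.finrank_fintype_fun_eq_card, Sym2.card, Fintype.card_fin]
    at h1
  change Module.finrank ℂ (critSpace V w) + n = _ at h1
  omega

/-- A tuple of polynomials whose values on the cone over `V` are matrices in the system. -/
def IsSection (V : Set (PSpace n)) (F : Sym2 (Fin n) → MvPolynomial (Fin n) ℂ) : Prop :=
  ∀ y ∈ V, ∀ w, HomCoords.Rep w y → evalTuple F w ∈ critSpace V w

theorem evalTuple_symExtend (z : Fin n → MvPolynomial (Fin n) ℂ) (w : Fin n → ℂ) :
    evalTuple (symExtend X z) w = symExtend w (evalTuple z w) := by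
  funext q
  induction q using Sym2.ind with
  | _ i j => simp [evalTuple, symExtend, dotProduct]

theorem evalTuple_symCompress (k : Sym2 (Fin n) → ℂ) (w : Fin n → ℂ) :
    evalTuple (symCompress X fun q => C (k q)) w = symCompress w k := by
  funext q
  induction q using Sym2.ind with
  | _ i j => simp [evalTuple, symCompress, dotProduct, apply_ite (eval w)]

theorem evalTuple_symOne (w : Fin n → ℂ) :
    evalTuple (symOne : Sym2 (Fin n) → MvPolynomial (Fin n) ℂ) w = symOne := by
  funext q
  induction q using Sym2.ind with
  | _ i j => simp [evalTuple, symOne, apply_ite (eval w)]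

theorem isHomogeneous_dotProduct {u z : Fin n → MvPolynomial (Fin n) ℂ} {a b : ℕ}
    (hu : ∀ j, (u j).IsHomogeneous a) (hz : ∀ j, (z j).IsHomogeneous b) :
    (dotProduct u z).IsHomogeneous (a + b) :=
  IsHomogeneous.sum _ _ _ fun j _ => (hu j).mul (hz j)

theorem isHomogeneous_symExtend {z : Fin n → MvPolynomial (Fin n) ℂ} {e : ℕ}
    (hz : ∀ j, (z j).IsHomogeneous e) (q : Sym2 (Fin n)) :
    (symExtend X z q).IsHomogeneous (e + 3) := by
  induction q using Sym2.ind with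
  | _ i j =>
    have hX : ∀ j : Fin n, (X j : MvPolynomial (Fin n) ℂ).IsHomogeneous 1 :=
      fun j => isHomogeneous_X ℂ j
    have h1 := (isHomogeneous_dotProduct hX hX).mul
      (((hz i).mul (hX j)).add ((hz j).mul (hX i)))
    have h2 := (isHomogeneous_dotProduct hX hz).mul ((hX i).mul (hX j))
    rw [show 1 + 1 + (e + 1) = e + 3 by ring] at h1
    rw [show 1 + e + (1 + 1) = e + 3 by ring] at h2
    exact h1.sub h2

theorem isHomogeneous_symCompress (k : Sym2 (Fin n) → ℂ) (q : Sym2 (Fin n)) :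
    (symCompress (X : Fin n → MvPolynomial (Fin n) ℂ) (fun q => C (k q)) q).IsHomogeneous 4 := by
  induction q using Sym2.ind with
  | _ i j =>
    have hX : ∀ j : Fin n, (X j : MvPolynomial (Fin n) ℂ).IsHomogeneous 1 :=
      fun j => isHomogeneous_X ℂ j
    have hP : ∀ i a : Fin n,
        ((if i = a then dotProduct (X : Fin n → MvPolynomial (Fin n) ℂ) X else 0) -
        X i * X a).IsHomogeneous 2 := by
      intro i a
      refine IsHomogeneous.sub ?_ ((hX i).mul (hX a))
      split_ifs
      · exact isHomogeneous_dotProduct hX hX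
      · exact isHomogeneous_zero _ _ _
    simp only [symCompress, Sym2.lift_mk]
    refine IsHomogeneous.sum _ _ _ fun a _ => ?_
    refine IsHomogeneous.sum _ _ _ fun b _ => ?_
    exact ((hP i a).mul (isHomogeneous_C _ (k s(a, b)))).mul (hP j b)

theorem isHomogeneous_symOne (q : Sym2 (Fin n)) :
    (symOne q : MvPolynomial (Fin n) ℂ).IsHomogeneous 0 := by
  induction q using Sym2.ind with
  | _ i j =>
    simp only [symOne, Sym2.lift_mk]
    split_ifs
    · exact isHomogeneous_one _ _
    · exact isHomogeneous_zero _ _ _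

theorem homogeneousComponent_mem_vanIdeal {V : Set (PSpace n)} {f : MvPolynomial (Fin n) ℂ}
    (hf : f ∈ vanIdeal V) (i : ℕ) : homogeneousComponent i f ∈ vanIdeal V := fun y hy _ hw =>
  homogeneousComponent_eval_eq_zero (fun _ hc => hf y hy _ (proj_rep_smul hw hc)) i

/-- The tuples of forms of one degree that are sections. -/
def IsHomogeneousSection (V : Set (PSpace n)) (F : Sym2 (Fin n) → MvPolynomial (Fin n) ℂ) : Prop :=
  IsSection V F ∧ ∃ e, ∀ q, (F q).IsHomogeneous e

theorem isSection_symExtend {V : Set (PSpace n)} {f : MvPolynomial (Fin n) ℂ}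
    (hf : f ∈ vanIdeal V) : IsSection V (symExtend X fun j => pderiv j f) := by
  intro y hy w hw
  rw [evalTuple_symExtend, mem_critSpace]
  refine ⟨dotProduct w w ^ 2 • grad f w,
    Submodule.smul_mem _ _ (mem_jacSpan.2 ⟨f, hf, rfl⟩), 0, ?_⟩
  rw [zero_smul, add_zero, symMatrix_symExtend_mulVec]
  rfl

/-- A matrix with Hw = ∇f(w) + αw is the sum of a multiple of `symExtend w (∇f(w))`, of `α` times
the identity and of a matrix annihilating `w`. Each of the three comes from homogeneous sections. -/
theorem critSpace_le_span {V : Set (PSpace n)} {w : Fin n → ℂ} (hw0 : dotProduct w w ≠ 0) :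
    critSpace V w ≤
      Submodule.span ℂ {h | ∃ F, IsHomogeneousSection V F ∧ h = evalTuple F w} := by
  set S := Submodule.span ℂ {h | ∃ F, IsHomogeneousSection V F ∧ h = evalTuple F w} with hS
  intro h hh
  obtain ⟨z, hz, α, hα⟩ := mem_critSpace.1 hh
  obtain ⟨f, hf, rfl⟩ := mem_jacSpan.1 hz
  -- A homogeneous section needs a form of one degree, so `f` is split into components. The degree
  -- `i - 1 + 3` below is harmless at `i = 0`, where the gradient is zero.
  have hlin : symExtend w (grad f w) = ∑ i ∈ Finset.range (f.totalDegree + 1),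
      symExtend w (grad (homogeneousComponent i f) w) := by
    have hg : ∀ j, grad f w j = ∑ i ∈ Finset.range (f.totalDegree + 1),
        grad (homogeneousComponent i f) w j := by
      intro j
      conv_lhs => rw [← sum_homogeneousComponent f]
      simp [grad]
    funext q
    rw [Finset.sum_apply]
    induction q using Sym2.ind with
    | _ i j =>
      simp only [symExtend, Sym2.lift_mk, Finset.sum_sub_distrib, ← Finset.mul_sum,
        ← Finset.sum_mul, Finset.sum_add_distrib, ← hg]
      congr 2
      simp only [dotProduct, hg, Finset.mul_sum]
      exact Finset.sum_comm
  have h1 : symExtend w (grad f w) ∈ S := by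
    rw [hlin]
    refine Submodule.sum_mem _ fun i _ => Submodule.subset_span
      ⟨_, ⟨isSection_symExtend (homogeneousComponent_mem_vanIdeal hf i), i - 1 + 3, fun q => ?_⟩, ?_⟩
    · exact isHomogeneous_symExtend
        (fun j => (homogeneousComponent_isHomogeneous i f).pderiv) q
    · rw [evalTuple_symExtend]; rfl
  have h2 : ∀ k : Sym2 (Fin n) → ℂ, symCompress w k ∈ S := by
    intro k
    refine Submodule.subset_span
      ⟨symCompress X fun q => C (k q), ⟨?_, 4, isHomogeneous_symCompress k⟩, ?_⟩
    · intro y hy v hv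
      rw [evalTuple_symCompress, mem_critSpace]
      refine ⟨0, zero_mem _, 0, ?_⟩
      rw [symMatrix_symCompress_mulVec]
      simp
    · rw [evalTuple_symCompress]
  have h3 : (symOne : Sym2 (Fin n) → ℂ) ∈ S := by
    refine Submodule.subset_span ⟨symOne, ⟨?_, 0, isHomogeneous_symOne⟩, ?_⟩
    · intro y hy v hv
      rw [evalTuple_symOne, mem_critSpace]
      refine ⟨0, zero_mem _, 1, ?_⟩
      rw [symMatrix_symOne]
      simp
    · rw [evalTuple_symOne]
  have hc0 : dotProduct w w ^ 2 ≠ 0 := pow_ne_zero 2 hw0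
  have hk : symMulVec w (h - (dotProduct w w ^ 2)⁻¹ • symExtend w (grad f w) - α • symOne) = 0 := by
    rw [map_sub, map_sub, map_smul, map_smul]
    change (symMatrix h).mulVec w - _ • (symMatrix (symExtend w (grad f w))).mulVec w -
      α • (symMatrix symOne).mulVec w = 0
    rw [symMatrix_symExtend_mulVec, symMatrix_symOne, hα, smul_smul, inv_mul_cancel₀ hc0, one_smul,
      Matrix.one_mulVec]
    abel
  have h4 := h2 (h - (dotProduct w w ^ 2)⁻¹ • symExtend w (grad f w) - α • symOne)
  rw [symCompress_of_mulVec_eq_zero hk] at h4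
  have h5 := Submodule.smul_mem _ (dotProduct w w ^ 2)⁻¹ h4
  rw [smul_smul, inv_mul_cancel₀ hc0, one_smul] at h5
  have h6 := add_mem (add_mem h5 (Submodule.smul_mem _ (dotProduct w w ^ 2)⁻¹ h1))
    (Submodule.smul_mem _ α h3)
  convert h6 using 1
  abel

/-- Sums of homogeneous sections of different degrees lose homogeneity, but extending a given matrix
along the cone is all that the closure argument needs. -/
theorem exists_section {V : Set (PSpace n)} {w : Fin n → ℂ} (hw0 : dotProduct w w ≠ 0)
    {h : Sym2 (Fin n) → ℂ} (hh : h ∈ critSpace V w) :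
    ∃ F, IsSection V F ∧ evalTuple F w = h := by
  have := critSpace_le_span hw0 hh
  clear hh
  induction this using Submodule.span_induction with
  | mem x hx =>
    obtain ⟨F, hF, rfl⟩ := hx
    exact ⟨F, hF.1, rfl⟩
  | zero =>
    have h0 : ∀ v, evalTuple (0 : Sym2 (Fin n) → MvPolynomial (Fin n) ℂ) v = 0 := fun v => by
      funext q; simp [evalTuple]
    exact ⟨0, fun y _ v _ => (h0 v).symm ▸ zero_mem _, h0 w⟩
  | add x y hx' hy' hx hy =>
    obtain ⟨F, hF, rfl⟩ := hx
    obtain ⟨G, hG, rfl⟩ := hy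
    have h0 : ∀ v, evalTuple (F + G) v = evalTuple F v + evalTuple G v := fun v => by
      funext q; simp [evalTuple]
    exact ⟨F + G, fun y hy v hv => (h0 v).symm ▸ add_mem (hF y hy v hv) (hG y hy v hv), h0 w⟩
  | smul c x hx' hx =>
    obtain ⟨F, hF, rfl⟩ := hx
    have h0 : ∀ v, evalTuple (fun q => C c * F q) v = c • evalTuple F v := fun v => by
      funext q; simp [evalTuple]
    exact ⟨_, fun y hy v hv => (h0 v).symm ▸ Submodule.smul_mem _ _ (hF y hy v hv), h0 w⟩

/-- A basis of the system at a point, consisting of values of homogeneous sections. -/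
theorem exists_frame {V : Set (PSpace n)} {w : Fin n → ℂ} {y : PSpace n} (hy : y ∈ V)
    (hw : HomCoords.Rep w y) (hw0 : dotProduct w w ≠ 0) {q : ℕ}
    (hq : Module.finrank ℂ (critSpace V w) = q) :
    ∃ F : Fin q → Sym2 (Fin n) → MvPolynomial (Fin n) ℂ, (∀ l, IsHomogeneousSection V (F l)) ∧
      LinearIndependent ℂ fun l => evalTuple (F l) w := by
  have hspan : Submodule.span ℂ {h | ∃ F, IsHomogeneousSection V F ∧ h = evalTuple F w} =
      critSpace V w := by
    refine le_antisymm (Submodule.span_le.2 ?_) (critSpace_le_span hw0)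
    rintro _ ⟨F, hF, rfl⟩
    exact hF.1 y hy w hw
  obtain ⟨f, hf, -, hli⟩ := Submodule.exists_fun_fin_finrank_span_eq ℂ
    {h | ∃ F, IsHomogeneousSection V F ∧ h = evalTuple F w}
  have hq' : Module.finrank ℂ (Submodule.span ℂ
      {h | ∃ F, IsHomogeneousSection V F ∧ h = evalTuple F w}) = q := by rw [hspan]; exact hq
  choose F hF hFw using hf
  refine ⟨fun l => F (Fin.cast hq'.symm l), fun l => hF _, ?_⟩
  have h : (fun l => evalTuple (F (Fin.cast hq'.symm l)) w) = f ∘ Fin.cast hq'.symm :=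
    funext fun l => (hFw _).symm
  rw [h]
  exact hli.comp _ (Fin.cast_injective hq'.symm)

end

/-! ## Affine charts of `ℂ^a × ∏ᵢ ℙ^{dᵢ}` -/

section
variable {k a : ℕ} {d : Fin k → ℕ}

/-- The character of the torus given by a multidegree. -/
def torusCharacter (l : Fin k → ℂ) : Multiplicative (Fin k → ℕ) →* ℂ where
  toFun D := ∏ i, l i ^ (Multiplicative.toAdd D) i
  map_one' := by simp
  map_mul' D D' := by simp [pow_add, Finset.prod_mul_distrib]

theorem eval_scale_of_isWeightedHomogeneous {f : MvPolynomial (Coord a d) ℂ} {D : Fin k → ℕ}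
    (hf : IsWeightedHomogeneous (weight a d) f D) (l : Fin k → ℂ) (v : Coord a d → ℂ) :
    eval (scale (MultiProj.blk (ParamSpace a d)) l v) f = (∏ i, l i ^ D i) * eval v f := by
  rw [show (∏ i, l i ^ D i) = torusCharacter l (Multiplicative.ofAdd D) from rfl,
    ← eval_character_smul hf]
  congr 2
  funext s
  rcases s with s | ⟨i, j⟩
  · simp [scale, MultiProj.blk, weight, torusCharacter]
  · have : ∏ i', l i' ^ (Pi.single i 1 : Fin k → ℕ) i' = l i := by
      rw [Finset.prod_eq_single i]
      · simp
      · intro b _ hb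
        simp [hb]
      · simp
    simp [scale, MultiProj.blk, weight, torusCharacter, this]

theorem IsMultihomogeneous.exists_scale {ι : Type} {F : ι → MvPolynomial (Coord a d) ℂ}
    (hF : IsMultihomogeneous F) (l : Fin k → ℂ) (hl : ∀ i, l i ≠ 0) :
    ∃ c : ℂ, c ≠ 0 ∧ ∀ v, evalTuple F (scale (MultiProj.blk (ParamSpace a d)) l v) =
      c • evalTuple F v := by
  obtain ⟨D, hD⟩ := hF
  exact ⟨∏ i, l i ^ D i, Finset.prod_ne_zero_iff.2 fun i _ => pow_ne_zero _ (hl i),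
    fun v => funext fun j => eval_scale_of_isWeightedHomogeneous (hD j) l v⟩

theorem IsMultihomogeneous.exists_rep {ι : Type} {F : ι → MvPolynomial (Coord a d) ℂ}
    (hF : IsMultihomogeneous F) {x : ParamSpace a d} {v w : Coord a d → ℂ}
    (hv : HomCoords.Rep v x) (hw : HomCoords.Rep w x) :
    ∃ c : ℂ, c ≠ 0 ∧ evalTuple F w = c • evalTuple F v := by
  obtain ⟨l, hl, rfl⟩ := MultiProj.rep_eq_scale hv hw
  obtain ⟨c, hc, h⟩ := hF.exists_scale l hl
  exact ⟨c, hc, h v⟩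

/-- The index set of the coordinates on an affine chart of `ℂ^a × ∏ᵢ ℙ^{dᵢ}`. -/
abbrev ChartCoord (a : ℕ) (d : Fin k → ℕ) : Type := Fin a ⊕ (Σ i : Fin k, Fin (d i))

theorem card_chartCoord : Fintype.card (ChartCoord a d) = a + ∑ i, d i := by
  simp [ChartCoord, Fintype.card_sum, Fintype.card_sigma]

variable (κ : ∀ i : Fin k, Fin (d i + 1))

/-- The affine chart in which the coordinates `κ i` are `1`. -/
def chart (s : Coord a d) : MvPolynomial (ChartCoord a d) ℂ :=
  s.elim (fun s => X (Sum.inl s)) fun t =>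
    (κ t.1).insertNth (α := fun _ => MvPolynomial (ChartCoord a d) ℂ) 1
      (fun j => X (Sum.inr ⟨t.1, j⟩)) t.2

/-- The numerators of the chart coordinates. -/
def chartNum (s : ChartCoord a d) : Coord a d :=
  s.elim Sum.inl fun t => Sum.inr ⟨t.1, (κ t.1).succAbove t.2⟩

/-- The denominators of the chart coordinates. -/
def chartDen (s : ChartCoord a d) : MvPolynomial (Coord a d) ℂ :=
  s.elim (fun _ => 1) fun t => X (Sum.inr ⟨t.1, κ t.1⟩)

theorem chart_pivot (i : Fin k) : chart (a := a) κ (Sum.inr ⟨i, κ i⟩) = 1 := by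
  simp [chart]

theorem exists_rep_chart (t : ChartCoord a d → ℂ) :
    ∃ x : ParamSpace a d, HomCoords.Rep (evalTuple (chart κ) t) x := by
  have h : ∀ i, ∃ y : ℙ ℂ (Fin (d i + 1) → ℂ),
      HomCoords.Rep (fun j => evalTuple (chart (a := a) κ) t (Sum.inr ⟨i, j⟩)) y := fun i =>
    proj_exists_point fun h => by
      have := congrFun h (κ i)
      simp [evalTuple, chart_pivot] at this
  choose y hy using h
  exact ⟨⟨fun s => evalTuple (chart κ) t (Sum.inl s), y⟩, fun s => rfl, hy⟩

/-- The chart coordinates of a coordinate vector. -/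
def chartCoords (v : Coord a d → ℂ) (s : ChartCoord a d) : ℂ :=
  v (chartNum κ s) / eval v (chartDen κ s)

theorem eq_scale_chart {v : Coord a d → ℂ} (hv : ∀ i, v (Sum.inr ⟨i, κ i⟩) ≠ 0) :
    v = scale (MultiProj.blk (ParamSpace a d)) (fun i => v (Sum.inr ⟨i, κ i⟩))
      (evalTuple (chart κ) (chartCoords κ v)) := by
  funext s
  rcases s with s | ⟨i, j⟩
  · simp [scale, MultiProj.blk, evalTuple, chart, chartCoords, chartNum, chartDen]
  · rcases Fin.eq_self_or_eq_succAbove (κ i) j with rfl | ⟨j, rfl⟩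
    · simp [scale, MultiProj.blk, evalTuple, chart]
    · have := hv i
      simp only [scale, MultiProj.blk, evalTuple, chart, chartCoords, chartNum, chartDen,
        Sum.elim_inr, Option.elim_some, Fin.insertNth_apply_succAbove, eval_X]
      field_simp

theorem scale_chart_pivot (l : Fin k → ℂ) (t : ChartCoord a d → ℂ) (i : Fin k) :
    scale (MultiProj.blk (ParamSpace a d)) l (evalTuple (chart κ) t) (Sum.inr ⟨i, κ i⟩) = l i := by
  simp [scale, MultiProj.blk, evalTuple, chart_pivot]

theorem scale_chart_chartNum {l : Fin k → ℂ} (hl : ∀ i, l i ≠ 0) (t : ChartCoord a d → ℂ)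
    (s : ChartCoord a d) :
    eval (scale (MultiProj.blk (ParamSpace a d)) l (evalTuple (chart κ) t)) (chartDen κ s) ≠ 0 ∧
    scale (MultiProj.blk (ParamSpace a d)) l (evalTuple (chart κ) t) (chartNum κ s) =
      t s * eval (scale (MultiProj.blk (ParamSpace a d)) l (evalTuple (chart κ) t))
        (chartDen κ s) := by
  rcases s with s | ⟨i, j⟩
  · simp [scale, MultiProj.blk, evalTuple, chart, chartNum, chartDen]
  · simp only [chartDen, Sum.elim_inr, eval_X, scale_chart_pivot]
    refine ⟨hl i, ?_⟩
    simp [scale, MultiProj.blk, evalTuple, chart, chartNum, mul_comm]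

theorem chart_rep {t : ChartCoord a d → ℂ} {x : ParamSpace a d} {w : Coord a d → ℂ}
    (ht : HomCoords.Rep (evalTuple (chart κ) t) x) (hw : HomCoords.Rep w x) (s : ChartCoord a d) :
    eval w (chartDen κ s) ≠ 0 ∧ w (chartNum κ s) = t s * eval w (chartDen κ s) := by
  obtain ⟨l, hl, rfl⟩ := MultiProj.rep_eq_scale ht hw
  exact scale_chart_chartNum κ hl t s

/-- The homogeneous form of a principal open subset of the chart. -/
theorem exists_chart_locus (g : MvPolynomial (ChartCoord a d) ℂ) :
    ∃ Γ : MvPolynomial (Coord a d) ℂ, ∀ v, eval v Γ ≠ 0 ↔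
      ∃ (l : Fin k → ℂ) (t : ChartCoord a d → ℂ), (∀ i, l i ≠ 0) ∧ eval t g ≠ 0 ∧
        v = scale (MultiProj.blk (ParamSpace a d)) l (evalTuple (chart κ) t) := by
  obtain ⟨Θ, N, h⟩ := exists_clear_denominators
    (fun s => (X (chartNum κ s) : MvPolynomial (Coord a d) ℂ)) (chartDen κ) g
  -- The product of the pivots expresses membership in the chart; `Θ` is `g` in the chart
  -- coordinates with denominators cleared.
  refine ⟨(∏ i, X (Sum.inr ⟨i, κ i⟩)) * Θ, fun v => ?_⟩
  have key : ∀ (l : Fin k → ℂ) (t : ChartCoord a d → ℂ), (∀ i, l i ≠ 0) →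
      v = scale (MultiProj.blk (ParamSpace a d)) l (evalTuple (chart κ) t) →
      (eval v Θ ≠ 0 ↔ eval t g ≠ 0) := by
    rintro l t hl rfl
    have h1 := h ℂ (aeval (scale (MultiProj.blk (ParamSpace a d)) l (evalTuple (chart κ) t))) t
      fun s => by
        rw [aeval_X]
        exact (scale_chart_chartNum κ hl t s).2
    simp only [aeval_eq_eval] at h1
    rw [h1, mul_ne_zero_iff]
    exact and_iff_right (pow_ne_zero _ (Finset.prod_ne_zero_iff.2
      fun s _ => (scale_chart_chartNum κ hl t s).1))
  rw [map_mul, map_prod, mul_ne_zero_iff, Finset.prod_ne_zero_iff]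
  simp only [Finset.mem_univ, true_implies, eval_X]
  constructor
  · rintro ⟨h1, h2⟩
    have h3 := eq_scale_chart κ h1
    exact ⟨_, _, h1, (key _ _ h1 h3).1 h2, h3⟩
  · rintro ⟨l, t, hl, ht, rfl⟩
    refine ⟨fun i => by rw [scale_chart_pivot]; exact hl i, (key _ _ hl rfl).2 ht⟩

/-- In suitable affine charts, the birational map is given by polynomials, and the inverse map by
quotients of forms of equal degree. -/
theorem IsBirational.exists_chart {n : ℕ} {ψ : Fin n → MvPolynomial (Coord a d) ℂ}
    (hψ : IsMultihomogeneous ψ) (hbir : IsBirational ψ) :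
    ∃ (κ : ∀ i : Fin k, Fin (d i + 1)) (g : MvPolynomial (ChartCoord a d) ℂ)
      (num den : ChartCoord a d → MvPolynomial (Fin n) ℂ) (deg : ChartCoord a d → ℕ),
      g ≠ 0 ∧ (∀ s, (num s).IsHomogeneous (deg s)) ∧ (∀ s, (den s).IsHomogeneous (deg s)) ∧
      ∀ t, eval t g ≠ 0 → evalTuple ψ (evalTuple (chart κ) t) ≠ 0 ∧
        ∀ s, eval (evalTuple ψ (evalTuple (chart κ) t)) (den s) ≠ 0 ∧
          eval (evalTuple ψ (evalTuple (chart κ) t)) (num s) =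
            t s * eval (evalTuple ψ (evalTuple (chart κ) t)) (den s) := by
  obtain ⟨p, q, e, E, hq, hp, hP, W, hW, ⟨x₀, hx₀⟩, hinv⟩ := hbir
  obtain ⟨v₀, hv₀⟩ := MultiProj.rep_exists x₀
  have hκ : ∀ i, ∃ j, v₀ (Sum.inr ⟨i, j⟩) ≠ 0 := fun i => by
    by_contra! h
    exact proj_rep_ne_zero (hv₀.2 i) (funext h)
  choose κ hκ using hκ
  have h1 := eq_scale_chart κ hκ
  obtain ⟨x₁, hx₁⟩ := exists_rep_chart κ (chartCoords κ v₀)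
  have h2 := MultiProj.rep_scale hx₁ hκ
  rw [← h1] at h2
  obtain rfl : x₀ = x₁ := MultiProj.rep_inj hv₀ h2
  let _ := zariski (ParamSpace a d)
  obtain ⟨S, hS⟩ := isClosed_zariski_iff.1 (IsOpen.isClosed_compl hW)
  have h3 : ¬ ∀ f ∈ S, eval (evalTuple (chart κ) (chartCoords κ v₀)) f = 0 := fun h =>
    (hS _ _ hx₁).2 h hx₀
  -- One equation `f` of the complement of `W` is nonzero at the normalized coordinates of `x₀`; its
  -- pullback to the chart is the desired `g`.
  push Not at h3
  obtain ⟨f, hfS, hf⟩ := h3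
  -- A chart coordinate on a projective factor is the quotient of two components of the inverse,
  -- both of degree `E i`, so numerator and denominator always have equal degree.
  refine ⟨κ, aeval (chart κ) f, fun s => p (chartNum κ s),
    fun s => s.elim (fun _ => q) fun t => p (Sum.inr ⟨t.1, κ t.1⟩),
    fun s => s.elim (fun _ => e) fun t => E t.1, ?_, ?_, ?_, ?_⟩
  · intro h
    rw [← eval_aeval_tuple, h, map_zero] at hf
    exact hf rfl
  · rintro (s | ⟨i, j⟩)
    · exact hp s
    · exact hP i _
  · rintro (s | ⟨i, j⟩)
    · exact hq
    · exact hP i _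
  · intro t ht
    rw [eval_aeval_tuple] at ht
    obtain ⟨x, hx⟩ := exists_rep_chart κ t
    have hxW : x ∈ W := by
      by_contra h
      exact ht ((hS _ _ hx).1 h f hfS)
    obtain ⟨v, hv, hv1, hv2, hv3⟩ := hinv x hxW
    obtain ⟨c, hc, hcv⟩ := hψ.exists_rep hv hx
    rw [hcv]
    refine ⟨smul_ne_zero hc hv1, ?_⟩
    rintro (s | ⟨i, j⟩)
    · have h4 := (hv3.1 s).trans (hx.1 s).symm
      simp only [Sum.elim_inl, chartNum]
      rw [eval_smul_of_isHomogeneous hq, eval_smul_of_isHomogeneous (hp s)]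
      refine ⟨mul_ne_zero (pow_ne_zero _ hc) hv2, ?_⟩
      simp only [Sum.elim_inl, evalTuple, chart, eval_X] at h4
      rw [div_eq_iff hv2] at h4
      rw [show eval (evalTuple ψ v) (p (Sum.inl s)) = _ from h4]
      ring
    · obtain ⟨h4, h5⟩ := chart_rep κ hx hv3 (Sum.inr ⟨i, j⟩)
      simp only [chartDen, chartNum, Sum.elim_inr, eval_X] at h4 h5
      simp only [Sum.elim_inr, chartNum]
      rw [eval_smul_of_isHomogeneous (hP i _), eval_smul_of_isHomogeneous (hP i _)]
      refine ⟨mul_ne_zero (pow_ne_zero _ hc) h4, ?_⟩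
      rw [h5]
      ring

end

/-! ## Varieties with a polynomial parametrization that has a rational inverse -/

section
variable {σ : Type} [Fintype σ]

/-- Evaluation of polynomials at a point with a tangent vector. -/
def dualEval (w u : σ → ℂ) : MvPolynomial σ ℂ →ₐ[ℂ] DualNumber ℂ :=
  aeval fun s => TrivSqZeroExt.inl (w s) + TrivSqZeroExt.inr (u s)

theorem dualEval_eq (w u : σ → ℂ) (f : MvPolynomial σ ℂ) : dualEval w u f =
    TrivSqZeroExt.inl (eval w f) + TrivSqZeroExt.inr (polyDeriv f w u) := by
  induction f using MvPolynomial.induction_on with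
  | C c =>
    rw [dualEval, ← algebraMap_eq, AlgHom.commutes]
    simp [polyDeriv_apply, TrivSqZeroExt.algebraMap_eq_inl]
  | add p q hp hq =>
    rw [map_add, hp, hq]
    ext <;> simp [polyDeriv_apply, add_mul, Finset.sum_add_distrib]
  | mul_X p s hp =>
    rw [map_mul, hp]
    classical
    have h : polyDeriv (p * X s) w u = polyDeriv p w u * w s + eval w p * u s := by
      simp only [polyDeriv_apply, pderiv_mul, pderiv_X, map_add, map_mul, eval_X, add_mul,
        Finset.sum_add_distrib, Finset.sum_mul]
      congr 1
      · exact Finset.sum_congr rfl fun i _ => by ring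
      · rw [Finset.sum_eq_single s]
        · simp
        · intro b _ hb
          simp [hb.symm]
        · simp
    rw [h]
    ext <;> simp [dualEval]
    ring

theorem polyDeriv_self_of_isHomogeneous {f : MvPolynomial σ ℂ} {e : ℕ} (hf : f.IsHomogeneous e)
    (w : σ → ℂ) : polyDeriv f w w = e * eval w f := by
  have := congrArg (eval w) hf.sum_X_mul_pderiv
  simp only [map_sum, map_mul, eval_X, nsmul_eq_mul, map_natCast] at this
  rw [polyDeriv_apply, ← this]
  exact Finset.sum_congr rfl fun i _ => mul_comm _ _

end

/-- A polynomial parametrization of a projective variety by affine space, with an inverse on a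
principal open set whose coordinates are quotients of forms of equal degree. -/
structure InvertibleParam {n : ℕ} {α : Type} (Ψ : Fin n → MvPolynomial α ℂ) where
  g : MvPolynomial α ℂ
  num : α → MvPolynomial (Fin n) ℂ
  den : α → MvPolynomial (Fin n) ℂ
  deg : α → ℕ
  g_ne_zero : g ≠ 0
  num_hom : ∀ s, (num s).IsHomogeneous (deg s)
  den_hom : ∀ s, (den s).IsHomogeneous (deg s)
  ne_zero : ∀ t, eval t g ≠ 0 → evalTuple Ψ t ≠ 0
  den_ne_zero : ∀ t, eval t g ≠ 0 → ∀ s, eval (evalTuple Ψ t) (den s) ≠ 0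
  num_eq : ∀ t, eval t g ≠ 0 → ∀ s,
    eval (evalTuple Ψ t) (num s) = t s * eval (evalTuple Ψ t) (den s)

namespace InvertibleParam
variable {n : ℕ} {α : Type} {Ψ : Fin n → MvPolynomial α ℂ} (P : InvertibleParam Ψ)

/-- The image of the principal open set. -/
def image : Set (PSpace n) := {y | ∃ t, eval t P.g ≠ 0 ∧ HomCoords.Rep (evalTuple Ψ t) y}

/-- The variety parametrized by `Ψ`. -/
def variety : Set (PSpace n) := zclosure P.image

theorem exists_rep {t : α → ℂ} (ht : eval t P.g ≠ 0) :
    ∃ y, y ∈ P.image ∧ HomCoords.Rep (evalTuple Ψ t) y := by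
  obtain ⟨y, hy⟩ := proj_exists_point (P.ne_zero t ht)
  exact ⟨y, ⟨t, ht, hy⟩, hy⟩

theorem mem_variety {t : α → ℂ} (ht : eval t P.g ≠ 0) {y : PSpace n}
    (hy : HomCoords.Rep (evalTuple Ψ t) y) : y ∈ P.variety :=
  subset_zclosure _ ⟨t, ht, hy⟩

theorem mem_vanIdeal_variety {f : MvPolynomial (Fin n) ℂ} : f ∈ vanIdeal P.variety ↔
    ∀ t, eval t P.g ≠ 0 → ∀ c : ℂ, c ≠ 0 → eval (c • evalTuple Ψ t) f = 0 := by
  rw [variety, vanIdeal_zclosure]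
  constructor
  · intro h t ht c hc
    obtain ⟨y, hy, hy'⟩ := P.exists_rep ht
    exact h y hy _ (proj_rep_smul hy' hc)
  · rintro h y ⟨t, ht, hy⟩ w hw
    obtain ⟨c, hc, rfl⟩ := proj_rep_eq_smul hy hw
    exact h t ht c hc

theorem inverse_rep {t : α → ℂ} (ht : eval t P.g ≠ 0) {y : PSpace n} {w : Fin n → ℂ}
    (hy : HomCoords.Rep (evalTuple Ψ t) y) (hw : HomCoords.Rep w y) (s : α) :
    eval w (P.den s) ≠ 0 ∧ eval w (P.num s) = t s * eval w (P.den s) := by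
  obtain ⟨c, hc, rfl⟩ := proj_rep_eq_smul hy hw
  rw [eval_smul_of_isHomogeneous (P.num_hom s), eval_smul_of_isHomogeneous (P.den_hom s),
    P.num_eq t ht s]
  exact ⟨mul_ne_zero (pow_ne_zero _ hc) (P.den_ne_zero t ht s), by ring⟩

/-- The inverse, known pointwise on an open set, is a polynomial identity and can therefore be
differentiated. -/
theorem aeval_num (s : α) : aeval Ψ (P.num s) = X s * aeval Ψ (P.den s) := by
  rw [← sub_eq_zero]
  refine eq_zero_of_eval_of_ne P.g_ne_zero fun t ht => ?_
  rw [map_sub, map_mul, eval_X, eval_aeval_tuple, eval_aeval_tuple, P.num_eq t ht s, sub_self]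

theorem aeval_eq_zero {f : MvPolynomial (Fin n) ℂ} (hf : f ∈ vanIdeal P.variety) :
    aeval Ψ f = 0 :=
  eq_zero_of_eval_of_ne P.g_ne_zero fun t ht => by
    have := P.mem_vanIdeal_variety.1 hf t ht 1 one_ne_zero
    rwa [one_smul, ← eval_aeval_tuple] at this

theorem vanIdeal_variety : vanIdeal P.variety =
    RingHom.ker (aeval (torusTuple (MultiProj.blk (PSpace n)) Ψ)) := by
  rw [variety, vanIdeal_zclosure]
  refine vanIdeal_eq_ker_torusTuple Ψ P.g_ne_zero (fun t ht => P.exists_rep ht) ?_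
  rintro y ⟨t, -, hy⟩
  exact ⟨t, hy⟩

/-- The parametrization restricted to a smaller principal open set. -/
def restrict {g' : MvPolynomial α ℂ} (hg' : g' ≠ 0) : InvertibleParam Ψ where
  g := P.g * g'
  num := P.num
  den := P.den
  deg := P.deg
  g_ne_zero := mul_ne_zero P.g_ne_zero hg'
  num_hom := P.num_hom
  den_hom := P.den_hom
  ne_zero t ht := P.ne_zero t (left_ne_zero_of_mul (map_mul (eval t) P.g g' ▸ ht))
  den_ne_zero t ht := P.den_ne_zero t (left_ne_zero_of_mul (map_mul (eval t) P.g g' ▸ ht))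
  num_eq t ht := P.num_eq t (left_ne_zero_of_mul (map_mul (eval t) P.g g' ▸ ht))

/-- The vanishing ideal is a kernel that depends only on `Ψ`, not on the open set. -/
theorem variety_restrict {g' : MvPolynomial α ℂ} (hg' : g' ≠ 0) :
    (P.restrict hg').variety = P.variety := by
  have h : vanIdeal (P.restrict hg').variety = vanIdeal P.variety := by
    rw [vanIdeal_variety, vanIdeal_variety]
  ext y
  rw [variety, variety, mem_zclosure, mem_zclosure]
  rw [variety, variety, vanIdeal_zclosure, vanIdeal_zclosure] at h
  rw [h]

variable [Fintype α]

theorem dep_vanIdeal : Dep (vanIdeal P.variety) (Fintype.card α + 1 + 1) := by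
  rw [P.vanIdeal_variety]
  have := dep_ker_aeval (torusTuple (MultiProj.blk (PSpace n)) Ψ)
  rwa [Fintype.card_sum, Fintype.card_unit] at this

theorem zdim_variety : zdim P.variety = (Fintype.card α : ℕ) := by
  apply le_antisymm
  · refine zdim_le ?_
    rw [Fintype.card_unit]
    exact P.dep_vanIdeal
  · refine le_zdim ?_ Ψ P.g_ne_zero
      (fun t ht => ?_) P.num P.den fun t x w ht hx hw s => P.inverse_rep ht hx hw s
    · exact zclosure_subset subset_rfl
    · obtain ⟨y, hy, hy'⟩ := P.exists_rep ht
      exact ⟨y, subset_zclosure _ hy, hy'⟩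

/-- The derivative of the parametrization. -/
def differential (Ψ : Fin n → MvPolynomial α ℂ) (t b : α → ℂ) : Fin n → ℂ :=
  fun j => polyDeriv (Ψ j) t b

/-- Differentiate num(Ψ) = t·den(Ψ) in the direction `b`. When the image direction is a multiple of
Ψ, Euler's formula applies, and the equal degrees of `num` and `den` cancel everything except `b s`
times the denominator. -/
theorem differential_injective {t : α → ℂ} (ht : eval t P.g ≠ 0) {b : α → ℂ} {c : ℂ}
    (h : differential Ψ t b = c • evalTuple Ψ t) : b = 0 ∧ c = 0 := by
  have hb : b = 0 := by
    funext s
    have h1 := congrArg (fun f => polyDeriv f t b) (P.aeval_num s)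
    have h2 : polyDeriv (X s * aeval Ψ (P.den s)) t b =
        b s * eval (evalTuple Ψ t) (P.den s) +
          t s * polyDeriv (aeval Ψ (P.den s)) t b := by
      have h3 := congrArg TrivSqZeroExt.snd (map_mul (dualEval t b) (X s) (aeval Ψ (P.den s)))
      simp only [dualEval_eq, TrivSqZeroExt.snd_add, TrivSqZeroExt.snd_inl, TrivSqZeroExt.snd_inr,
        TrivSqZeroExt.snd_mul, zero_add, TrivSqZeroExt.fst_add, TrivSqZeroExt.fst_inl,
        TrivSqZeroExt.fst_inr, add_zero, eval_X, eval_aeval_tuple, smul_eq_mul,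
        MulOpposite.smul_eq_mul_unop, MulOpposite.unop_op] at h3
      rw [h3]
      have : polyDeriv (X s) t b = b s := by
        classical
        rw [polyDeriv_apply, Finset.sum_eq_single s]
        · simp
        · intro i _ hi
          simp [pderiv_X, hi.symm]
        · simp
      rw [this]
      ring
    simp only [h2, polyDeriv_comp] at h1
    change polyDeriv (P.num s) _ (differential Ψ t b) =
      _ + _ * polyDeriv (P.den s) _ (differential Ψ t b) at h1
    rw [h, map_smul, map_smul, polyDeriv_self_of_isHomogeneous (P.num_hom s),
      polyDeriv_self_of_isHomogeneous (P.den_hom s), P.num_eq t ht s,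
      smul_eq_mul, smul_eq_mul] at h1
    have h4 : b s * eval (evalTuple Ψ t) (P.den s) = 0 := by linear_combination -h1
    exact (mul_eq_zero.1 h4).resolve_right (P.den_ne_zero t ht s)
  refine ⟨hb, ?_⟩
  subst hb
  have h0 : differential Ψ t 0 = 0 := by funext j; simp [differential]
  rw [h0] at h
  exact (smul_eq_zero.1 h.symm).resolve_right (P.ne_zero t ht)

theorem differential_mem_tangent (t b : α → ℂ) :
    differential Ψ t b ∈ tangent P.variety (evalTuple Ψ t) := by
  rw [mem_tangent]
  intro f hf
  have := polyDeriv_comp Ψ f t b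
  rw [P.aeval_eq_zero hf] at this
  change polyDeriv f _ (fun j => polyDeriv (Ψ j) t b) = 0
  rw [← this, polyDeriv_apply]
  simp

/-- The points of the variety are proportional to the values of `Ψ` at their parameters. -/
theorem exists_proportional (i j : Fin n) : ∃ Θ ∈ vanIdeal P.variety, ∃ N : ℕ,
    ∀ (S : Type) [CommRing S] [Algebra ℂ S] (φ : MvPolynomial (Fin n) ℂ →ₐ[ℂ] S)
      (z : α ⊕ Fin n → S),
      (∀ s, φ (Sum.elim P.num X s) = z s * φ (Sum.elim P.den 1 s)) →
        φ Θ = (∏ s : α ⊕ Fin n, φ (Sum.elim P.den 1 s)) ^ N *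
          aeval z (X (Sum.inr i) * rename Sum.inl (Ψ j) - X (Sum.inr j) * rename Sum.inl (Ψ i)) := by
  obtain ⟨Θ, N, hΘ⟩ := exists_clear_denominators
    (Sum.elim P.num X : α ⊕ Fin n → MvPolynomial (Fin n) ℂ) (Sum.elim P.den 1)
    (X (Sum.inr i) * rename Sum.inl (Ψ j) - X (Sum.inr j) * rename Sum.inl (Ψ i))
  refine ⟨Θ, ?_, N, hΘ⟩
  rw [mem_vanIdeal_variety]
  intro t' ht' c hc
  have h1 := hΘ ℂ (aeval (c • evalTuple Ψ t')) (Sum.elim t' (c • evalTuple Ψ t')) (by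
    rintro (s | s)
    · simp only [Sum.elim_inl, aeval_eq_eval]
      rw [eval_smul_of_isHomogeneous (P.num_hom s), eval_smul_of_isHomogeneous (P.den_hom s),
        P.num_eq t' ht' s]
      ring
    · simp)
  simp only [aeval_eq_eval] at h1
  rw [h1]
  simp only [map_sub, map_mul, eval_X, eval_rename, Sum.elim_inr, Sum.elim_comp_inl]
  simp only [Pi.smul_apply, evalTuple, smul_eq_mul]
  ring

/-- A tangent vector `u` makes w + εu a point of the cone over the dual numbers. The rational
inverse sends it to t + εb, and the equations saying that a point is proportional to Ψ of its
parameters remain valid there because the denominators are units. Their ε-part says that u − dΨ(b)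
is proportional to `w`. -/
theorem exists_differential_eq {t : α → ℂ} (ht : eval t P.g ≠ 0) {u : Fin n → ℂ}
    (hu : u ∈ tangent P.variety (evalTuple Ψ t)) :
    ∃ (b : α → ℂ) (c : ℂ), u = differential Ψ t b + c • evalTuple Ψ t := by
  set w := evalTuple Ψ t with hw
  -- The derivative of num/den at `w` along `u`, by the quotient rule with num = t·den.
  set b : α → ℂ := fun s =>
    (polyDeriv (P.num s) w u - t s * polyDeriv (P.den s) w u) / eval w (P.den s) with hb
  have key : ∀ i j, (u i - differential Ψ t b i) * w j = (u j - differential Ψ t b j) * w i := by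
    intro i j
    obtain ⟨Θ, hmem, N, hΘ⟩ := P.exists_proportional i j
    have h1 := hΘ (DualNumber ℂ) (dualEval w u)
      (Sum.elim (fun s => TrivSqZeroExt.inl (t s) + TrivSqZeroExt.inr (b s))
        (fun j => TrivSqZeroExt.inl (w j) + TrivSqZeroExt.inr (u j))) (by
        rintro (s | s)
        · have h2 : b s * eval w (P.den s) =
              polyDeriv (P.num s) w u - t s * polyDeriv (P.den s) w u :=
            div_mul_cancel₀ _ (P.den_ne_zero t ht s)
          have h3 := P.num_eq t ht s
          simp only [Sum.elim_inl, dualEval_eq]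
          ext
          · simpa using h3
          · simp
            linear_combination -h2
        · simp [dualEval])
    have h2 : ∀ f, aeval (Sum.elim (fun s => TrivSqZeroExt.inl (t s) + TrivSqZeroExt.inr (b s))
        (fun j => TrivSqZeroExt.inl (w j) + TrivSqZeroExt.inr (u j)) :
          α ⊕ Fin n → DualNumber ℂ) (rename Sum.inl f) = dualEval t b f := fun f => by
      rw [aeval_rename, Sum.elim_comp_inl]
      rfl
    rw [map_sub, map_mul, map_mul, h2, h2, aeval_X, aeval_X, Sum.elim_inr, Sum.elim_inr,
      dualEval_eq, dualEval_eq, dualEval_eq, mem_tangent.1 hu Θ hmem,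
      show eval w Θ = 0 by simpa using P.mem_vanIdeal_variety.1 hmem t ht 1 one_ne_zero] at h1
    have hunit : IsUnit (∏ s : α ⊕ Fin n, dualEval w u (Sum.elim P.den 1 s)) := by
      rw [← map_prod, TrivSqZeroExt.isUnit_iff_isUnit_fst, dualEval_eq]
      simp only [TrivSqZeroExt.fst_add, TrivSqZeroExt.fst_inl, TrivSqZeroExt.fst_inr, add_zero]
      rw [isUnit_iff_ne_zero, map_prod, Finset.prod_ne_zero_iff]
      rintro (s | s) -
      · exact P.den_ne_zero t ht s
      · simp
    have h3 := ((hunit.pow N).mul_right_eq_zero).1 (h1.symm.trans (by simp))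
    have h4 := congrArg TrivSqZeroExt.snd h3
    simp only [TrivSqZeroExt.snd_sub, TrivSqZeroExt.snd_mul, TrivSqZeroExt.snd_add,
      TrivSqZeroExt.fst_add, TrivSqZeroExt.fst_inl, TrivSqZeroExt.fst_inr, TrivSqZeroExt.snd_inl,
      TrivSqZeroExt.snd_inr, add_zero, zero_add, smul_eq_mul, TrivSqZeroExt.snd_zero,
      MulOpposite.smul_eq_mul_unop, MulOpposite.unop_op] at h4
    change w i * differential Ψ t b j + u i * w j -
      (w j * differential Ψ t b i + u j * w i) = 0 at h4
    linear_combination h4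
  have hw0 : w ≠ 0 := P.ne_zero t ht
  obtain ⟨j, hj⟩ := Function.ne_iff.1 hw0
  refine ⟨b, (u j - differential Ψ t b j) / w j, funext fun i => ?_⟩
  have := key i j
  simp only [Pi.add_apply, Pi.smul_apply, smul_eq_mul]
  simp only [Pi.zero_apply] at hj
  field_simp
  linear_combination this

theorem finrank_tangent {t : α → ℂ} (ht : eval t P.g ≠ 0) :
    Module.finrank ℂ (tangent P.variety (evalTuple Ψ t)) = Fintype.card α + 1 := by
  obtain ⟨y, hy, hy'⟩ := P.exists_rep ht
  have hself := mem_tangent_self (subset_zclosure _ hy) hy'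
  let L : ((α → ℂ) × ℂ) →ₗ[ℂ] tangent P.variety (evalTuple Ψ t) :=
    { toFun := fun z => ⟨differential Ψ t z.1 + z.2 • evalTuple Ψ t,
        add_mem (P.differential_mem_tangent t z.1) (Submodule.smul_mem _ _ hself)⟩
      map_add' := fun z z' => by
        ext j
        simp [differential]
        ring
      map_smul' := fun c z => by
        ext j
        simp [differential]
        ring }
  have hL : Function.Bijective L := by
    constructor
    · rw [injective_iff_map_eq_zero]
      rintro ⟨b, c⟩ h
      have h1 : differential Ψ t b + c • evalTuple Ψ t = 0 := congrArg Subtype.val h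
      have h2 : differential Ψ t b = (-c) • evalTuple Ψ t := by
        rw [neg_smul]; exact eq_neg_of_add_eq_zero_left h1
      obtain ⟨rfl, h3⟩ := P.differential_injective ht h2
      rw [neg_eq_zero.1 h3]
      rfl
    · rintro ⟨u, hu⟩
      obtain ⟨b, c, rfl⟩ := P.exists_differential_eq ht hu
      exact ⟨(b, c), rfl⟩
  rw [← (LinearEquiv.ofBijective L hL).finrank_eq]
  simp

theorem finrank_jacSpan {t : α → ℂ} (ht : eval t P.g ≠ 0) :
    Module.finrank ℂ (jacSpan P.variety (evalTuple Ψ t)) + Fintype.card α + 1 = n := by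
  have h1 := P.finrank_tangent ht
  have h2 := finrank_jacSpan_add_finrank_tangent (V := P.variety) (w := evalTuple Ψ t)
  omega

/-- If the Jacobian had larger rank at some point, a minor nonzero there would vanish at every
parametrized point, hence lie in the ideal and vanish on all of the variety. -/
theorem finrank_jacSpan_le {y : PSpace n} (hy : y ∈ P.variety) {w : Fin n → ℂ}
    (hw : HomCoords.Rep w y) :
    Module.finrank ℂ (jacSpan P.variety w) + Fintype.card α + 1 ≤ n := by
  by_contra! hlt
  obtain ⟨f, hf, -, hli⟩ := Submodule.exists_fun_fin_finrank_span_eq ℂ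
    {g | ∃ f ∈ vanishingPolys P.variety, g = grad f w}
  choose F hF hFw using hf
  have hli' : LinearIndependent ℂ
      fun l => evalTuple ((fun l j => pderiv j (F l)) l) w := by
    have : (fun l => evalTuple ((fun l j => pderiv j (F l)) l) w) = f :=
      funext fun l => (hFw l).symm
    rwa [this]
  obtain ⟨δ, hδ0, hδ⟩ := exists_poly_linearIndependent _ hli'
  have hmem : δ ∈ vanIdeal P.variety := by
    rw [mem_vanIdeal_variety]
    intro t ht c hc
    by_contra hne
    have h1 := hδ _ hne
    have h2 : Submodule.span ℂ (Set.range fun l =>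
        evalTuple ((fun l j => pderiv j (F l)) l) (c • evalTuple Ψ t)) ≤
          jacSpan P.variety (evalTuple Ψ t) := by
      rw [← jacSpan_smul hc]
      refine Submodule.span_mono ?_
      rintro _ ⟨l, rfl⟩
      exact ⟨F l, hF l, rfl⟩
    have h3 := Submodule.finrank_mono h2
    rw [finrank_span_eq_card h1, Fintype.card_fin] at h3
    have h4 := P.finrank_jacSpan ht
    change Module.finrank ℂ (jacSpan P.variety w) ≤ _ at h3
    omega
  exact hδ0 (hmem y hy w hw)

end InvertibleParam

/-! ## The closure of a parametrized bundle of systems of critical matrices -/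

/-- A family of points of `S`, parametrized by a principal open subset of an affine space with a
rational inverse, whose images under `ψ` lie in `V` and on which the system of critical matrices
has a frame of sections. -/
structure ParamBundle (S : Type) {σ B : Type} [HomCoords S σ] [MultiProj S B] {n : ℕ}
    (V : Set (PSpace n)) (ψ : Fin n → MvPolynomial σ ℂ) (α : Type) [Fintype α] (r : ℕ) where
  g : MvPolynomial α ℂ
  Φ : σ → MvPolynomial α ℂ
  num : α → MvPolynomial σ ℂ
  den : α → MvPolynomial σ ℂ
  locus : MvPolynomial σ ℂ
  F : Fin (r + 1) → Sym2 (Fin n) → MvPolynomial (Fin n) ℂ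
  Λ : Matrix (Fin (r + 1)) (Sym2 (Fin n)) ℂ
  g_ne_zero : g ≠ 0
  exists_rep : ∀ t, eval t g ≠ 0 → ∃ x : S, HomCoords.Rep (evalTuple Φ t) x
  inverse : ∀ (t : α → ℂ) (x : S) (w : σ → ℂ), eval t g ≠ 0 →
    HomCoords.Rep (evalTuple Φ t) x → HomCoords.Rep w x →
      ∀ i, eval w (den i) ≠ 0 ∧ eval w (num i) = t i * eval w (den i)
  exists_smul : ∀ (x : S) (v w : σ → ℂ), HomCoords.Rep v x → HomCoords.Rep w x →
    ∃ c : ℂ, c ≠ 0 ∧ evalTuple ψ w = c • evalTuple ψ v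
  locus_ne_zero : ∀ (t : α → ℂ) (x : S), eval t g ≠ 0 → HomCoords.Rep (evalTuple Φ t) x →
    eval (evalTuple Φ t) locus ≠ 0
  -- Away from the zeros of `locus`, taking the closure adds no points to the base.
  exists_param : ∀ x ∈ zclosure {x : S | ∃ t, eval t g ≠ 0 ∧ HomCoords.Rep (evalTuple Φ t) x},
    ∀ w, HomCoords.Rep w x → eval w locus ≠ 0 →
      ∃ t, eval t g ≠ 0 ∧ HomCoords.Rep (evalTuple Φ t) x
  mem : ∀ t, eval t g ≠ 0 → ∃ y ∈ V, HomCoords.Rep (evalTuple ψ (evalTuple Φ t)) y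
  isSection : ∀ l, IsSection V (F l)
  span_eq : ∀ t, eval t g ≠ 0 → critSpace V (evalTuple ψ (evalTuple Φ t)) =
    Submodule.span ℂ (Set.range fun l => evalTuple (F l) (evalTuple ψ (evalTuple Φ t)))
  det_ne_zero : ∀ t, eval t g ≠ 0 →
    (Λ * Matrix.of fun q l => eval (evalTuple ψ (evalTuple Φ t)) (F l q)).det ≠ 0
  -- Parameters and frame coefficients together are as many as the matrix entries; both the
  -- dimension and the finiteness of the general fibre rest on this.
  card_add : Fintype.card α + (r + 1) = Fintype.card (Sym2 (Fin n))

namespace ParamBundle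
variable {S σ B : Type} [HomCoords S σ] [MultiProj S B] {n : ℕ} {V : Set (PSpace n)}
  {ψ : Fin n → MvPolynomial σ ℂ} {α : Type} [Fintype α] {r : ℕ} (b : ParamBundle S V ψ α r)

/-- The parametrized points. -/
def base : Set S := {x : S | ∃ t, eval t b.g ≠ 0 ∧ HomCoords.Rep (evalTuple b.Φ t) x}

/-- The bundle over the parametrized points. -/
def total : Set (S × PSym n) :=
  {z | ∃ t h, eval t b.g ≠ 0 ∧ HomCoords.Rep (evalTuple b.Φ t) z.1 ∧ HomCoords.Rep h z.2 ∧
    h ∈ critSpace V (evalTuple ψ (evalTuple b.Φ t))}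

include b in
theorem critSpace_rep {x : S} {v w : σ → ℂ} (hv : HomCoords.Rep v x) (hw : HomCoords.Rep w x) :
    critSpace V (evalTuple ψ w) = critSpace V (evalTuple ψ v) := by
  obtain ⟨c, hc, h⟩ := b.exists_smul x v w hv hw
  rw [h, critSpace_smul hc]

theorem mem_critSpace_of_mem_total {z : S × PSym n} (hz : z ∈ b.total) {v : σ → ℂ}
    {h : Sym2 (Fin n) → ℂ} (hv : HomCoords.Rep v z.1) (hh : HomCoords.Rep h z.2) :
    h ∈ critSpace V (evalTuple ψ v) := by
  obtain ⟨t, h', ht, htx, hh', hmem⟩ := hz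
  rw [b.critSpace_rep htx hv]
  obtain ⟨c, -, rfl⟩ := proj_rep_eq_smul hh' hh
  exact Submodule.smul_mem _ _ hmem

theorem linearIndependent {t : α → ℂ} (ht : eval t b.g ≠ 0) :
    LinearIndependent ℂ fun l => evalTuple (b.F l) (evalTuple ψ (evalTuple b.Φ t)) :=
  linearIndependent_of_det_ne_zero (b.det_ne_zero t ht)

theorem mem_of_rep {x : S} {t : α → ℂ} (ht : eval t b.g ≠ 0)
    (htx : HomCoords.Rep (evalTuple b.Φ t) x) {v : σ → ℂ} (hv : HomCoords.Rep v x) :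
    ∃ y ∈ V, HomCoords.Rep (evalTuple ψ v) y := by
  obtain ⟨y, hy, hy'⟩ := b.mem t ht
  obtain ⟨c, hc, h⟩ := b.exists_smul x _ _ htx hv
  exact ⟨y, hy, h ▸ proj_rep_smul hy' hc⟩

theorem finrank_critSpace_rep {x : S} {t : α → ℂ} (ht : eval t b.g ≠ 0)
    (htx : HomCoords.Rep (evalTuple b.Φ t) x) {v : σ → ℂ} (hv : HomCoords.Rep v x) :
    Module.finrank ℂ (critSpace V (evalTuple ψ v)) = r + 1 := by
  rw [b.critSpace_rep htx hv, b.span_eq t ht, finrank_span_eq_card (b.linearIndependent ht),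
    Fintype.card_fin]

/-- Critical matrices over the closure of the base lie in the closure of the bundle. -/
theorem mem_zclosure_total {x : S} (hx : x ∈ zclosure b.base) {v : σ → ℂ}
    (hv : HomCoords.Rep v x)
    (hiso : dotProduct (evalTuple ψ v) (evalTuple ψ v) ≠ 0) {h : Sym2 (Fin n) → ℂ}
    (hh : h ∈ critSpace V (evalTuple ψ v)) {H : PSym n} (hH : HomCoords.Rep h H) :
    (x, H) ∈ zclosure b.total := by
  rw [mem_zclosure]
  rintro f hf u ⟨hu1, hu2⟩
  set v₁ : σ → ℂ := fun s => u (Sum.inl s) with hv₁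
  set h₁ : Sym2 (Fin n) → ℂ := fun s => u (Sum.inr s) with hh₁
  obtain ⟨c, hc, hcv⟩ := b.exists_smul x v v₁ hv hu1
  have hmem : h₁ ∈ critSpace V (evalTuple ψ v₁) := by
    rw [b.critSpace_rep hv hu1]
    obtain ⟨c', -, hc'⟩ := proj_rep_eq_smul hH hu2
    rw [hc']
    exact Submodule.smul_mem _ _ hh
  have hiso' : dotProduct (evalTuple ψ v₁) (evalTuple ψ v₁) ≠ 0 := by
    rw [hcv, smul_dotProduct, dotProduct_smul]
    exact smul_ne_zero hc (smul_ne_zero hc hiso)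
  -- The critical matrix is extended to a section `G`; over the base its nonzero values give points
  -- of the bundle, where `f` vanishes.
  obtain ⟨G, hG, hGv⟩ := exists_section hiso' hmem
  obtain ⟨q, hq⟩ := Function.ne_iff.1 (proj_rep_ne_zero hu2)
  set Gψ : Sym2 (Fin n) → MvPolynomial σ ℂ := fun q => aeval ψ (G q) with hGψ
  have hGev : ∀ v, evalTuple Gψ v = evalTuple G (evalTuple ψ v) := fun v => evalTuple_aeval ψ G v
  have hfev : ∀ v, eval v (aeval (Sum.elim X Gψ) f) =
      eval (Sum.elim v (evalTuple Gψ v)) f := by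
    intro v
    rw [eval_aeval_tuple]
    congr 2
    funext s
    rcases s with s | s <;> simp [evalTuple]
  -- The factor `Gψ q` takes care of base points at which the section is zero and defines no
  -- projective point; it is nonzero at `v₁`.
  have hvan : aeval (Sum.elim X Gψ) f * Gψ q ∈ vanIdeal b.base := by
    rintro x' ⟨t, ht, htx⟩ w hw
    rw [map_mul, hfev]
    by_cases h0 : evalTuple Gψ w = 0
    · have : eval w (Gψ q) = 0 := congrFun h0 q
      rw [this, mul_zero]
    · obtain ⟨H', hH'⟩ := proj_exists_point h0
      obtain ⟨y', hy', hy''⟩ := b.mem_of_rep ht htx hw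
      have hsec := hG y' hy' _ hy''
      rw [← hGev, b.critSpace_rep htx hw] at hsec
      have := hf (x', H') ⟨t, _, ht, htx, hH', hsec⟩ (Sum.elim w (evalTuple Gψ w)) ⟨hw, hH'⟩
      rw [this, zero_mul]
  have h1 := mem_zclosure.1 hx _ hvan v₁ hu1
  rw [map_mul, hfev] at h1
  have h2 : evalTuple Gψ v₁ = h₁ := (hGev v₁).trans hGv
  have h3 : eval v₁ (Gψ q) = h₁ q := congrFun h2 q
  rw [h2, h3] at h1
  have h4 : (Sum.elim v₁ h₁ : σ ⊕ Sym2 (Fin n) → ℂ) = u := by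
    funext s
    rcases s with s | s <;> rfl
  rw [h4] at h1
  exact (mul_eq_zero.1 h1).resolve_right hq

/-- Where sections form a frame, the fibre of the closure of the bundle is contained in their
span. -/
theorem mem_span_of_mem_zclosure {x : S} {H : PSym n} (hx : (x, H) ∈ zclosure b.total) {v : σ → ℂ}
    (hv : HomCoords.Rep v x) {h : Sym2 (Fin n) → ℂ} (hh : HomCoords.Rep h H)
    {G : Fin (r + 1) → Sym2 (Fin n) → MvPolynomial (Fin n) ℂ} (hG : ∀ l, IsSection V (G l))
    (hli : LinearIndependent ℂ fun l => evalTuple (G l) (evalTuple ψ v)) :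
    h ∈ Submodule.span ℂ (Set.range fun l => evalTuple (G l) (evalTuple ψ v)) := by
  by_contra hcon
  -- If `h` were outside the span, `h` and the `G l` would be `r + 2` independent tuples, and a
  -- minor would detect this. On the bundle they all lie in a space of rank `r + 1`, so the minor
  -- vanishes there and on the closure.
  set K : Fin (r + 2) → Sym2 (Fin n) → MvPolynomial (σ ⊕ Sym2 (Fin n)) ℂ :=
    Fin.cons (fun q => X (Sum.inr q)) (fun l q => rename Sum.inl (aeval ψ (G l q))) with hK
  have hKev : ∀ (v : σ → ℂ) (h : Sym2 (Fin n) → ℂ),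
      (fun l => evalTuple (K l) (Sum.elim v h)) =
        Fin.cons h fun l => evalTuple (G l) (evalTuple ψ v) := by
    intro v h
    funext l
    refine Fin.cases ?_ (fun l => ?_) l
    · funext q
      simp [hK, evalTuple]
    · funext q
      simp only [hK, evalTuple, Fin.cons_succ, eval_rename, Sum.elim_comp_inl]
      exact eval_aeval_tuple ψ v (G l q)
  have hli' : LinearIndependent ℂ fun l => evalTuple (K l) (Sum.elim v h) := by
    rw [hKev]
    exact linearIndependent_finCons.2 ⟨hli, hcon⟩
  obtain ⟨δ, hδ0, hδ⟩ := exists_poly_linearIndependent K hli'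
  refine hδ0 (mem_zclosure.1 hx δ ?_ (Sum.elim v h) ⟨hv, hh⟩)
  rintro z hz u ⟨hu1, hu2⟩
  by_contra hne
  have h1 := hδ u hne
  have h4 : u = (Sum.elim (fun s => u (Sum.inl s)) fun s => u (Sum.inr s) :
      σ ⊕ Sym2 (Fin n) → ℂ) := by
    funext s
    rcases s with s | s <;> rfl
  rw [h4, hKev] at h1
  have hmem := b.mem_critSpace_of_mem_total hz hu1 hu2
  obtain ⟨t, -, ht, htx, -, -⟩ := hz
  obtain ⟨y, hy, hy'⟩ := b.mem_of_rep ht htx hu1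
  have h2 : Submodule.span ℂ (Set.range (Fin.cons (fun s => u (Sum.inr s)) fun l =>
      evalTuple (G l) (evalTuple ψ fun s => u (Sum.inl s)) :
        Fin (r + 2) → Sym2 (Fin n) → ℂ)) ≤ critSpace V (evalTuple ψ fun s => u (Sum.inl s)) := by
    rw [Submodule.span_le]
    rintro _ ⟨l, rfl⟩
    refine Fin.cases ?_ (fun l => ?_) l
    · exact hmem
    · exact hG l y hy _ hy'
  have h3 := Submodule.finrank_mono h2
  rw [finrank_span_eq_card h1, b.finrank_critSpace_rep ht htx hu1, Fintype.card_fin] at h3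
  omega

theorem mem_critSpace_of_mem_zclosure {x : S} {H : PSym n} (hx : (x, H) ∈ zclosure b.total)
    {t : α → ℂ} (ht : eval t b.g ≠ 0) (htx : HomCoords.Rep (evalTuple b.Φ t) x)
    {h : Sym2 (Fin n) → ℂ} (hh : HomCoords.Rep h H) :
    h ∈ critSpace V (evalTuple ψ (evalTuple b.Φ t)) := by
  rw [b.span_eq t ht]
  exact b.mem_span_of_mem_zclosure hx htx hh b.isSection (b.linearIndependent ht)

/-- The combinations of the frame over the parameter space. -/
def frameTuple (q : Sym2 (Fin n)) : MvPolynomial (α ⊕ Fin (r + 1)) ℂ :=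
  ∑ l, X (Sum.inr l) * rename Sum.inl (aeval b.Φ (aeval ψ (b.F l q)))

theorem evalTuple_frameTuple (z : α ⊕ Fin (r + 1) → ℂ) : evalTuple b.frameTuple z =
    ∑ l, z (Sum.inr l) •
      evalTuple (b.F l) (evalTuple ψ (evalTuple b.Φ fun s => z (Sum.inl s))) := by
  funext q
  simp only [evalTuple, frameTuple, map_sum, map_mul, eval_X, eval_rename, Finset.sum_apply,
    Pi.smul_apply, smul_eq_mul]
  refine Finset.sum_congr rfl fun l _ => ?_
  rw [eval_aeval_tuple, eval_aeval_tuple]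
  rfl

/-- A point of the bundle with given parameters. -/
theorem exists_mem_total {t : α → ℂ} (ht : eval t b.g ≠ 0) {s : Fin (r + 1) → ℂ} (hs : s ≠ 0) :
    ∃ x H, (x, H) ∈ b.total ∧ HomCoords.Rep (evalTuple b.Φ t) x ∧
      HomCoords.Rep (evalTuple b.frameTuple (Sum.elim t s)) H := by
  obtain ⟨x, hx⟩ := b.exists_rep t ht
  have h0 : evalTuple b.frameTuple (Sum.elim t s) ≠ 0 := by
    rw [evalTuple_frameTuple]
    intro h
    exact hs (funext fun l => Fintype.linearIndependent_iff.1 (b.linearIndependent ht) s h l)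
  obtain ⟨H, hH⟩ := proj_exists_point h0
  refine ⟨x, H, ⟨t, _, ht, hx, hH, ?_⟩, hx, hH⟩
  rw [b.span_eq t ht, evalTuple_frameTuple]
  exact Submodule.sum_mem _ fun l _ => Submodule.smul_mem _ _ (Submodule.subset_span ⟨l, rfl⟩)

theorem exists_eq_frameTuple {t : α → ℂ} (ht : eval t b.g ≠ 0) {h : Sym2 (Fin n) → ℂ}
    (hh : h ∈ critSpace V (evalTuple ψ (evalTuple b.Φ t))) :
    ∃ s, evalTuple b.frameTuple (Sum.elim t s) = h := by
  rw [b.span_eq t ht, Submodule.mem_span_range_iff_exists_fun] at hh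
  obtain ⟨s, hs⟩ := hh
  refine ⟨s, ?_⟩
  rw [evalTuple_frameTuple]
  exact hs

/-- The parameters of the points of the bundle over a matrix. -/
def fibre (h : Sym2 (Fin n) → ℂ) : Set (α → ℂ) :=
  {t | eval t b.g ≠ 0 ∧ h ∈ critSpace V (evalTuple ψ (evalTuple b.Φ t))}

/-- A matrix in the bundle over `t` has unique frame coefficients, so parameters over `h` correspond
to preimages of `h` under `frameTuple`, a polynomial map between affine spaces of equal dimension.
-/
theorem exists_card : ∃ (D : ℕ) (δ : MvPolynomial (Sym2 (Fin n)) ℂ), δ ≠ 0 ∧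
    ∀ h, eval h δ ≠ 0 → (b.fibre h).Finite ∧ (b.fibre h).ncard = D := by
  obtain ⟨D, δ, hδ0, hδ⟩ := exists_card_fibre (by
    rw [Fintype.card_sum, Fintype.card_fin, b.card_add]) b.frameTuple
    ((map_ne_zero_iff _ (rename_injective _ Sum.inl_injective)).2 b.g_ne_zero :
      rename (Sum.inl : α → α ⊕ Fin (r + 1)) b.g ≠ 0)
  refine ⟨D, δ, hδ0, fun h hh => ?_⟩
  have hbij : Set.BijOn (fun (z : α ⊕ Fin (r + 1) → ℂ) i => z (Sum.inl i))
      {z | eval z (rename Sum.inl b.g) ≠ 0 ∧ evalTuple b.frameTuple z = h} (b.fibre h) := by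
    refine ⟨?_, ?_, ?_⟩
    · rintro z ⟨hz, rfl⟩
      rw [eval_rename] at hz
      refine ⟨hz, ?_⟩
      rw [evalTuple_frameTuple]
      refine (b.span_eq _ hz).ge ?_
      exact Submodule.sum_mem _ fun l _ => Submodule.smul_mem _ _ (Submodule.subset_span ⟨l, rfl⟩)
    · rintro z ⟨hz, hz'⟩ z' ⟨-, hz''⟩ hzz
      rw [eval_rename] at hz
      dsimp only at hzz
      rw [← hz'', evalTuple_frameTuple, evalTuple_frameTuple, ← hzz] at hz'
      have h1 := (b.linearIndependent hz).eq_coords_of_eq hz'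
      funext i
      rcases i with i | i
      · exact congrFun hzz i
      · exact h1 i
    · rintro t ⟨ht, hmem⟩
      obtain ⟨s, hs⟩ := b.exists_eq_frameTuple ht hmem
      refine ⟨Sum.elim t s, ⟨?_, hs⟩, rfl⟩
      rw [eval_rename]
      exact ht
  obtain ⟨hfin, hcard⟩ := hδ h hh
  refine ⟨hbij.finite_iff_finite.1 hfin, ?_⟩
  rw [← hbij.ncard_eq, hcard]

theorem ncard_eq {h : Sym2 (Fin n) → ℂ} {A : Set S}
    (h1 : ∀ x ∈ A, ∃ t ∈ b.fibre h, HomCoords.Rep (evalTuple b.Φ t) x)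
    (h2 : ∀ t ∈ b.fibre h, ∀ x, HomCoords.Rep (evalTuple b.Φ t) x → x ∈ A)
    (hfin : (b.fibre h).Finite) : A.Finite ∧ A.ncard = (b.fibre h).ncard := by
  have : Nonempty S := by
    obtain ⟨t, ht⟩ := exists_eval_ne_zero b.g_ne_zero
    exact ⟨(b.exists_rep t ht).choose⟩
  choose! f hf using b.exists_rep
  have hbij : Set.BijOn f (b.fibre h) A := by
    refine ⟨fun t ht => h2 t ht _ (hf t ht.1), fun t ht t' ht' htt => ?_, fun x hx => ?_⟩
    · have hr := hf t ht.1
      have hr' := hf t' ht'.1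
      rw [← htt] at hr'
      funext s
      obtain ⟨h0, h1⟩ := b.inverse t _ _ ht.1 hr hr s
      obtain ⟨-, h2⟩ := b.inverse t' _ _ ht'.1 hr' hr s
      exact mul_right_cancel₀ h0 (h1.symm.trans h2)
    · obtain ⟨t, ht, htx⟩ := h1 x hx
      exact ⟨t, ht, MultiProj.rep_inj (hf t ht.1) htx⟩
  exact ⟨hbij.finite_iff_finite.1 hfin, hbij.ncard_eq.symm⟩

variable [Fintype B]

/-- Coordinate vectors of bundle points are parametrized by `t`, scaling factors for the blocks of
the base, and frame coefficients. The matrix block needs no scaling factor, since the coefficients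
`s` already absorb it. -/
theorem vanIdeal_total : vanIdeal b.total = RingHom.ker (aeval
    (Sum.elim (fun s => rename Sum.inl (torusTuple (MultiProj.blk S) b.Φ s))
      (fun q => rename (Sum.map Sum.inl id) (b.frameTuple q)) :
        σ ⊕ Sym2 (Fin n) → MvPolynomial ((α ⊕ B) ⊕ Fin (r + 1)) ℂ)) := by
  have key : ∀ (t : α → ℂ) (l : B → ℂ) (s : Fin (r + 1) → ℂ), evalTuple
    (Sum.elim (fun s => rename Sum.inl (torusTuple (MultiProj.blk S) b.Φ s))
      (fun q => rename (Sum.map Sum.inl id) (b.frameTuple q)) :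
        σ ⊕ Sym2 (Fin n) → MvPolynomial ((α ⊕ B) ⊕ Fin (r + 1)) ℂ)
      (Sum.elim (Sum.elim t l) s) = Sum.elim (scale (MultiProj.blk S) l (evalTuple b.Φ t))
        (evalTuple b.frameTuple (Sum.elim t s)) := by
    intro t l s
    funext j
    rcases j with j | j
    · have := congrFun (evalTuple_torusTuple (MultiProj.blk S) b.Φ (Sum.elim t l)) j
      simp only [evalTuple, Sum.elim_inl, eval_rename, Sum.elim_comp_inl]
      exact this
    · simp only [evalTuple, Sum.elim_inr, eval_rename]
      congr 2
      funext i
      rcases i with i | i <;> rfl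
  have hsplit : ∀ z : (α ⊕ B) ⊕ Fin (r + 1) → ℂ, z = Sum.elim (Sum.elim
      (fun i => z (Sum.inl (Sum.inl i))) fun i => z (Sum.inl (Sum.inr i)))
        fun i => z (Sum.inr i) := by
    intro z
    funext i
    rcases i with (i | i) | i <;> rfl
  -- Requiring the coefficient `s 0` to be nonzero makes the frame combination nonzero, so that it
  -- represents a projective point.
  refine vanIdeal_eq_ker (Γ := rename Sum.inl (torusDenom b.g) * X (Sum.inr 0)) _ ?_ ?_ ?_
  · refine mul_ne_zero ?_ (X_ne_zero _)
    exact (map_ne_zero_iff _ (rename_injective _ Sum.inl_injective)).2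
      (torusDenom_ne_zero b.g_ne_zero)
  · intro z hz
    rw [map_mul, eval_rename, eval_X, mul_ne_zero_iff, eval_torusDenom_ne_zero] at hz
    obtain ⟨⟨hz1, hz2⟩, hz3⟩ := hz
    have hs : (fun i => z (Sum.inr i)) ≠ 0 := fun h => hz3 (congrFun h 0)
    obtain ⟨x, H, hmem, hx, hH⟩ := b.exists_mem_total hz1 hs
    refine ⟨(x, H), hmem, ?_⟩
    rw [hsplit z, key]
    exact ⟨MultiProj.rep_scale hx hz2, hH⟩
  · rintro ⟨x, H⟩ ⟨t, h, ht, hx, hh, hmem⟩ w ⟨hw1, hw2⟩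
    obtain ⟨l, hl, hwl⟩ := MultiProj.rep_eq_scale hx hw1
    obtain ⟨c, -, hwc⟩ := proj_rep_eq_smul hh hw2
    obtain ⟨s, hs⟩ := b.exists_eq_frameTuple ht (Submodule.smul_mem _ c hmem)
    refine ⟨Sum.elim (Sum.elim t l) s, ?_⟩
    rw [key, hs, ← hwl, ← hwc]
    funext j
    rcases j with j | j <;> rfl

theorem isPrime_vanIdeal_total : (vanIdeal b.total).IsPrime := by
  rw [b.vanIdeal_total]
  exact RingHom.ker_isPrime _

theorem dep_vanIdeal_total :
    Dep (vanIdeal b.total) (Fintype.card (Sym2 (Fin n)) + Fintype.card B + 1) := by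
  rw [b.vanIdeal_total, ← b.card_add]
  refine (dep_ker_aeval _).mono ?_
  simp only [Fintype.card_sum, Fintype.card_fin]
  omega

omit [Fintype B] in
theorem nonempty_total : b.total.Nonempty := by
  obtain ⟨t, ht⟩ := exists_eval_ne_zero b.g_ne_zero
  obtain ⟨x, H, hmem, -⟩ := b.exists_mem_total ht (s := fun _ => 1)
    fun h => one_ne_zero (congrFun h 0)
  exact ⟨_, hmem⟩

theorem zIrreducible : ZIrreducible (zclosure b.total) :=
  zIrreducible_zclosure b.nonempty_total b.isPrime_vanIdeal_total

/-- Over a general matrix, the points of the closure of the bundle lie in the bundle. -/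
theorem exists_generic [Finite σ] : ∃ δ : MvPolynomial (Sym2 (Fin n)) ℂ, δ ≠ 0 ∧
    ∀ (x : S) (H : PSym n) (h : Sym2 (Fin n) → ℂ), HomCoords.Rep h H → eval h δ ≠ 0 →
      (x, H) ∈ zclosure b.total → ∃ t, eval t b.g ≠ 0 ∧ HomCoords.Rep (evalTuple b.Φ t) x ∧
        h ∈ critSpace V (evalTuple ψ (evalTuple b.Φ t)) := by
  have hE := b.isPrime_vanIdeal_total
  have hdep := b.dep_vanIdeal_total
  rw [← vanIdeal_zclosure] at hE hdep
  have hf : rename Sum.inl b.locus ∉ vanIdeal (zclosure b.total) := by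
    intro h
    rw [vanIdeal_zclosure] at h
    obtain ⟨t, ht⟩ := exists_eval_ne_zero b.g_ne_zero
    obtain ⟨x, H, hmem, hx, hH⟩ := b.exists_mem_total ht (s := fun _ => 1)
      fun h => one_ne_zero (congrFun h 0)
    have := h (x, H) hmem (Sum.elim _ _) ⟨hx, hH⟩
    rw [eval_rename, Sum.elim_comp_inl] at this
    exact b.locus_ne_zero t x ht hx this
  obtain ⟨δ, hδ0, hδ⟩ := exists_generic_not_mem hE hdep hf
  refine ⟨δ, hδ0, fun x H h hh hne hmem => ?_⟩
  by_contra! hcon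
  refine hne (hδ x H hmem (fun v hv => ?_) h hh)
  by_contra hv0
  have hx : x ∈ zclosure b.base := by
    rw [mem_zclosure]
    intro f hf w hw
    have h1 : rename Sum.inl f ∈ vanIdeal b.total := by
      rintro z ⟨t, h, ht, hx, -, -⟩ u ⟨hu, -⟩
      rw [eval_rename]
      exact hf z.1 ⟨t, ht, hx⟩ _ hu
    have := mem_zclosure.1 hmem _ h1 (Sum.elim w h) ⟨hw, hh⟩
    rwa [eval_rename, Sum.elim_comp_inl] at this
  obtain ⟨t, ht, htx⟩ := b.exists_param x hx v hv hv0
  exact hcon t ht htx (b.mem_critSpace_of_mem_zclosure hmem ht htx hh)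

/-- The matrix of the frame over the parameter space, compressed by `Λ`. -/
def frameMatrix : Matrix (Fin (r + 1)) (Fin (r + 1)) (MvPolynomial (α ⊕ Sym2 (Fin n)) ℂ) :=
  Matrix.of fun i l => ∑ q, C (b.Λ i q) * rename Sum.inl (aeval b.Φ (aeval ψ (b.F l q)))

/-- Polynomials in the parameters and the matrix that are proportional to its coordinates with
respect to the frame. -/
def frameCoords : Fin (r + 1) → MvPolynomial (α ⊕ Sym2 (Fin n)) ℂ :=
  b.frameMatrix.adjugate.mulVec fun i => ∑ q, C (b.Λ i q) * X (Sum.inr q)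

omit [Fintype B] in
-- This is Cramer's rule for the square matrix obtained by compressing the frame with `Λ`; the
-- common factor `c` is its determinant.
theorem eval_frameCoords {t : α → ℂ} (ht : eval t b.g ≠ 0) : ∃ c : ℂ, c ≠ 0 ∧
    ∀ (s : Fin (r + 1) → ℂ) (l : Fin (r + 1)),
      eval (Sum.elim t (evalTuple b.frameTuple (Sum.elim t s))) (b.frameCoords l) = c * s l := by
  refine ⟨_, b.det_ne_zero t ht, fun s l => ?_⟩
  set Fm : Matrix (Sym2 (Fin n)) (Fin (r + 1)) ℂ :=
    Matrix.of fun q l => eval (evalTuple ψ (evalTuple b.Φ t)) (b.F l q) with hFm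
  set h := evalTuple b.frameTuple (Sum.elim t s) with hh
  have h1 : h = Fm.mulVec s := by
    rw [hh, evalTuple_frameTuple]
    funext q
    simp [Matrix.mulVec, dotProduct, hFm, evalTuple, mul_comm]
  have h2 : (eval (Sum.elim t h)).mapMatrix b.frameMatrix = b.Λ * Fm := by
    ext i l
    simp only [frameMatrix, RingHom.mapMatrix_apply, Matrix.map_apply, Matrix.of_apply, map_sum,
      map_mul, eval_C, eval_rename, Sum.elim_comp_inl, Matrix.mul_apply, hFm]
    refine Finset.sum_congr rfl fun q _ => ?_
    rw [eval_aeval_tuple, eval_aeval_tuple]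
  have h3 : (eval (Sum.elim t h) ∘ fun i => ∑ q, C (b.Λ i q) * X (Sum.inr q)) =
      b.Λ.mulVec h := by
    funext i
    simp [Matrix.mulVec, dotProduct]
  rw [frameCoords, RingHom.map_mulVec, h3, ← RingHom.mapMatrix_apply]
  rw [RingHom.map_adjugate, h2, h1, Matrix.mulVec_mulVec, Matrix.mulVec_mulVec,
    Matrix.mul_assoc, Matrix.adjugate_mul, Matrix.smul_mulVec, Matrix.one_mulVec]
  rfl

/-- The affine chart `s 0 = 1` parametrizes the bundle by `t` and `r` coefficients. These are
recovered as ratios of `frameCoords`, so the common Cramer factor and the scaling of the matrix both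
cancel. -/
theorem le_zdim_total : ((Fintype.card α + r : ℕ) : WithBot ℕ∞) ≤ zdim (zclosure b.total) := by
  choose Θ N hΘ using fun l => exists_clear_denominators
    (Sum.elim (fun i => rename Sum.inl (b.num i)) (fun q => X (Sum.inr q)) :
      α ⊕ Sym2 (Fin n) → MvPolynomial (σ ⊕ Sym2 (Fin n)) ℂ)
    (Sum.elim (fun i => rename Sum.inl (b.den i)) 1) (b.frameCoords l)
  set Q : MvPolynomial (σ ⊕ Sym2 (Fin n)) ℂ := ∏ i, rename Sum.inl (b.den i) with hQ
  set Φ' : σ ⊕ Sym2 (Fin n) → MvPolynomial (α ⊕ Fin r) ℂ :=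
    Sum.elim (fun s => rename Sum.inl (b.Φ s)) fun q =>
      aeval (Sum.elim (fun i => X (Sum.inl i)) (Fin.cons 1 fun i => X (Sum.inr i)))
        (b.frameTuple q) with hΦ'
  have hev : ∀ z, evalTuple Φ' z = Sum.elim (evalTuple b.Φ fun i => z (Sum.inl i))
      (evalTuple b.frameTuple (Sum.elim (fun i => z (Sum.inl i))
        (Fin.cons 1 fun i => z (Sum.inr i)))) := by
    intro z
    funext j
    rcases j with j | j
    · simp only [evalTuple, hΦ', Sum.elim_inl, eval_rename]
      rfl
    · simp only [evalTuple, hΦ', Sum.elim_inr]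
      rw [eval_aeval_tuple]
      congr 2
      funext i
      rcases i with i | i
      · simp [evalTuple]
      · refine Fin.cases ?_ (fun i => ?_) i <;> simp [evalTuple]
  have hcard : Fintype.card α + r = Fintype.card (α ⊕ Fin r) := by simp
  rw [hcard]
  refine le_zdim (zclosure_subset subset_rfl) Φ' (g := rename Sum.inl b.g) ?_ ?_
    -- Clearing denominators multiplies each frame coordinate by its own power of `Q`; the crossed
    -- powers equalize them in the quotient.
    (Sum.elim (fun i => rename Sum.inl (b.num i)) fun l => Θ l.succ * Q ^ N 0)
    (Sum.elim (fun i => rename Sum.inl (b.den i)) fun l => Θ 0 * Q ^ N l.succ) ?_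
  · exact (map_ne_zero_iff _ (rename_injective _ Sum.inl_injective)).2 b.g_ne_zero
  · intro z hz
    rw [eval_rename] at hz
    obtain ⟨x, H, hmem, hx, hH⟩ := b.exists_mem_total hz
      (s := Fin.cons 1 fun i => z (Sum.inr i)) fun h => one_ne_zero (congrFun h 0)
    refine ⟨(x, H), subset_zclosure _ hmem, ?_⟩
    rw [hev]
    exact ⟨hx, hH⟩
  · rintro z ⟨x, H⟩ w hz hx ⟨hw1, hw2⟩
    rw [eval_rename] at hz
    rw [hev] at hx
    obtain ⟨hx1, hx2⟩ := hx
    simp only [Sum.elim_inl, Sum.elim_inr] at hx1 hx2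
    set t : α → ℂ := fun i => z (Sum.inl i) with ht
    set s : Fin (r + 1) → ℂ := Fin.cons 1 fun i => z (Sum.inr i) with hs
    have hinv := b.inverse t x _ hz hx1 hw1
    obtain ⟨c', hc', hwc⟩ := proj_rep_eq_smul hx2 hw2
    have hwc' : (fun q => w (Sum.inr q)) = evalTuple b.frameTuple (Sum.elim t (c' • s)) := by
      rw [hwc, evalTuple_frameTuple, evalTuple_frameTuple, Finset.smul_sum]
      refine Finset.sum_congr rfl fun l _ => ?_
      simp [smul_smul]
    obtain ⟨c, hc, hcoord⟩ := b.eval_frameCoords hz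
    have hQ0 : eval w Q ≠ 0 := by
      rw [hQ, map_prod, Finset.prod_ne_zero_iff]
      intro i _
      rw [eval_rename]
      exact (hinv i).1
    have hΘw : ∀ l, eval w (Θ l) = eval w Q ^ N l * (c * (c' * s l)) := by
      intro l
      have h1 := hΘ l ℂ (aeval w) (Sum.elim t fun q => w (Sum.inr q)) (by
        rintro (i | i)
        · simp only [Sum.elim_inl, aeval_eq_eval, eval_rename]
          exact (hinv i).2
        · simp)
      simp only [aeval_eq_eval] at h1
      rw [h1, hwc']
      erw [hcoord (c' • s) l]
      rw [Fintype.prod_sum_type]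
      simp [hQ]
    rintro (i | l)
    · simp only [Sum.elim_inl, eval_rename]
      exact hinv i
    · simp only [Sum.elim_inr, map_mul, map_pow, hΘw]
      have h0 : s 0 = 1 := rfl
      have h1 : s l.succ = z (Sum.inr l) := rfl
      rw [h0, h1]
      exact ⟨mul_ne_zero (mul_ne_zero (pow_ne_zero _ hQ0)
        (mul_ne_zero hc (mul_ne_zero hc' one_ne_zero))) (pow_ne_zero _ hQ0), by ring⟩

theorem zdim_add_one : zdim (zclosure b.total) + 1 = (Fintype.card (Sym2 (Fin n)) : ℕ) := by
  have hM : zdim (zclosure b.total) = (Fintype.card α + r : ℕ) := by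
    apply le_antisymm
    · refine zdim_le ?_
      rw [vanIdeal_zclosure]
      have := b.dep_vanIdeal_total
      rw [← b.card_add] at this
      refine this.mono ?_
      simp only [Fintype.card_sum, Fintype.card_unit]
      omega
    · exact b.le_zdim_total
  rw [hM, ← b.card_add]
  push_cast
  ring

end ParamBundle

/-! ### Frames over a parametrization, and the bundle over the image variety -/

namespace InvertibleParam
variable {n : ℕ} {α : Type} [Fintype α] {Ψ : Fin n → MvPolynomial α ℂ} (P : InvertibleParam Ψ)

/-- A frame of the system of critical matrices over the domain of a parametrization. -/
structure Frame (r : ℕ) where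
  F : Fin (r + 1) → Sym2 (Fin n) → MvPolynomial (Fin n) ℂ
  Λ : Matrix (Fin (r + 1)) (Sym2 (Fin n)) ℂ
  isSection : ∀ l, IsSection P.variety (F l)
  nonisotropic : ∀ t, eval t P.g ≠ 0 → dotProduct (evalTuple Ψ t) (evalTuple Ψ t) ≠ 0
  det_ne_zero : ∀ t, eval t P.g ≠ 0 →
    (Λ * Matrix.of fun q l => eval (evalTuple Ψ t) (F l q)).det ≠ 0
  card_add : Fintype.card α + (r + 1) = Fintype.card (Sym2 (Fin n))

variable {P}

theorem finrank_critSpace_param {t : α → ℂ} (ht : eval t P.g ≠ 0)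
    (hiso : dotProduct (evalTuple Ψ t) (evalTuple Ψ t) ≠ 0) :
    Fintype.card α + Module.finrank ℂ (critSpace P.variety (evalTuple Ψ t)) =
      Fintype.card (Sym2 (Fin n)) := by
  obtain ⟨y, hy, hy'⟩ := P.exists_rep ht
  have h1 := finrank_critSpace (subset_zclosure _ hy) hy' hiso
  have h2 := P.finrank_jacSpan ht
  rw [Sym2.card, Fintype.card_fin]
  change Module.finrank ℂ (critSpace P.variety (evalTuple Ψ t)) + n = _ + Module.finrank ℂ
    (jacSpan P.variety (evalTuple Ψ t)) + 1 at h1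
  omega

theorem Frame.span_eq {r : ℕ} (f : P.Frame r) {t : α → ℂ} (ht : eval t P.g ≠ 0) :
    critSpace P.variety (evalTuple Ψ t) =
      Submodule.span ℂ (Set.range fun l => evalTuple (f.F l) (evalTuple Ψ t)) := by
  symm
  obtain ⟨y, hy, hy'⟩ := P.exists_rep ht
  apply Submodule.eq_of_le_of_finrank_eq
  · rw [Submodule.span_le]
    rintro _ ⟨l, rfl⟩
    exact f.isSection l y (subset_zclosure _ hy) _ hy'
  · have h1 := finrank_critSpace_param ht (f.nonisotropic t ht)
    have h2 := f.card_add
    rw [finrank_span_eq_card (linearIndependent_of_det_ne_zero (f.det_ne_zero t ht)),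
      Fintype.card_fin]
    omega

variable (P) in
-- Since the variety is not isotropic, some parameter `t₀` gives a nonisotropic point. A frame
-- chosen there remains one where a determinant is nonzero, so it suffices to shrink the open set by
-- the quadratic form and this determinant; the variety does not change.
theorem exists_frame (hQ : ¬ P.variety ⊆ isotropicQuadric n) :
    ∃ P' : InvertibleParam Ψ, P'.variety = P.variety ∧ ∃ r, Nonempty (P'.Frame r) := by
  have hiso : aeval Ψ (dotProduct X X : MvPolynomial (Fin n) ℂ) ≠ 0 := by
    intro h
    apply hQ
    intro y hy
    obtain ⟨w, hw⟩ := proj_rep_exists y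
    have h1 : (dotProduct X X : MvPolynomial (Fin n) ℂ) ∈ vanIdeal P.variety := by
      rw [mem_vanIdeal_variety]
      intro t _ c _
      have h2 := congrArg (eval t) h
      rw [eval_aeval_tuple, map_zero] at h2
      rw [eval_smul_of_isHomogeneous (isHomogeneous_dotProduct (fun j => isHomogeneous_X ℂ j)
        fun j => isHomogeneous_X ℂ j), h2, mul_zero]
    refine ⟨w, hw, ?_⟩
    have := h1 y hy w hw
    simpa [dotProduct] using this
  obtain ⟨t₀, ht₀⟩ := exists_eval_ne_zero (mul_ne_zero P.g_ne_zero hiso)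
  rw [map_mul, mul_ne_zero_iff, eval_aeval_tuple] at ht₀
  have hev : ∀ w : Fin n → ℂ, eval w (dotProduct X X) = dotProduct w w := fun w => by
    simp [dotProduct]
  rw [hev] at ht₀
  have h1 := finrank_critSpace_param ht₀.1 ht₀.2
  obtain ⟨y, hy, hy'⟩ := P.exists_rep ht₀.1
  -- The rank must be written as `r + 1`. It is positive because the number of parameters is below
  -- `n`, which is at most the number of matrix entries.
  have hpos : Module.finrank ℂ (critSpace P.variety (evalTuple Ψ t₀)) ≠ 0 := by
    intro h0
    have h2 := finrank_critSpace (subset_zclosure _ hy) hy' ht₀.2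
    have h3 := P.finrank_jacSpan ht₀.1
    have h4 : Fintype.card α + 1 ≤ n := by omega
    have h5 : n ≤ (n + 1).choose 2 := by
      rw [Nat.choose_succ_succ']
      simp
    rw [h0, Sym2.card, Fintype.card_fin] at h1
    omega
  obtain ⟨r, hr⟩ := Nat.exists_eq_succ_of_ne_zero hpos
  obtain ⟨F, hF, hli⟩ := RayleighRitz.exists_frame (subset_zclosure _ hy) hy' ht₀.2 hr
  obtain ⟨Λ, hΛ⟩ := exists_det_ne_zero F hli
  have hdet : aeval Ψ (detPoly F Λ) ≠ 0 := by
    intro h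
    have h2 := congrArg (eval t₀) h
    rw [eval_aeval_tuple, map_zero, eval_detPoly] at h2
    exact hΛ h2
  have hne := mul_ne_zero hiso hdet
  have hg : ∀ t, eval t (P.restrict hne).g ≠ 0 ↔ eval t P.g ≠ 0 ∧
      dotProduct (evalTuple Ψ t) (evalTuple Ψ t) ≠ 0 ∧
        (Λ * Matrix.of fun q l => eval (evalTuple Ψ t) (F l q)).det ≠ 0 := by
    intro t
    change eval t (P.g * (_ * _)) ≠ 0 ↔ _
    rw [map_mul, map_mul, mul_ne_zero_iff, mul_ne_zero_iff, eval_aeval_tuple, eval_aeval_tuple,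
      hev, eval_detPoly]
  have hV := P.variety_restrict hne
  refine ⟨P.restrict hne, hV, r, ⟨⟨F, Λ, fun l => ?_, fun t ht => ((hg t).1 ht).2.1,
    fun t ht => ((hg t).1 ht).2.2, ?_⟩⟩⟩
  · rw [hV]
    exact (hF l).1
  · omega

/-- The critical points of the variety form a bundle over the parametrized points. -/
theorem exists_imageBundle {r : ℕ} (f : P.Frame r) :
    ∃ b : ParamBundle (PSpace n) P.variety (X : Fin n → MvPolynomial (Fin n) ℂ) α r,
      b.g = P.g ∧ b.Φ = Ψ := by
  have hX : ∀ w : Fin n → ℂ, evalTuple (X : Fin n → MvPolynomial (Fin n) ℂ) w = w := fun w => by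
    funext j; simp [evalTuple]
  obtain ⟨Θ, N, hΘ⟩ := exists_clear_denominators P.num P.den P.g
  have hΘev : ∀ (w : Fin n → ℂ) (t : α → ℂ),
      (∀ s, eval w (P.num s) = t s * eval w (P.den s)) →
        eval w Θ = (∏ s, eval w (P.den s)) ^ N * eval t P.g := fun w t h => by
    have := hΘ ℂ (aeval w) t (by simpa only [aeval_eq_eval] using h)
    simpa only [aeval_eq_eval] using this
  refine ⟨⟨P.g, Ψ, P.num, P.den, Θ * ∏ s, P.den s, f.F, f.Λ, P.g_ne_zero, fun t ht => ?_,
    fun t x w ht hx hw i => P.inverse_rep ht hx hw i, fun y v w hv hw => ?_, fun t x ht hx => ?_,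
    fun y hy w hw hne => ?_, fun t ht => ?_, f.isSection, fun t ht => ?_, fun t ht => ?_,
    f.card_add⟩, rfl, rfl⟩
  · obtain ⟨y, -, hy⟩ := P.exists_rep ht
    exact ⟨y, hy⟩
  · rw [hX, hX]
    exact proj_rep_eq_smul hv hw
  · rw [map_mul, map_prod, hΘev _ t (P.num_eq t ht)]
    have h := Finset.prod_ne_zero_iff.2 fun s (_ : s ∈ Finset.univ) => P.den_ne_zero t ht s
    exact mul_ne_zero (mul_ne_zero (pow_ne_zero _ h) ht) h
  · rw [map_mul, mul_ne_zero_iff, map_prod, Finset.prod_ne_zero_iff] at hne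
    obtain ⟨h1, h2⟩ := hne
    have h2' : ∀ s, eval w (P.den s) ≠ 0 := fun s => h2 s (Finset.mem_univ s)
    set t : α → ℂ := fun s => eval w (P.num s) / eval w (P.den s) with ht
    have h3 : ∀ s, eval w (P.num s) = t s * eval w (P.den s) := fun s =>
      (div_mul_cancel₀ _ (h2' s)).symm
    rw [hΘev w t h3] at h1
    have htg := right_ne_zero_of_mul h1
    refine ⟨t, htg, ?_⟩
    -- The proportionality equations belong to the ideal and so hold at every point of the closure;
    -- with nonzero denominators they make `w` proportional to Ψ of its recovered parameters.
    have h4 : ∀ i j, w i * evalTuple Ψ t j = w j * evalTuple Ψ t i := by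
      intro i j
      obtain ⟨Ξ, hΞ, M, hM⟩ := P.exists_proportional i j
      have h5 := hM ℂ (aeval w) (Sum.elim t w) (by
        rintro (s | s)
        · simp only [Sum.elim_inl, aeval_eq_eval]
          exact h3 s
        · simp)
      have h6 : eval w Ξ = 0 := hΞ y hy w hw
      simp only [aeval_eq_eval, h6] at h5
      have h7 : (∏ s : α ⊕ Fin n, eval w (Sum.elim P.den 1 s)) ≠ 0 := by
        rw [Finset.prod_ne_zero_iff]
        rintro (s | s) -
        · exact h2' s
        · simp
      have h8 := (mul_eq_zero.1 h5.symm).resolve_left (pow_ne_zero _ h7)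
      simp only [map_sub, map_mul, eval_X, eval_rename, Sum.elim_inr, Sum.elim_comp_inl] at h8
      exact sub_eq_zero.1 h8
    obtain ⟨j, hj⟩ := Function.ne_iff.1 (proj_rep_ne_zero hw)
    have h9 : evalTuple Ψ t = (evalTuple Ψ t j / w j) • w := by
      funext i
      have := h4 i j
      simp only [Pi.smul_apply, smul_eq_mul]
      simp only [Pi.zero_apply] at hj
      field_simp
      linear_combination -this
    have h10 : evalTuple Ψ t j / w j ≠ 0 := by
      intro h0
      rw [h0, zero_smul] at h9
      exact P.ne_zero t htg h9
    rw [h9]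
    exact proj_rep_smul hw h10
  · rw [hX]
    obtain ⟨y, hy, hy'⟩ := P.exists_rep ht
    exact ⟨y, subset_zclosure _ hy, hy'⟩
  · rw [hX]
    exact f.span_eq ht
  · rw [hX]
    exact f.det_ne_zero t ht

end InvertibleParam

section
variable {k a n : ℕ} {d : Fin k → ℕ}

/-! ## The parametric correspondence as the closure of a bundle -/

/-- A rational map in an affine chart. -/
def inChart (κ : ∀ i : Fin k, Fin (d i + 1)) (ψ : Fin n → MvPolynomial (Coord a d) ℂ) :
    Fin n → MvPolynomial (ChartCoord a d) ℂ := fun j => aeval (chart κ) (ψ j)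

theorem evalTuple_inChart (κ : ∀ i : Fin k, Fin (d i + 1)) (ψ : Fin n → MvPolynomial (Coord a d) ℂ)
    (t : ChartCoord a d → ℂ) :
    evalTuple (inChart κ ψ) t = evalTuple ψ (evalTuple (chart κ) t) :=
  evalTuple_aeval _ _ _

theorem IsBirational.exists_invertibleParam {ψ : Fin n → MvPolynomial (Coord a d) ℂ}
    (hψ : IsMultihomogeneous ψ) (hbir : IsBirational ψ) :
    ∃ κ : ∀ i : Fin k, Fin (d i + 1), Nonempty (InvertibleParam (inChart κ ψ)) := by
  obtain ⟨κ, g, num, den, deg, hg, hnum, hden, h⟩ := hbir.exists_chart hψ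
  simp only [← evalTuple_inChart] at h
  exact ⟨κ, ⟨⟨g, num, den, deg, hg, hnum, hden, fun t ht => (h t ht).1,
    fun t ht s => ((h t ht).2 s).1, fun t ht s => ((h t ht).2 s).2⟩⟩⟩

variable {κ : ∀ i : Fin k, Fin (d i + 1)} {ψ : Fin n → MvPolynomial (Coord a d) ℂ}
  {P : InvertibleParam (inChart κ ψ)} {r : ℕ}

theorem eq_zero_of_eval_chart {g : MvPolynomial (ChartCoord a d) ℂ} (hg : g ≠ 0)
    {f : MvPolynomial (Coord a d) ℂ}
    (h : ∀ (l : Fin k → ℂ) t, (∀ i, l i ≠ 0) → eval t g ≠ 0 →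
      eval (scale (MultiProj.blk (ParamSpace a d)) l (evalTuple (chart κ) t)) f = 0) : f = 0 := by
  obtain ⟨Γ, hΓ⟩ := exists_chart_locus κ g
  have hΓ0 : Γ ≠ 0 := by
    rintro rfl
    obtain ⟨t, ht⟩ := exists_eval_ne_zero hg
    exact (hΓ _).2 ⟨fun _ => 1, t, fun _ => one_ne_zero, ht, rfl⟩ (map_zero _)
  refine eq_zero_of_eval_of_ne hΓ0 fun v hv => ?_
  obtain ⟨l, t, hl, ht, rfl⟩ := (hΓ v).1 hv
  exact h l t hl ht

theorem exists_domainBundle (hψ : IsMultihomogeneous ψ) (f : P.Frame r) :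
    ∃ b : ParamBundle (ParamSpace a d) P.variety ψ (ChartCoord a d) r,
      b.g = P.g ∧ b.Φ = chart κ := by
  obtain ⟨Γ, hΓ⟩ := exists_chart_locus κ P.g
  refine ⟨⟨P.g, chart κ, fun s => X (chartNum κ s), chartDen κ, Γ, f.F, f.Λ, P.g_ne_zero,
    fun t _ => exists_rep_chart κ t, fun t x w _ hx hw i => ?_,
    fun x v w hv hw => hψ.exists_rep hv hw, fun t x ht _ => ?_, fun x _ w hw hne => ?_,
    fun t ht => ?_, f.isSection, fun t ht => ?_, fun t ht => ?_, f.card_add⟩, rfl, rfl⟩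
  · rw [eval_X]
    exact chart_rep κ hx hw i
  · refine (hΓ _).2 ⟨fun _ => 1, t, fun _ => one_ne_zero, ht, ?_⟩
    funext s
    simp only [scale]
    cases MultiProj.blk (ParamSpace a d) s <;> simp
  · obtain ⟨l, t, hl, ht, rfl⟩ := (hΓ w).1 hne
    obtain ⟨x', hx'⟩ := exists_rep_chart κ t
    have := MultiProj.rep_inj hw (MultiProj.rep_scale hx' hl)
    exact ⟨t, ht, this ▸ hx'⟩
  · obtain ⟨y, hy, hy'⟩ := P.exists_rep ht
    rw [evalTuple_inChart] at hy'
    exact ⟨y, subset_zclosure _ hy, hy'⟩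
  · rw [← evalTuple_inChart]
    exact f.span_eq ht
  · rw [← evalTuple_inChart]
    exact f.det_ne_zero t ht

theorem mem_zclosure_base (b : ParamBundle (ParamSpace a d) P.variety ψ (ChartCoord a d) r)
    (hΦ : b.Φ = chart κ) (x : ParamSpace a d) : x ∈ zclosure b.base := by
  rw [mem_zclosure]
  intro f hf w _
  have : f = 0 := eq_zero_of_eval_chart (κ := κ) b.g_ne_zero fun l t hl ht => by
    obtain ⟨x', hx'⟩ := exists_rep_chart κ t
    exact hf x' ⟨t, ht, hΦ ▸ hx'⟩ _ (MultiProj.rep_scale hx' hl)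
  rw [this, map_zero]

/-- The polynomial f(cψ) vanishes on rescaled chart vectors, which are dense among all coordinate
vectors. So ψ maps into the cone over the variety also outside the chart and at points where it is
not immersive. -/
theorem eval_smul_of_mem_vanIdeal (hψ : IsMultihomogeneous ψ) {f : MvPolynomial (Fin n) ℂ}
    (hf : f ∈ vanIdeal P.variety) {c : ℂ} (hc : c ≠ 0) (v : Coord a d → ℂ) :
    eval (c • evalTuple ψ v) f = 0 := by
  have hev : ∀ v, eval v (aeval (fun j => C c * ψ j) f) = eval (c • evalTuple ψ v) f := by
    intro v
    rw [eval_aeval_tuple]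
    congr 2
    funext j
    simp [evalTuple]
  rw [← hev, eq_zero_of_eval_chart (κ := κ) (f := aeval (fun j => C c * ψ j) f) P.g_ne_zero,
    map_zero]
  intro l t hl ht
  obtain ⟨c', hc', h⟩ := hψ.exists_scale l hl
  rw [hev, h, smul_smul, ← evalTuple_inChart]
  exact P.mem_vanIdeal_variety.1 hf t ht _ (mul_ne_zero hc hc')

theorem imageClosure_eq (hψ : IsMultihomogeneous ψ) (P : InvertibleParam (inChart κ ψ)) :
    imageClosure ψ = P.variety := by
  apply Set.Subset.antisymm
  · refine zclosure_subset ?_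
    rintro y ⟨x, v, hv, hy⟩
    change y ∈ P.variety
    rw [InvertibleParam.variety, mem_zclosure]
    intro f hf w hw
    rw [← vanIdeal_zclosure] at hf
    obtain ⟨c, hc, rfl⟩ := proj_rep_eq_smul hy hw
    exact eval_smul_of_mem_vanIdeal hψ hf hc v
  · refine zclosure_mono ?_
    rintro y ⟨t, ht, hy⟩
    obtain ⟨x, hx⟩ := exists_rep_chart κ t
    rw [evalTuple_inChart] at hy
    exact ⟨x, _, hx, hy⟩

theorem mem_variety_of_rep (hψ : IsMultihomogeneous ψ) {y : PSpace n} {v : Coord a d → ℂ}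
    (hy : HomCoords.Rep (evalTuple ψ v) y) : y ∈ P.variety := by
  rw [InvertibleParam.variety, mem_zclosure]
  intro f hf w hw
  rw [← vanIdeal_zclosure] at hf
  obtain ⟨c, hc, rfl⟩ := proj_rep_eq_smul hy hw
  exact eval_smul_of_mem_vanIdeal hψ hf hc v

theorem polyDeriv_mem_tangent (hψ : IsMultihomogeneous ψ) (v u : Coord a d → ℂ) :
    (fun j => polyDeriv (ψ j) v u) ∈ tangent P.variety (evalTuple ψ v) := by
  rw [mem_tangent]
  intro f hf
  have h0 : aeval ψ f = 0 := MvPolynomial.funext fun v => by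
    rw [eval_aeval_tuple, map_zero]
    have := eval_smul_of_mem_vanIdeal hψ hf one_ne_zero v
    rwa [one_smul] at this
  rw [← polyDeriv_comp, h0, polyDeriv_apply]
  simp

/-- The span of the value and of the partial derivatives of a rational map. -/
def imageSpan (ψ : Fin n → MvPolynomial (Coord a d) ℂ) (v : Coord a d → ℂ) :
    Submodule ℂ (Fin n → ℂ) :=
  Submodule.span ℂ ({evalTuple ψ v} ∪
    Set.range fun s : Coord a d => evalTuple (fun j => pderiv s (ψ j)) v)

theorem polyDeriv_mem_imageSpan (v u : Coord a d → ℂ) :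
    (fun j => polyDeriv (ψ j) v u) ∈ imageSpan ψ v := by
  rw [evalTuple_pderiv_sum]
  exact Submodule.sum_mem _ fun s _ => Submodule.smul_mem _ _
    (Submodule.subset_span (Or.inr ⟨s, rfl⟩))

theorem evalTuple_pderiv (v : Coord a d → ℂ) (s : Coord a d) :
    evalTuple (fun j => pderiv s (ψ j)) v = fun j => polyDeriv (ψ j) v (Pi.single s 1) := by
  rw [evalTuple_pderiv_sum, Finset.sum_eq_single s]
  · simp
  · intro b _ hb
    simp [hb]
  · simp

theorem imageSpan_le_tangent (hψ : IsMultihomogeneous ψ) {v : Coord a d → ℂ} {y : PSpace n}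
    (hy : HomCoords.Rep (evalTuple ψ v) y) :
    imageSpan ψ v ≤ tangent P.variety (evalTuple ψ v) := by
  rw [imageSpan, Submodule.span_le]
  rintro _ (h | ⟨s, rfl⟩)
  · rw [Set.mem_singleton_iff.1 h]
    exact mem_tangent_self (mem_variety_of_rep hψ hy) hy
  · simp only [evalTuple_pderiv]
    exact polyDeriv_mem_tangent hψ v _

theorem isImmersiveAt_iff (v : Coord a d → ℂ) :
    IsImmersiveAt ψ v ↔ Module.finrank ℂ (imageSpan ψ v) = Fintype.card (ChartCoord a d) + 1 := by
  rw [card_chartCoord]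
  rfl

/-- Every tangent vector of the cone comes from the parameters, and by the chain rule it is a
combination of the value and the partial derivatives of ψ. -/
theorem isImmersiveAt_chart (hψ : IsMultihomogeneous ψ) {t : ChartCoord a d → ℂ}
    (ht : eval t P.g ≠ 0) : IsImmersiveAt ψ (evalTuple (chart κ) t) := by
  obtain ⟨y, hy, hy'⟩ := P.exists_rep ht
  have hy'' := hy'
  rw [evalTuple_inChart] at hy''
  have h : imageSpan ψ (evalTuple (chart κ) t) = tangent P.variety (evalTuple (inChart κ ψ) t) := by
    apply le_antisymm
    · rw [evalTuple_inChart]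
      exact imageSpan_le_tangent hψ hy''
    · intro u hu
      obtain ⟨b, c, rfl⟩ := P.exists_differential_eq ht hu
      refine add_mem ?_ (Submodule.smul_mem _ _ (Submodule.subset_span (Or.inl ?_)))
      · have : InvertibleParam.differential (inChart κ ψ) t b = fun j =>
            polyDeriv (ψ j) (evalTuple (chart κ) t) fun s => polyDeriv (chart κ s) t b :=
          _root_.funext fun j => polyDeriv_comp (chart κ) (ψ j) t b
        rw [this]
        exact polyDeriv_mem_imageSpan _ _
      · rw [evalTuple_inChart]
        rfl
  rw [isImmersiveAt_iff, h, P.finrank_tangent ht]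

theorem fderiv_rayleigh_comp (h : Sym2 (Fin n) → ℂ) {v : Coord a d → ℂ}
    (hiso : dotProduct (evalTuple ψ v) (evalTuple ψ v) ≠ 0) (u : Coord a d → ℂ) :
    fderiv ℂ (fun u : Coord a d → ℂ => rayleigh (symMatrix h) (evalTuple ψ u)) v u =
      fderiv ℂ (rayleigh (symMatrix h)) (evalTuple ψ v) (fun j => polyDeriv (ψ j) v u) := by
  have := ((differentiableAt_rayleigh (symMatrix h) hiso).hasFDerivAt.comp v
    (hasFDerivAt_evalTuple ψ v)).fderiv
  change fderiv ℂ (rayleigh (symMatrix h) ∘ evalTuple ψ) v u = _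
  rw [this]
  rfl

theorem fderiv_eq_zero_of_mem_critSpace (hψ : IsMultihomogeneous ψ) {v : Coord a d → ℂ}
    {y : PSpace n} (hy : HomCoords.Rep (evalTuple ψ v) y)
    (hiso : dotProduct (evalTuple ψ v) (evalTuple ψ v) ≠ 0) {h : Sym2 (Fin n) → ℂ}
    (hh : h ∈ critSpace P.variety (evalTuple ψ v)) :
    fderiv ℂ (fun u : Coord a d → ℂ => rayleigh (symMatrix h) (evalTuple ψ u)) v = 0 := by
  ext1 u
  rw [fderiv_rayleigh_comp h hiso]
  exact (mem_critSpace_iff (mem_variety_of_rep hψ hy) hy hiso).1 hh _ (polyDeriv_mem_tangent hψ v u)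

/-- At an immersive point with regular image, the span of the value and partial derivatives fills
the tangent space by dimension. The partial derivatives are covered by the hypothesis on the
composite, and the direction of the value itself is free because the Rayleigh quotient has degree
zero. -/
theorem mem_critSpace_of_fderiv_eq_zero (hψ : IsMultihomogeneous ψ) {v : Coord a d → ℂ}
    {y : PSpace n} (hy : HomCoords.Rep (evalTuple ψ v) y)
    (hiso : dotProduct (evalTuple ψ v) (evalTuple ψ v) ≠ 0)
    (hreg : Module.finrank ℂ (tangent P.variety (evalTuple ψ v)) =
      Fintype.card (ChartCoord a d) + 1) (him : IsImmersiveAt ψ v) {h : Sym2 (Fin n) → ℂ}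
    (hh : fderiv ℂ (fun u : Coord a d → ℂ => rayleigh (symMatrix h) (evalTuple ψ u)) v = 0) :
    h ∈ critSpace P.variety (evalTuple ψ v) := by
  have hspan : imageSpan ψ v = tangent P.variety (evalTuple ψ v) :=
    Submodule.eq_of_le_of_finrank_eq (imageSpan_le_tangent hψ hy)
      (((isImmersiveAt_iff v).1 him).trans hreg.symm)
  rw [mem_critSpace_iff (mem_variety_of_rep hψ hy) hy hiso]
  have hle : imageSpan ψ v ≤ LinearMap.ker
      (fderiv ℂ (rayleigh (symMatrix h)) (evalTuple ψ v)).toLinearMap := by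
    rw [imageSpan, Submodule.span_le]
    rintro _ (hs | ⟨s, rfl⟩)
    · rw [Set.mem_singleton_iff.1 hs]
      change fderiv ℂ (rayleigh (symMatrix h)) (evalTuple ψ v) (evalTuple ψ v) = 0
      rw [fderiv_rayleigh (symMatrix_isSymm h) hiso]
      ring
    · change fderiv ℂ (rayleigh (symMatrix h)) (evalTuple ψ v) _ = 0
      simp only [evalTuple_pderiv]
      rw [← fderiv_rayleigh_comp h hiso, hh]
      rfl
  intro u hu
  rw [← hspan] at hu
  exact hle hu

theorem mem_regularLocus {y : PSpace n} {w : Fin n → ℂ} (hw : HomCoords.Rep w y) :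
    y ∈ regularLocus P.variety ↔ y ∈ P.variety ∧
      Module.finrank ℂ (jacSpan P.variety w) + Fintype.card (ChartCoord a d) + 1 = n := by
  rw [regularLocus, Set.mem_ofPred_eq, P.zdim_variety]
  refine and_congr_right fun _ => ⟨?_, fun h => ⟨w, hw, by exact_mod_cast h⟩⟩
  rintro ⟨w', hw', h⟩
  obtain ⟨c, hc, rfl⟩ := proj_rep_eq_smul hw hw'
  rw [jacSpan_smul hc] at h
  exact_mod_cast h

theorem mem_isotropicQuadric {y : PSpace n} {w : Fin n → ℂ} (hw : HomCoords.Rep w y) :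
    y ∈ isotropicQuadric n ↔ dotProduct w w = 0 := by
  refine ⟨?_, fun h => ⟨w, hw, h⟩⟩
  rintro ⟨w', hw', h⟩
  obtain ⟨c, hc, rfl⟩ := proj_rep_eq_smul hw hw'
  rw [smul_dotProduct, dotProduct_smul, smul_eq_mul, smul_eq_mul] at h
  simpa [hc] using h

theorem mem_regularDomain (hψ : IsMultihomogeneous ψ) (P : InvertibleParam (inChart κ ψ))
    {x : ParamSpace a d} {v : Coord a d → ℂ} (hv : HomCoords.Rep v x) :
    x ∈ regularDomain ψ ↔ dotProduct (evalTuple ψ v) (evalTuple ψ v) ≠ 0 ∧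
      Module.finrank ℂ (jacSpan P.variety (evalTuple ψ v)) + Fintype.card (ChartCoord a d) + 1 =
        n := by
  constructor
  · rintro ⟨y, ⟨v', hv', hy⟩, hreg, hiso⟩
    obtain ⟨c, hc, h⟩ := hψ.exists_rep hv' hv
    have hy' : HomCoords.Rep (evalTuple ψ v) y := h ▸ proj_rep_smul hy hc
    rw [imageClosure_eq hψ P, mem_regularLocus hy'] at hreg
    exact ⟨fun h0 => hiso ((mem_isotropicQuadric hy').2 h0), hreg.2⟩
  · rintro ⟨hiso, hreg⟩
    have h0 : evalTuple ψ v ≠ 0 := by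
      intro h
      rw [h, zero_dotProduct] at hiso
      exact hiso rfl
    obtain ⟨y, hy⟩ := proj_exists_point h0
    refine ⟨y, ⟨v, hv, hy⟩, ?_, fun h => hiso ((mem_isotropicQuadric hy).1 h)⟩
    rw [imageClosure_eq hψ P, mem_regularLocus hy]
    exact ⟨mem_variety_of_rep hψ hy, hreg⟩

theorem exists_point_of_nonisotropic {w : Fin n → ℂ} (h : dotProduct w w ≠ 0) :
    ∃ y : PSpace n, HomCoords.Rep w y :=
  proj_exists_point fun h0 => h (by rw [h0, zero_dotProduct])

/-- Parametric critical pairs may lie outside the chart or above zeros of `P.g`, but the chart is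
dense and sections deform such pairs into the bundle. Conversely, bundle points are regular,
nonisotropic and immersive, so they are parametric critical pairs themselves. -/
theorem correspondence_eq (hψ : IsMultihomogeneous ψ) (f : P.Frame r)
    {b : ParamBundle (ParamSpace a d) P.variety ψ (ChartCoord a d) r} (hg : b.g = P.g)
    (hΦ : b.Φ = chart κ) : parametricCorrespondence ψ = zclosure b.total := by
  apply Set.Subset.antisymm
  · refine zclosure_subset ?_
    rintro ⟨x, H⟩ ⟨hx, v, h, hv, hh, him, hcrit⟩
    obtain ⟨hiso, hreg⟩ := (mem_regularDomain hψ P hv).1 hx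
    obtain ⟨y, hy⟩ := exists_point_of_nonisotropic hiso
    have h1 := finrank_jacSpan_add_finrank_tangent (V := P.variety) (w := evalTuple ψ v)
    exact b.mem_zclosure_total (mem_zclosure_base b hΦ x) hv hiso
      (mem_critSpace_of_fderiv_eq_zero hψ hy hiso (by omega) him hcrit) hh
  · refine zclosure_mono ?_
    rintro ⟨x, H⟩ ⟨t, h, ht, hx, hh, hmem⟩
    rw [hg] at ht
    rw [hΦ] at hx hmem
    have hiso := f.nonisotropic t ht
    have hreg := P.finrank_jacSpan ht
    rw [evalTuple_inChart] at hiso hreg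
    obtain ⟨y, hy⟩ := exists_point_of_nonisotropic hiso
    exact ⟨(mem_regularDomain hψ P hx).2 ⟨hiso, hreg⟩, _, h, hx, hh, isImmersiveAt_chart hψ ht,
      fderiv_eq_zero_of_mem_critSpace hψ hy hiso hmem⟩

end

/-! ### The projective bundle over the regular domain, and the count of critical points -/

section
variable {k a n : ℕ} {d : Fin k → ℕ}

theorem isWeightedHomogeneous_aeval {σ ι M : Type} [AddCommMonoid M] {wt : σ → M}
    {F : ι → MvPolynomial σ ℂ} {D : M} (hF : ∀ j, IsWeightedHomogeneous wt (F j) D)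
    {f : MvPolynomial ι ℂ} {e : ℕ} (hf : f.IsHomogeneous e) :
    IsWeightedHomogeneous wt (aeval F f) (e • D) := by
  rw [aeval_def, eval₂_eq]
  refine IsWeightedHomogeneous.sum _ _ _ fun u hu => ?_
  have h1 : IsWeightedHomogeneous wt (∏ i ∈ u.support, F i ^ u i) (e • D) := by
    have := IsWeightedHomogeneous.prod u.support (fun i => F i ^ u i) (fun i => u i • D)
      fun i _ => (hF i).pow (u i)
    rw [← Finset.sum_smul] at this
    have he := hf (mem_support_iff.1 hu)
    rw [Finsupp.weight_apply, Finsupp.sum] at he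
    simpa [← he] using this
  have h2 := (isWeightedHomogeneous_C wt (coeff u f)).mul h1
  rw [zero_add] at h2
  exact h2

theorem IsMultihomogeneous.aeval {ψ : Fin n → MvPolynomial (Coord a d) ℂ}
    (hψ : IsMultihomogeneous ψ) {ι : Type} {F : ι → MvPolynomial (Fin n) ℂ} {e : ℕ}
    (hF : ∀ q, (F q).IsHomogeneous e) :
    IsMultihomogeneous fun q => MvPolynomial.aeval ψ (F q) := by
  obtain ⟨D, hD⟩ := hψ
  exact ⟨e • D, fun q => isWeightedHomogeneous_aeval hD (hF q)⟩

theorem linearIndependent_of_smul {ι E : Type} [AddCommGroup E] [Module ℂ E] {v w : ι → E}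
    {c : ι → ℂ} (hc : ∀ i, c i ≠ 0) (h : ∀ i, w i = c i • v i) (hv : LinearIndependent ℂ v) :
    LinearIndependent ℂ w := by
  have := hv.units_smul fun i => Units.mk0 (c i) (hc i)
  convert this using 1
  funext i
  rw [h]
  rfl

variable {κ : ∀ i : Fin k, Fin (d i + 1)} {ψ : Fin n → MvPolynomial (Coord a d) ℂ}
  {P : InvertibleParam (inChart κ ψ)} {r : ℕ}

/-- Near a regular point, the Jacobian matrix has maximal rank. -/
theorem exists_poly_finrank_jacSpan {V : Set (PSpace n)} (v₀ : Coord a d → ℂ) :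
    ∃ δ : MvPolynomial (Coord a d) ℂ, eval v₀ δ ≠ 0 ∧ ∀ v, eval v δ ≠ 0 →
      Module.finrank ℂ (jacSpan V (evalTuple ψ v₀)) ≤
        Module.finrank ℂ (jacSpan V (evalTuple ψ v)) := by
  obtain ⟨G', hG', -, hli⟩ := Submodule.exists_fun_fin_finrank_span_eq ℂ
    {g | ∃ f ∈ vanishingPolys V, g = grad f (evalTuple ψ v₀)}
  choose G hG hGw using hG'
  have hev : ∀ v l, evalTuple (fun j => aeval ψ (pderiv j (G l))) v =
      grad (G l) (evalTuple ψ v) := fun v l =>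
    evalTuple_aeval ψ (fun j => pderiv j (G l)) v
  obtain ⟨δ, hδ0, hδ⟩ := exists_poly_linearIndependent (fun l j => aeval ψ (pderiv j (G l)))
    (v₀ := v₀) (by
      simp only [hev, ← hGw]
      exact hli)
  refine ⟨δ, hδ0, fun v hv => ?_⟩
  have h1 := hδ v hv
  simp only [hev] at h1
  have h2 : Submodule.span ℂ (Set.range fun l => grad (G l) (evalTuple ψ v)) ≤
      jacSpan V (evalTuple ψ v) := by
    refine Submodule.span_mono ?_
    rintro _ ⟨l, rfl⟩
    exact ⟨G l, hG l, rfl⟩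
  have h3 := Submodule.finrank_mono h2
  rw [finrank_span_eq_card h1, Fintype.card_fin] at h3
  exact h3

/-- The frame in `b` is useful only on the chart, so a new frame of homogeneous sections is chosen
at each point and pulled back by ψ. Its span lies in the closure by extension of sections and
contains the fibre by the rank bound. -/
theorem isProjectiveBundleOver (hψ : IsMultihomogeneous ψ)
    (b : ParamBundle (ParamSpace a d) P.variety ψ (ChartCoord a d) r)
    (hΦ : b.Φ = chart κ) :
    IsProjectiveBundleOver (zclosure b.total) (regularDomain ψ) r := by
  intro x₀ hx₀
  obtain ⟨v₀, hv₀⟩ := MultiProj.rep_exists x₀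
  obtain ⟨hiso, hreg⟩ := (mem_regularDomain hψ P hv₀).1 hx₀
  obtain ⟨y, hy⟩ := exists_point_of_nonisotropic hiso
  have hyV : y ∈ P.variety := mem_variety_of_rep hψ hy
  have hrank : Module.finrank ℂ (critSpace P.variety (evalTuple ψ v₀)) = r + 1 := by
    have h1 := finrank_critSpace hyV hy hiso
    have h2 := b.card_add
    rw [Sym2.card, Fintype.card_fin] at h2
    omega
  obtain ⟨F, hF, hli⟩ := exists_frame hyV hy hiso hrank
  have hev : ∀ v l, evalTuple (fun q => aeval ψ (F l q)) v = evalTuple (F l) (evalTuple ψ v) :=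
    fun v l => evalTuple_aeval ψ (F l) v
  obtain ⟨δ₁, hδ₁, hδ₁'⟩ := exists_poly_linearIndependent (fun l q => aeval ψ (F l q))
    (v₀ := v₀) (by simp only [hev]; exact hli)
  simp only [hev] at hδ₁'
  obtain ⟨δ₂, hδ₂, hδ₂'⟩ := exists_poly_finrank_jacSpan (ψ := ψ) (V := P.variety) v₀
  have hδ₃ : ∀ v, eval v (dotProduct ψ ψ) = dotProduct (evalTuple ψ v) (evalTuple ψ v) :=
    fun v => by simp [dotProduct, evalTuple]
  refine ⟨{x | ∃ v, HomCoords.Rep v x ∧ eval v (δ₁ * δ₂ * dotProduct ψ ψ) ≠ 0},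
    zOpen_nonvanishing _, ⟨v₀, hv₀, ?_⟩, ?_, fun l q => aeval ψ (F l q), fun l => ?_, ?_⟩
  · rw [map_mul, map_mul, hδ₃]
    exact mul_ne_zero (mul_ne_zero hδ₁ hδ₂) hiso
  · rintro x ⟨v, hv, hne⟩
    rw [map_mul, map_mul, mul_ne_zero_iff, mul_ne_zero_iff, hδ₃] at hne
    obtain ⟨⟨h1, h2⟩, h3⟩ := hne
    rw [mem_regularDomain hψ P hv]
    refine ⟨h3, ?_⟩
    obtain ⟨y', hy'⟩ := exists_point_of_nonisotropic h3
    have h4 := P.finrank_jacSpan_le (mem_variety_of_rep hψ hy') hy'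
    have h5 := hδ₂' v h2
    -- The rank of the Jacobian is at least its value at `x₀` by `δ₂` and at most that of a regular
    -- point everywhere on the variety, so the image stays regular.
    omega
  · obtain ⟨e, he⟩ := (hF l).2
    exact hψ.aeval he
  · rintro x ⟨v, hv, hne⟩ v' hv'
    rw [map_mul, map_mul, mul_ne_zero_iff, mul_ne_zero_iff, hδ₃] at hne
    obtain ⟨⟨h1, h2⟩, h3⟩ := hne
    obtain ⟨c, hc, hcv⟩ := hψ.exists_rep hv hv'
    choose e he using fun l => (hF l).2
    have hli' : LinearIndependent ℂ fun l => evalTuple (F l) (evalTuple ψ v') :=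
      linearIndependent_of_smul (fun l => pow_ne_zero (e l) hc) (fun l => by
        funext q
        rw [hcv]
        exact eval_smul_of_isHomogeneous (he l q) c _) (hδ₁' v h1)
    simp only [hev]
    refine ⟨hli', fun H h hh => ⟨fun hmem => ?_, fun hmem => ?_⟩⟩
    · exact b.mem_span_of_mem_zclosure hmem hv' hh (fun l => (hF l).1) hli'
    · have hiso' : dotProduct (evalTuple ψ v') (evalTuple ψ v') ≠ 0 := by
        rw [hcv, smul_dotProduct, dotProduct_smul]
        exact smul_ne_zero hc (smul_ne_zero hc h3)
      obtain ⟨y', hy'⟩ := exists_point_of_nonisotropic hiso'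
      refine b.mem_zclosure_total (mem_zclosure_base b hΦ x) hv' hiso' ?_ hh
      refine Submodule.span_le.2 ?_ hmem
      rintro _ ⟨l, rfl⟩
      exact (hF l).1 y' (mem_variety_of_rep hψ hy') _ hy'

/-! ## The Rayleigh–Ritz degree -/

theorem mem_criticalPoints {H : PSym n} {h : Sym2 (Fin n) → ℂ} (hh : HomCoords.Rep h H)
    {y : PSpace n} {w : Fin n → ℂ} (hw : HomCoords.Rep w y) :
    y ∈ criticalPoints P.variety H ↔ y ∈ P.variety ∧
      Module.finrank ℂ (jacSpan P.variety w) + Fintype.card (ChartCoord a d) + 1 = n ∧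
        dotProduct w w ≠ 0 ∧ h ∈ critSpace P.variety w := by
  have hcrit : ∀ {w' h'}, y ∈ P.variety → dotProduct w' w' ≠ 0 → HomCoords.Rep w' y →
      ((∀ u ∈ coneTangent P.variety w', fderiv ℂ (rayleigh (symMatrix h')) w' u = 0) ↔
        h' ∈ critSpace P.variety w') := fun hy h0 hw' => (mem_critSpace_iff hy hw' h0).symm
  constructor
  · rintro ⟨hreg, hiso, w', h', hw', hh', hu⟩
    obtain ⟨hy, hrank⟩ := (mem_regularLocus hw).1 hreg
    rw [mem_isotropicQuadric hw] at hiso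
    rw [hcrit hy (fun h0 => hiso ((mem_isotropicQuadric hw).1 ((mem_isotropicQuadric hw').2 h0)))
      hw'] at hu
    obtain ⟨c, hc, rfl⟩ := proj_rep_eq_smul hw hw'
    obtain ⟨c', hc', rfl⟩ := proj_rep_eq_smul hh hh'
    rw [critSpace_smul hc, Submodule.smul_mem_iff _ hc'] at hu
    exact ⟨hy, hrank, hiso, hu⟩
  · rintro ⟨hy, hrank, hiso, hmem⟩
    exact ⟨(mem_regularLocus hw).2 ⟨hy, hrank⟩, fun h0 => hiso ((mem_isotropicQuadric hw).1 h0),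
      w, h, hw, hh, (hcrit hy hiso hw).2 hmem⟩

theorem zIrreducible_univ {τ : Type} [Nonempty τ] :
    ZIrreducible (Set.univ : Set (ℙ ℂ (τ → ℂ))) := by
  have h0 : ∀ f ∈ vanIdeal (Set.univ : Set (ℙ ℂ (τ → ℂ))), f = 0 := by
    intro f hf
    obtain ⟨q⟩ := ‹Nonempty τ›
    refine eq_zero_of_eval_of_ne (X_ne_zero q) fun w hw => ?_
    rw [eval_X] at hw
    obtain ⟨x, hx⟩ := proj_exists_point (v := w) fun h => hw (congrFun h q)
    exact hf x trivial w hx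
  have hbot : vanIdeal (Set.univ : Set (ℙ ℂ (τ → ℂ))) = ⊥ := by
    rw [eq_bot_iff]
    exact fun f hf => h0 f hf
  refine zIrreducible_of_isPrime ?_ (hbot ▸ Ideal.isPrime_bot)
  obtain ⟨q⟩ := ‹Nonempty τ›
  obtain ⟨x, -⟩ := proj_exists_point (v := fun _ : τ => (1 : ℂ)) fun h =>
    one_ne_zero (congrFun h q)
  exact ⟨x, trivial⟩

theorem ForGeneral.of_poly {τ : Type} [Nonempty τ] {p : ℙ ℂ (τ → ℂ) → Prop}
    {δ : MvPolynomial τ ℂ} (hδ : δ ≠ 0)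
    (h : ∀ H h, HomCoords.Rep h H → eval h δ ≠ 0 → p H) : ForGeneral p := by
  obtain ⟨q⟩ := ‹Nonempty τ›
  obtain ⟨w, hw⟩ := exists_eval_ne_zero (mul_ne_zero hδ (X_ne_zero q))
  rw [map_mul, eval_X, mul_ne_zero_iff] at hw
  obtain ⟨x, hx⟩ := proj_exists_point (v := w) fun h => hw.2 (congrFun h q)
  refine ⟨{H | ∃ h, HomCoords.Rep h H ∧ eval h δ ≠ 0}, zOpen_nonvanishing δ, ⟨x, w, hx, hw.1⟩, ?_⟩
  rintro H ⟨h', hh, hne⟩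
  exact h H h' hh hne

/-- Projective space is irreducible, so the two open sets on which the counts hold have a common
matrix. -/
theorem IsRRDegree.unique [Nonempty (Sym2 (Fin n))] {V : Set (PSpace n)} {D D' : ℕ}
    (h : IsRRDegree V D) (h' : IsRRDegree V D') : D = D' := by
  obtain ⟨G, hG, ⟨x, hx⟩, hGD⟩ := h
  obtain ⟨G', hG', ⟨x', hx'⟩, hGD'⟩ := h'
  obtain ⟨H, -, hH, hH'⟩ := (zIrreducible_univ (τ := Sym2 (Fin n))).2 G G' hG hG'
    ⟨x, trivial, hx⟩ ⟨x', trivial, hx'⟩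
  exact (hGD H hH).2.symm.trans (hGD' H hH').2

/-- Over a general matrix, the critical points on the variety and the points of the closure of the
bundle correspond to the same parameters. -/
theorem exists_degree (f : P.Frame r)
    (b : ParamBundle (ParamSpace a d) P.variety ψ (ChartCoord a d) r)
    (hg : b.g = P.g) (hΦ : b.Φ = chart κ) :
    ∃ (D : ℕ) (δ : MvPolynomial (Sym2 (Fin n)) ℂ), δ ≠ 0 ∧ ∀ (H : PSym n) (h : Sym2 (Fin n) → ℂ),
      HomCoords.Rep h H → eval h δ ≠ 0 →
        ((criticalPoints P.variety H).Finite ∧ (criticalPoints P.variety H).ncard = D) ∧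
        {x : ParamSpace a d | (x, H) ∈ zclosure b.total}.Finite ∧
        {x : ParamSpace a d | (x, H) ∈ zclosure b.total}.ncard = D := by
  obtain ⟨b', hg', hΦ'⟩ := InvertibleParam.exists_imageBundle f
  obtain ⟨D, δ, hδ0, hδ⟩ := b.exists_card
  obtain ⟨δ₁, hδ₁, hδ₁'⟩ := b.exists_generic
  obtain ⟨δ₂, hδ₂, hδ₂'⟩ := b'.exists_generic
  have hX : ∀ w : Fin n → ℂ, evalTuple (X : Fin n → MvPolynomial (Fin n) ℂ) w = w := fun w => by
    funext j; simp [evalTuple]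
  -- The bundles over `U` and over the variety share the parameters `t`, and in the chart ψ is the
  -- parametrization of the variety; hence the two counts agree.
  have hfib : ∀ h, b'.fibre h = b.fibre h := by
    intro h
    ext t
    simp only [ParamBundle.fibre, hg, hg', hΦ, hΦ', hX, evalTuple_inChart]
  refine ⟨D, δ * δ₁ * δ₂, mul_ne_zero (mul_ne_zero hδ0 hδ₁) hδ₂, fun H h hh hne => ?_⟩
  rw [map_mul, map_mul, mul_ne_zero_iff, mul_ne_zero_iff] at hne
  obtain ⟨⟨h1, h2⟩, h3⟩ := hne
  obtain ⟨hfin, hcard⟩ := hδ h h1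
  constructor
  · rw [← hcard, ← hfib]
    refine b'.ncard_eq (fun y hy => ?_) (fun t ht y hy => ?_) (by rwa [hfib])
    · obtain ⟨w, hw⟩ := proj_rep_exists y
      obtain ⟨hyV, -, hiso, hmem⟩ := (mem_criticalPoints hh hw).1 hy
      have hbase : b'.base = P.image := by
        simp only [ParamBundle.base, InvertibleParam.image, hg', hΦ']
      -- A critical point need not be parametrized a priori, but it lies in the closure of the
      -- bundle over the variety; for general `H` it is then parametrized.
      have hcl := b'.mem_zclosure_total (x := y) (v := w) (hbase ▸ hyV) hw
        (by rwa [hX]) (by rwa [hX]) hh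
      obtain ⟨t, ht, hty, hmem'⟩ := hδ₂' y H h hh h3 hcl
      exact ⟨t, ⟨ht, hmem'⟩, hty⟩
    · obtain ⟨htg, hmem⟩ := ht
      rw [hX, hΦ'] at hmem
      rw [hg'] at htg
      rw [hΦ'] at hy
      exact (mem_criticalPoints hh hy).2 ⟨P.mem_variety htg hy, P.finrank_jacSpan htg,
        f.nonisotropic t htg, hmem⟩
  · rw [← hcard]
    refine b.ncard_eq (fun x hx => ?_) (fun t ht x hx => ?_) hfin
    · obtain ⟨t, ht, htx, hmem⟩ := hδ₁' x H h hh h2 hx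
      exact ⟨t, ⟨ht, hmem⟩, htx⟩
    · exact subset_zclosure _ ⟨t, h, ht.1, hx, hh, ht.2⟩

end

end RayleighRitz

end

/-! ### The main theorem -/

theorem theorem5p2 {k a n : ℕ} (d : Fin k → ℕ) (ψ : Fin n → MvPolynomial (Coord a d) ℂ)
    (hψ : IsMultihomogeneous ψ) (hbir : IsBirational ψ)
    (hQ : ¬ imageClosure ψ ⊆ isotropicQuadric n)
    (c : ℕ) (hc : zdim (imageClosure ψ) + c + 1 = n) :
    ZIrreducible (parametricCorrespondence ψ) ∧
    zdim (parametricCorrespondence ψ) + 1 = (n + 1).choose 2 ∧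
    IsProjectiveBundleOver (parametricCorrespondence ψ) (regularDomain ψ)
      ((n + 1).choose 2 + c - n) ∧
    (∃! D : ℕ, IsRRDegree (imageClosure ψ) D) ∧
    ∀ D : ℕ, IsRRDegree (imageClosure ψ) D →
      ForGeneral fun H : PSym n =>
        {x : ParamSpace a d | (x, H) ∈ parametricCorrespondence ψ}.Finite ∧
        {x : ParamSpace a d | (x, H) ∈ parametricCorrespondence ψ}.ncard = D := by
  obtain ⟨κ, ⟨P₀⟩⟩ := hbir.exists_invertibleParam hψ
  rw [imageClosure_eq hψ P₀] at hQ
  obtain ⟨P, -, r, ⟨f⟩⟩ := P₀.exists_frame hQ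
  obtain ⟨b, hg, hΦ⟩ := exists_domainBundle hψ f
  have hV := imageClosure_eq hψ P
  have hE := correspondence_eq hψ f hg hΦ
  have hN : Fintype.card (Sym2 (Fin n)) = (n + 1).choose 2 := by
    rw [Sym2.card, Fintype.card_fin]
  have hcard := f.card_add
  rw [hV, P.zdim_variety] at hc
  have hc' : Fintype.card (ChartCoord a d) + c + 1 = n := by exact_mod_cast hc
  -- The number of parameters is n − 1 − c, and together with `r + 1` it gives the number of matrix
  -- entries; in particular the natural subtraction is not truncated.
  have hr : (n + 1).choose 2 + c - n = r := by omega
  have hne : Nonempty (Sym2 (Fin n)) := Fintype.card_pos_iff.1 (by omega)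
  obtain ⟨D, δ, hδ0, hδ⟩ := exists_degree f b hg hΦ
  have hD : IsRRDegree P.variety D := ForGeneral.of_poly hδ0 fun H h hh hne => (hδ H h hh hne).1
  rw [hV, hE, hr]
  refine ⟨b.zIrreducible, ?_, isProjectiveBundleOver hψ b hΦ, ⟨D, hD, fun D' h => h.unique hD⟩,
    fun D' h => ?_⟩
  · rw [b.zdim_add_one, hN]
  · rw [h.unique hD]
    exact ForGeneral.of_poly hδ0 fun H h hh hne => (hδ H h hh hne).2
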